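/- Let $Q\subset E$ be a connected open subset of a finite-dimensional real vector space $E$, with an exact symplectic form $\omega=-\mathbf d\vartheta$, a smooth Hamiltonian $H:Q\to\mathbb R$ with Hamiltonian vector field $X_H$ (that is, $\omega(X_H,\cdot)=\mathbf dH$), and a smooth almost complex structure $\mathbb J$ compatible with $\omega$, so that $g(v,w)=\omega(v,\mathbb Jw)$ is a metric tensor. All data are $C^\infty$; $TQ=Q\times E$. Let $\theta_0\in\mathbb R$ be non-resonant, i.e. $\theta_0/2\pi\notin\mathbb Q$. For $\hbar\in\mathbb R$ set \[ S_\hbar(q,\overline q)=\int_0^1\vartheta_{q+t(\overline q-q)}(\overline q-q)\,dt+\Sigma_\hbar\Big(\frac{q+\overline q}{2},\,\overline q-q\Big), \] \[ \Sigma_\hbar(x,\xi)=-\hbar H(x)+\hbar^2 g_x(X_H,\xi)-\frac{\hbar^2}{12}\,(D\omega_x[X_H])(X_H,\xi)-\frac14\,\frac{\sin\theta_0}{1-\cos\theta_0}\,g_x(\xi-\hbar X_H,\xi-\hbar X_H), \] where $X_H=X_H(x)$ in the second formula. The symplectic Lorentz map $\Psi_\hbar:(q,v)\mapsto(\overline q,\overline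 v)$ is the map, smooth in $(q,v,\hbar)$ on an open neighbourhood of $\{\hbar=0\}$ in $TQ\times\mathbb R$, that is defined by the implicit relations \[ \vartheta_{\overline q}+\hbar^2 g_{\overline q}(\overline v,\cdot)=\partial_{\overline q}S_\hbar(q,\overline q),\qquad \vartheta_{q}+\hbar^2 g_{q}(v,\cdot)=-\partial_{q}S_\hbar(q,\overline q), \] on the branch with $\overline q=q$ at $\hbar=0$ (the line segment from $q$ to $\overline q$ is required to lie in $Q$). Claim. Such a map exists. Moreover, for each real $N>0$ there is an integer-valued function $k^*(\hbar,N)\ge 0$ of exact order $\hbar^{-N}$ as $\hbar\to0^+$ (bounded above and below by positive constant multiples of $\hbar^{-N}$ for small $\hbar>0$) with the following property. Let $\Psi$ be a symplectic Lorentz map, let $C\subset TQ$ be compact, and let $(q_\hbar,v_\hbar)$ be $\hbar$-dependent points such that, for all sufficiently small $\hbar>0$, $(q_\hbar,v_\hbar)$ is positively contained in $C$, i.e. $\Psi_\hbar^k(q_\hbar,v_\hbar)\in C$ for all integers $k\ge0$, and such that $v_\hbar=X_H(q_\hbar)+O(\hbar^{1/2})$ as $\hbar\to 0^+$. Put $(q^k,v^k)=\Psi_\hbar^k(q_\hbar,v_\hbar)$.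 Then \[ q^{k+1}=q^k+\hbar X_H(q^k)+\tfrac12\hbar^2\,DX_H(q^k)[X_H(q^k)]+O(\hbar^{5/2}),\qquad v^{k+1}=X_H(q^{k+1})+O(\hbar^{1/2}), \] for all $k\in[0,k^*(\hbar,N)]$, uniformly in $k$: there are $M$ and $\hbar_0>0$, independent of $\hbar$ and $k$, such that for all $0<\hbar<\hbar_0$ and all integers $0\le k\le k^*(\hbar,N)$ the two error terms have norm at most $M\hbar^{5/2}$ and $M\hbar^{1/2}$. -/

import Mathlib

open Set Filter Topology Asymptotics
open scoped ContDiff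

noncomputable section

/-- A Hamiltonian system on an exact symplectic manifold `(Q, ω = -dϑ)`, where `Q` is a connected
open subset of a finite-dimensional vector space `E`, together with an almost complex structure `J`
on `Q` compatible with `ω`. In the fields, `-dϑ` is written out: its value on `(v, w)` is
`Dϑ(q)[w](v) - Dϑ(q)[v](w)`. Nondegeneracy of `ω` on `Q` is a consequence of `J_pos`, see
`HamSystem.omega_nondegenerate`. -/
structure HamSystem (E : Type*) [NormedAddCommGroup E] [NormedSpace ℝ E] where
  /-- the configuration domain -/
  Q : Set E
  /-- the primitive one-form -/
  ϑ : E → E →L[ℝ] ℝ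
  /-- the Hamiltonian -/
  H : E → ℝ
  /-- the almost complex structure -/
  J : E → E →L[ℝ] E
  isOpen_Q : IsOpen Q
  isConnected_Q : IsConnected Q
  smooth_ϑ : ContDiffOn ℝ ∞ ϑ Q
  smooth_H : ContDiffOn ℝ ∞ H Q
  smooth_J : ContDiffOn ℝ ∞ J Q
  J_sq : ∀ q ∈ Q, ∀ v, J q (J q v) = -v
  J_symplectic : ∀ q ∈ Q, ∀ v w,
    fderiv ℝ ϑ q (J q w) (J q v) - fderiv ℝ ϑ q (J q v) (J q w)
      = fderiv ℝ ϑ q w v - fderiv ℝ ϑ q v w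
  J_pos : ∀ q ∈ Q, ∀ v, v ≠ 0 →
    0 < fderiv ℝ ϑ q (J q v) v - fderiv ℝ ϑ q v (J q v)

namespace HamSystem

variable {E : Type*} [NormedAddCommGroup E] [NormedSpace ℝ E] (D : HamSystem E)

/-- The symplectic form `ω = -dϑ`. -/
def omega (q : E) : E →L[ℝ] E →L[ℝ] ℝ := (fderiv ℝ D.ϑ q).flip - fderiv ℝ D.ϑ q

/-- The metric `g(v, w) = ω(v, J w)`. -/
def g (q v w : E) : ℝ := D.omega q v (D.J q w)

/-- The Hamiltonian vector field `X_H`, defined by `ω(X_H, ·) = dH`. -/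
def XH (q : E) : E := (D.omega q).inverse (fderiv ℝ D.H q)

theorem omega_apply (q v w : E) :
    D.omega q v w = fderiv ℝ D.ϑ q w v - fderiv ℝ D.ϑ q v w := by
  simp [omega]

theorem omega_nondegenerate {q : E} (hq : q ∈ D.Q) {v : E} (h : ∀ w, D.omega q v w = 0) :
    v = 0 := by
  by_contra hv
  have h1 := D.J_pos q hq v hv
  rw [← omega_apply, h] at h1
  exact lt_irrefl _ h1

theorem omega_isInvertible [FiniteDimensional ℝ E] {q : E} (hq : q ∈ D.Q) :
    (D.omega q).IsInvertible := by
  have hinj : Function.Injective (D.omega q : E →ₗ[ℝ] (E →L[ℝ] ℝ)) := by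
    rw [← LinearMap.ker_eq_bot, LinearMap.ker_eq_bot']
    intro v hv
    refine D.omega_nondegenerate hq (v := v) fun w => ?_
    have : D.omega q v = 0 := hv
    simp [this]
  have hdim : Module.finrank ℝ E = Module.finrank ℝ (E →L[ℝ] ℝ) := by
    rw [← (LinearMap.toContinuousLinearMap (𝕜 := ℝ) (E := E) (F' := ℝ)).finrank_eq]
    exact (Subspace.dual_finrank_eq (K := ℝ) (V := E)).symm
  exact ⟨(LinearEquiv.ofInjectiveOfFinrankEq _ hinj hdim).toContinuousLinearEquiv, by ext; rfl⟩

/-- Hamilton's equation `ω(X_H, ·) = dH` on `Q`. -/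
theorem omega_XH [FiniteDimensional ℝ E] {q : E} (hq : q ∈ D.Q) (w : E) :
    D.omega q (D.XH q) w = fderiv ℝ D.H q w := by
  obtain ⟨e, he⟩ := D.omega_isInvertible hq
  rw [XH, ← he, ContinuousLinearMap.inverse_equiv]
  simp

/-- The function `Σ(x, ξ)`, for the rotation angle `θ₀` and the parameter `ħ`. The third term is
`-(1/12) ħ² ∂ₖω_{jℓ} X_H^k X_H^j ξ^ℓ`. -/
def Sig (θ₀ ħ : ℝ) (x ξ : E) : ℝ :=
  -ħ * D.H x + ħ ^ 2 * D.g x (D.XH x) ξ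
    - (1 / 12) * ħ ^ 2 * fderiv ℝ D.omega x (D.XH x) (D.XH x) ξ
    - (1 / 4) * (Real.sin θ₀ / (1 - Real.cos θ₀)) * D.g x (ξ - ħ • D.XH x) (ξ - ħ • D.XH x)

/-- The generating function `S(q, q')`: the integral of `ϑ` along the straight line from `q` to
`q'`, plus `Σ` at the midpoint and the difference of `q` and `q'`. -/
def S (θ₀ ħ : ℝ) (q q' : E) : ℝ :=
  (∫ t in (0 : ℝ)..1, D.ϑ (q + t • (q' - q)) (q' - q))
    + D.Sig θ₀ ħ ((1 / 2 : ℝ) • q + (1 / 2 : ℝ) • q') (q' - q)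

/-- The implicit relations between `(q, v)` and its image `(q', v')`, which are required to be
joined by a line segment in `Q`, so that `S` is defined near `(q, q')`:
`ϑ_{q'} + ħ² g_{q'}(v', dq') = d_{q'} S` and `ϑ_q + ħ² g_q(v, dq) = - d_q S`. -/
def LorentzRel (θ₀ ħ : ℝ) (z z' : E × E) : Prop :=
  segment ℝ z.1 z'.1 ⊆ D.Q ∧
  (∀ w, D.ϑ z'.1 w + ħ ^ 2 * D.g z'.1 z'.2 w = fderiv ℝ (fun y => D.S θ₀ ħ z.1 y) z'.1 w) ∧
  (∀ w, D.ϑ z.1 w + ħ ^ 2 * D.g z.1 z.2 w = -fderiv ℝ (fun y => D.S θ₀ ħ y z'.1) z.1 w)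

/-- `Ψ` is (a representative of the germ at `ħ = 0` of) the symplectic Lorentz map: on an open
neighbourhood `U` of `{ħ = 0}` in `ℝ × TQ`, with `TQ = Q × E`, it is smooth in `(ħ, q, v)` and
solves the implicit relations, on the branch along which the base point of `Ψ_0(q, v)` is `q`. -/
def IsSymplecticLorentzMap (θ₀ : ℝ) (Ψ : ℝ → E × E → E × E) : Prop :=
  ∃ U : Set (ℝ × E × E), IsOpen U ∧
    (∀ p ∈ U, p.2.1 ∈ D.Q) ∧
    (∀ q ∈ D.Q, ∀ v, ((0 : ℝ), q, v) ∈ U) ∧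
    ContDiffOn ℝ ∞ (fun p : ℝ × E × E => Ψ p.1 p.2) U ∧
    (∀ q ∈ D.Q, ∀ v, (Ψ 0 (q, v)).1 = q) ∧
    ∀ p ∈ U, D.LorentzRel θ₀ p.1 p.2 (Ψ p.1 p.2)

end HamSystem

/-- All forward iterates of `z` under `F` stay in `C`. -/
def PositivelyContained {M : Type*} (F : M → M) (C : Set M) (z : M) : Prop :=
  ∀ k : ℕ, F^[k] z ∈ C

end

/-! ### Integrals depending on a parameter -/

section ParametricIntegral

universe u

/-! Put p = ħ²(v − X_H(q)), ξ = q̄ − q, κ = ξ − ħ X_H(midpoint) and c = sin θ₀ / (1 − cos θ₀).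
Because S changes sign when the endpoints are exchanged and ħ, θ₀ are negated (`S_neg`), the two
implicit relations express p and p̄ through one function `momentum` of (ħ, q, ξ) (`lorentzRel_iff`).
The terms of Σ are designed so that p = −½(J + c)κ up to O(|ħ|³ + |κ|(|ħ| + |κ|))
(`isBigO_momentum`). Since (J − c)(J + c) = −(1 + c²), this can be solved for κ, and (q, p) ↦ (q̄,
p̄) becomes a map F, smooth across ħ = 0 (`momentumMap`). After substituting p = ħ²(v − X_H), its p̄
is divisible by ħ²; this gives existence. Injectivity of ξ ↦ p near ħ = 0, ξ = 0 shows that every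
symplectic Lorentz map is given by F on a compact set for small ħ.

At ħ = 0 the map F fixes all points (q, 0), and its linearization there rotates p by R = cos θ₀ −
sin θ₀ J (`isNearlyPeriodicMap_momentumMap`). Expanding jointly in (ħ, p), one conjugates F, up to
any finite order, to a map commuting with these rotations (`exists_isNormalForm`). Each order
requires a cohomological equation over the rotation. Its data are trigonometric polynomials along
the orbits, so only finitely many of the numbers e^{ikθ₀} must differ from 1: irrationality
suffices, and no small-divisor estimate is needed (`exists_rotation_weights`).

The generating function makes F preserve the integrals of ϑ + ħ²g(v, ·) over closed curves exactly
(`integral_liouville_eq`). Evaluated on the images of the rotation orbits under the normal form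
transformation, they give an action that changes by only a high power of |(ħ, w)| in one step
(`exists_abs_action_sub_le`). To leading order it equals −π g(w, w), w being the fast normal form
coordinate, so it controls |w|² from both sides (`isTheta_action`); and w and p control each other
up to O(|ħ|³). Thus F has an adiabatic invariant of any order (`exists_adiabatic_invariant`).

Initially |p| = O(ħ^{5/2}), so the invariant is O(ħ⁵). With drift O(ħ^{⌈N⌉+5}) per step it remains
O(ħ⁵) for about ħ^{-N} steps, hence so does |p|². Dividing p by ħ² gives the velocity estimate, and
κ = O(ħ³ + |p|) gives the position estimate, the midpoint rule supplying the second-order Taylor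
term. Containment in the compact set C makes all the local estimates uniform. -/

theorem eventually_forall_Icc_of_forall_Icc {X : Type*} [TopologicalSpace X] {x₀ : X}
    {p : X × ℝ → Prop} (h : ∀ t ∈ Icc (0 : ℝ) 1, ∀ᶠ y in 𝓝 (x₀, t), p y) :
    ∀ᶠ x in 𝓝 x₀, ∀ t ∈ Icc (0 : ℝ) 1, p (x, t) :=
  isCompact_Icc.eventually_forall_of_forall_eventually fun t ht => h t ht

/-- Dominated convergence. Continuity is assumed near each point of the slice, not only on it, so
that neighbouring slices are measurable; compactness of [0, 1] supplies a constant dominating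
function. -/
theorem continuousAt_integral_param {X : Type*} [TopologicalSpace X] [FirstCountableTopology X]
    {V : Type*} [NormedAddCommGroup V] [NormedSpace ℝ V] {f : X × ℝ → V} {x₀ : X}
    (h : ∀ t ∈ Icc (0 : ℝ) 1, ∀ᶠ y in 𝓝 (x₀, t), ContinuousAt f y) :
    ContinuousAt (fun x => ∫ t in (0 : ℝ)..1, f (x, t)) x₀ := by
  have h1 := eventually_forall_Icc_of_forall_Icc h
  have hc : ContinuousOn (fun t => ‖f (x₀, t)‖ + 1) (Icc (0 : ℝ) 1) := fun t ht =>
    (((h1.self_of_nhds t ht).comp (f := fun t : ℝ => (x₀, t)) (by fun_prop)).norm.add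
      continuousAt_const).continuousWithinAt
  obtain ⟨C, hC⟩ : ∃ C, ∀ᶠ x in 𝓝 x₀, ∀ t ∈ Icc (0 : ℝ) 1, ‖f (x, t)‖ ≤ C := by
    have : ∀ t ∈ Icc (0 : ℝ) 1, ∀ᶠ y in 𝓝 (x₀, t), ‖f y‖ < ‖f (x₀, y.2)‖ + 2 := fun t ht => by
      have c1 := (h1.self_of_nhds t ht)
      have c2 : ContinuousAt (fun y : X × ℝ => ‖f (x₀, y.2)‖ + 2) (x₀, t) :=
        ((ContinuousAt.comp (f := fun y : X × ℝ => (x₀, y.2)) (by exact c1)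
          (by fun_prop)).norm).add continuousAt_const
      exact c1.norm.eventually_lt c2 (by simp)
    obtain ⟨C, hC⟩ := (isCompact_Icc.image_of_continuousOn hc).bddAbove
    refine ⟨C + 1, (eventually_forall_Icc_of_forall_Icc this).mono fun x hx t ht => ?_⟩
    have := hC ⟨t, ht, rfl⟩
    have h3 := hx t ht
    simp only at this h3
    linarith
  refine intervalIntegral.continuousAt_of_dominated_interval (bound := fun _ => C) ?_ ?_ ?_ ?_
  · filter_upwards [h1] with x hx
    rw [uIoc_of_le zero_le_one]
    refine ContinuousOn.aestronglyMeasurable (fun t ht => ?_) measurableSet_Ioc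
    exact ((hx t (Ioc_subset_Icc_self ht)).comp (f := fun t : ℝ => (x, t))
      (by fun_prop)).continuousWithinAt
  · filter_upwards [hC] with x hx
    refine Eventually.of_forall fun t ht => ?_
    rw [uIoc_of_le zero_le_one] at ht
    exact hx t (Ioc_subset_Icc_self ht)
  · exact intervalIntegrable_const
  · refine Eventually.of_forall fun t ht => ?_
    rw [uIoc_of_le zero_le_one] at ht
    exact (h1.self_of_nhds t (Ioc_subset_Icc_self ht)).comp (f := fun x => (x, t))
      (by fun_prop)

theorem hasFDerivAt_integral_param {X : Type*} [NormedAddCommGroup X] [NormedSpace ℝ X]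
    {V : Type*} [NormedAddCommGroup V] [NormedSpace ℝ V] {f : X × ℝ → V} {x₀ : X}
    (h : ∀ t ∈ Icc (0 : ℝ) 1, ContDiffAt ℝ 1 f (x₀, t)) :
    HasFDerivAt (fun x => ∫ t in (0 : ℝ)..1, f (x, t))
      (∫ t in (0 : ℝ)..1, (fderiv ℝ f (x₀, t)).comp (ContinuousLinearMap.inl ℝ X ℝ)) x₀ := by
  set f' : X × ℝ → X →L[ℝ] V :=
    fun y => (fderiv ℝ f y).comp (ContinuousLinearMap.inl ℝ X ℝ) with hf'
  have h1 : ∀ᶠ x in 𝓝 x₀, ∀ t ∈ Icc (0 : ℝ) 1, ContDiffAt ℝ 1 f (x, t) :=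
    eventually_forall_Icc_of_forall_Icc fun t ht => (h t ht).eventually (by simp)
  have hf'c : ∀ y, ContDiffAt ℝ 1 f y → ContinuousAt f' y := fun y hy =>
    (((hy.fderiv_right (m := 0) le_rfl).continuousAt).clm_comp continuousAt_const)
  obtain ⟨C, hC⟩ : ∃ C, ∀ᶠ x in 𝓝 x₀, ∀ t ∈ Icc (0 : ℝ) 1, ‖f' (x, t)‖ ≤ C := by
    have hc : ContinuousOn (fun t => ‖f' (x₀, t)‖) (Icc (0 : ℝ) 1) := fun t ht =>
      ((hf'c _ (h t ht)).comp (f := fun t : ℝ => (x₀, t)) (by fun_prop)).norm.continuousWithinAt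
    have : ∀ t ∈ Icc (0 : ℝ) 1, ∀ᶠ y in 𝓝 (x₀, t), ‖f' y‖ < ‖f' (x₀, y.2)‖ + 2 := fun t ht => by
      have c1 := hf'c _ (h t ht)
      have c2 : ContinuousAt (fun y : X × ℝ => ‖f' (x₀, y.2)‖ + 2) (x₀, t) :=
        ((ContinuousAt.comp (f := fun y : X × ℝ => (x₀, y.2)) (g := f')
          (x := (x₀, t)) c1 (by fun_prop)).norm).add continuousAt_const
      exact c1.norm.eventually_lt c2 (by simp)
    obtain ⟨C, hC⟩ := (isCompact_Icc.image_of_continuousOn hc).bddAbove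
    refine ⟨C + 2, (eventually_forall_Icc_of_forall_Icc this).mono fun x hx t ht => ?_⟩
    have := hC ⟨t, ht, rfl⟩
    have h3 := hx t ht
    simp only at this h3
    linarith
  refine intervalIntegral.hasFDerivAt_integral_of_dominated_of_fderiv_le
    (F := fun x t => f (x, t)) (F' := fun x t => f' (x, t)) (bound := fun _ => C)
    (s := {x | (∀ t ∈ Icc (0 : ℝ) 1, ContDiffAt ℝ 1 f (x, t)) ∧
      ∀ t ∈ Icc (0 : ℝ) 1, ‖f' (x, t)‖ ≤ C}) (inter_mem h1 hC) ?_ ?_ ?_ ?_ ?_ ?_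
  · filter_upwards [h1] with x hx
    rw [uIoc_of_le zero_le_one]
    exact ((continuousOn_of_forall_continuousAt fun t ht =>
      ((hx t ht).continuousAt.comp (f := fun t : ℝ => (x, t)) (by fun_prop))).mono
        Ioc_subset_Icc_self).aestronglyMeasurable measurableSet_Ioc
  · refine ContinuousOn.intervalIntegrable ?_
    rw [uIcc_of_le zero_le_one]
    exact continuousOn_of_forall_continuousAt fun t ht =>
      ((h t ht).continuousAt.comp (f := fun t : ℝ => (x₀, t)) (by fun_prop))
  · rw [uIoc_of_le zero_le_one]
    exact ((continuousOn_of_forall_continuousAt fun t ht =>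
      ((hf'c _ (h t ht)).comp (f := fun t : ℝ => (x₀, t)) (by fun_prop))).mono
        Ioc_subset_Icc_self).aestronglyMeasurable measurableSet_Ioc
  · refine Eventually.of_forall fun t ht x hx => hx.2 t ?_
    rw [uIoc_of_le zero_le_one] at ht
    exact Ioc_subset_Icc_self ht
  · exact intervalIntegrable_const
  · refine Eventually.of_forall fun t ht x hx => ?_
    rw [uIoc_of_le zero_le_one] at ht
    have h3 := ((hx.1 t (Ioc_subset_Icc_self ht)).differentiableAt (by simp)).hasFDerivAt
    exact h3.comp (f := fun x => (x, t)) x (hasFDerivAt_prodMk_left x t)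

/-- Induction on the order: the derivative is an integral of the same kind with values in X →L V.
Hence V is quantified inside the induction and shares its universe with X. -/
theorem contDiffAt_integral_param_nat {X : Type u} [NormedAddCommGroup X] [NormedSpace ℝ X]
    (n : ℕ) : ∀ {V : Type u} [NormedAddCommGroup V] [NormedSpace ℝ V] {f : X × ℝ → V} {x₀ : X},
    (∀ t ∈ Icc (0 : ℝ) 1, ContDiffAt ℝ n f (x₀, t)) →
    ContDiffAt ℝ n (fun x => ∫ t in (0 : ℝ)..1, f (x, t)) x₀ := by
  induction n with
  | zero =>
    intro V _ _ f x₀ h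
    have h1 : ∀ᶠ x in 𝓝 x₀, ∀ t ∈ Icc (0 : ℝ) 1, ContDiffAt ℝ 0 f (x, t) :=
      eventually_forall_Icc_of_forall_Icc fun t ht => by
        have := (h t ht).eventually (by simp)
        simpa using this
    rw [Nat.cast_zero, contDiffAt_zero]
    refine ⟨_, h1, fun x hx => ContinuousAt.continuousWithinAt ?_⟩
    exact continuousAt_integral_param fun t ht =>
      ((hx t ht).eventually (by simp)).mono fun y hy => hy.continuousAt
  | succ n ih =>
    intro V _ _ f x₀ h
    have h1 : ∀ᶠ x in 𝓝 x₀, ∀ t ∈ Icc (0 : ℝ) 1, ContDiffAt ℝ (n + 1 : ℕ) f (x, t) :=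
      eventually_forall_Icc_of_forall_Icc fun t ht => (h t ht).eventually (by simp)
    have h2 : ContDiffAt ℝ (n + 1) (fun x => ∫ t in (0 : ℝ)..1, f (x, t)) x₀ := by
      rw [contDiffAt_succ_iff_hasFDerivAt]
      refine ⟨fun x => ∫ t in (0 : ℝ)..1,
        (fderiv ℝ f (x, t)).comp (ContinuousLinearMap.inl ℝ X ℝ), ⟨_, h1, fun x hx => ?_⟩, ?_⟩
      · exact hasFDerivAt_integral_param fun t ht => (hx t ht).of_le (by simp)
      · refine ih (f := fun y => (fderiv ℝ f y).comp (ContinuousLinearMap.inl ℝ X ℝ)) fun t ht => ?_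
        exact ((h t ht).fderiv_right (by simp)).clm_comp contDiffAt_const
    exact_mod_cast h2

/-- The integral over `[0, 1]` of a smooth function is a smooth function of the parameters. -/
theorem contDiffAt_integral_param {X V : Type u} [NormedAddCommGroup X] [NormedSpace ℝ X]
    [NormedAddCommGroup V] [NormedSpace ℝ V] {f : X × ℝ → V} {x₀ : X}
    (h : ∀ t ∈ Icc (0 : ℝ) 1, ContDiffAt ℝ ∞ f (x₀, t)) :
    ContDiffAt ℝ ∞ (fun x => ∫ t in (0 : ℝ)..1, f (x, t)) x₀ := by
  rw [contDiffAt_infty]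
  exact fun n => contDiffAt_integral_param_nat n fun t ht => (contDiffAt_infty.1 (h t ht)) n

end ParametricIntegral

/-! ### Maps that are injective near a set of fixed points -/

section FixedPoints

variable {Y : Type*} [NormedAddCommGroup Y] [NormedSpace ℝ Y] [CompleteSpace Y]

/-- Local injectivity becomes injectivity on one neighbourhood because the points of A are fixed. If
x is near a, y is near b and G x = G y, then a and b are both near this common value, hence near
each other, and x, y lie in the injectivity ball of whichever centre has the larger radius. -/
theorem exists_isOpen_injOn_of_forall_fixed {G : Y → Y} {A O : Set Y} (hO : IsOpen O)
    (hAO : A ⊆ O) (hfix : ∀ a ∈ A, G a = a)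
    (hG : ∀ a ∈ A, ∃ e : Y ≃L[ℝ] Y, HasStrictFDerivAt G (e : Y →L[ℝ] Y) a) :
    ∃ V, IsOpen V ∧ A ⊆ V ∧ V ⊆ O ∧ InjOn G V := by
  have h1 : ∀ a ∈ A, ∃ r > 0, Metric.ball a (2 * r) ⊆ O ∧ InjOn G (Metric.ball a (2 * r)) := by
    intro a ha
    obtain ⟨e, he⟩ := hG a ha
    have hs : (he.toOpenPartialHomeomorph G).source ∈ 𝓝 a :=
      (he.toOpenPartialHomeomorph G).open_source.mem_nhds
        he.mem_toOpenPartialHomeomorph_source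
    obtain ⟨r, hr, hr2⟩ := Metric.mem_nhds_iff.1 (inter_mem (hO.mem_nhds (hAO ha)) hs)
    refine ⟨r / 2, by positivity, ?_, ?_⟩
    · rw [mul_div_cancel₀ _ two_ne_zero]; exact fun x hx => (hr2 hx).1
    · rw [mul_div_cancel₀ _ two_ne_zero]
      exact (he.toOpenPartialHomeomorph G).injOn.mono fun x hx => (hr2 hx).2
  choose! r hr hrO hrinj using h1
  have h2 : ∀ a ∈ A, ∃ δ > 0, δ ≤ r a / 4 ∧ ∀ x ∈ Metric.ball a δ, dist (G x) a < r a / 4 := by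
    intro a ha
    obtain ⟨e, he⟩ := hG a ha
    have hc : ContinuousAt G a := he.hasFDerivAt.continuousAt
    obtain ⟨δ, hδ, hδ2⟩ := Metric.continuousAt_iff.1 hc (r a / 4) (by linarith [hr a ha])
    refine ⟨min δ (r a / 4), lt_min hδ (by linarith [hr a ha]), min_le_right _ _, fun x hx => ?_⟩
    have := hδ2 (lt_of_lt_of_le (Metric.mem_ball.1 hx) (min_le_left _ _))
    rwa [hfix a ha] at this
  choose! δ hδ hδr hδG using h2
  refine ⟨⋃ a ∈ A, Metric.ball a (δ a), isOpen_biUnion fun _ _ => Metric.isOpen_ball,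
    fun a ha => mem_biUnion ha (Metric.mem_ball_self (hδ a ha)), ?_, ?_⟩
  · refine iUnion₂_subset fun a ha => (Metric.ball_subset_ball ?_).trans (hrO a ha)
    linarith [hr a ha, hδr a ha]
  · have key : ∀ a ∈ A, ∀ b ∈ A, r b ≤ r a → ∀ x ∈ Metric.ball a (δ a),
        ∀ y ∈ Metric.ball b (δ b), G x = G y → x = y := by
      intro a ha b hb hab x hx y hy hxy
      refine hrinj a ha ?_ ?_ hxy
      · exact Metric.ball_subset_ball (by linarith [hr a ha, hδr a ha]) hx
      · have e1 := hδG a ha x hx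
        have e2 := hδG b hb y hy
        rw [Metric.mem_ball] at hy ⊢
        have e3 := dist_triangle y b a
        have e4 := dist_triangle b (G y) a
        rw [hxy] at e1
        rw [dist_comm b (G y)] at e4
        linarith [hr a ha, hδr b hb]
    intro x hx y hy hxy
    obtain ⟨a, ha, hxa⟩ := mem_iUnion₂.1 hx
    obtain ⟨b, hb, hyb⟩ := mem_iUnion₂.1 hy
    rcases le_total (r b) (r a) with h | h
    · exact key a ha b hb h x hxa y hyb hxy
    · exact (key b hb a ha h y hyb x hxa hxy.symm).symm

/-- Near G v the local inverse takes values in V, where injectivity forces it to agree with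
`invFunOn`. Thus one globally defined inverse is smooth at all image points at once. -/
theorem contDiffAt_invFunOn {G : Y → Y} {V : Set Y} (hV : IsOpen V) (hinj : InjOn G V) {v : Y}
    (hv : v ∈ V) {n : WithTop ℕ∞} (hn : n ≠ 0) (hG : ContDiffAt ℝ n G v) {e : Y ≃L[ℝ] Y}
    (he : HasFDerivAt G (e : Y →L[ℝ] Y) v) :
    ContDiffAt ℝ n (Function.invFunOn G V) (G v) ∧
      ∀ᶠ z in 𝓝 (G v), Function.invFunOn G V z ∈ V ∧ G (Function.invFunOn G V z) = z := by
  have hs : HasStrictFDerivAt G (e : Y →L[ℝ] Y) v := hG.hasStrictFDerivAt' he hn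
  have h1 := hG.to_localInverse he hn
  have h2 : ∀ᶠ z in 𝓝 (G v), hs.localInverse G e v z ∈ V := by
    have h3 := hs.localInverse_continuousAt
    refine h3.eventually_mem (hV.mem_nhds ?_)
    rwa [hs.localInverse_apply_image]
  have h3 : ∀ᶠ z in 𝓝 (G v), Function.invFunOn G V z ∈ V ∧ G (Function.invFunOn G V z) = z := by
    filter_upwards [h2, hs.eventually_right_inverse] with z hz1 hz2
    have hz : ∃ a ∈ V, G a = z := ⟨_, hz1, hz2⟩
    exact ⟨Function.invFunOn_mem hz, Function.invFunOn_eq hz⟩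
  refine ⟨h1.congr_of_eventuallyEq ?_, h3⟩
  filter_upwards [h2, hs.eventually_right_inverse, h3] with z hz1 hz2 hz3
  exact hinj hz3.1 hz1 (hz3.2.trans hz2.symm)

end FixedPoints

/-! ### First-order estimates near a point -/

section Estimates

variable {Y V : Type*} [NormedAddCommGroup Y] [NormedSpace ℝ Y] [NormedAddCommGroup V]
  [NormedSpace ℝ V]

theorem ContDiffAt.isBigO_sub_nhds {f : Y → V} {a : Y} {n : WithTop ℕ∞} (hf : ContDiffAt ℝ n f a)
    (hn : n ≠ 0) : (fun p : Y × Y => f p.1 - f p.2) =O[𝓝 (a, a)] fun p => p.1 - p.2 :=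
  (hf.hasStrictFDerivAt hn).isBigO_sub

/-- The mean value inequality with a locally Lipschitz derivative. The point of differentiation is
independent of the two others so that it can be taken in {(0, q, 0)}, where derivatives are
explicitly known. -/
theorem ContDiffAt.isBigO_sub_sub_fderiv {f : Y → V} {a : Y} {n : WithTop ℕ∞}
    (hf : ContDiffAt ℝ n f a) (hn : 2 ≤ n) :
    (fun p : Y × Y × Y => f p.1 - f p.2.1 - fderiv ℝ f p.2.2 (p.1 - p.2.1)) =O[𝓝 (a, a, a)]
      fun p => (‖p.1 - p.2.2‖ + ‖p.2.1 - p.2.2‖) * ‖p.1 - p.2.1‖ := by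
  have hf2 : ContDiffAt ℝ 2 f a := hf.of_le hn
  obtain ⟨K, t, ht, hK⟩ := (hf2.fderiv_right (m := 1) (by norm_num)).exists_lipschitzOnWith
  obtain ⟨r, hr, hrt⟩ := Metric.mem_nhds_iff.1
    (inter_mem ht (hf2.eventually (by simp)))
  refine IsBigO.of_bound K ?_
  have hb : Metric.ball a r ∈ 𝓝 a := Metric.ball_mem_nhds a hr
  filter_upwards [prod_mem_nhds hb (prod_mem_nhds hb hb)] with ⟨u, v, x⟩ ⟨hu, hv, hx⟩
  have hseg : segment ℝ v u ⊆ Metric.ball a r := (convex_ball a r).segment_subset hv hu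
  have h1 : ∀ y ∈ segment ℝ v u, ‖fderiv ℝ f y - fderiv ℝ f x‖ ≤
      K * (‖u - x‖ + ‖v - x‖) := by
    intro y hy
    refine (hK.norm_sub_le (hrt (hseg hy)).1 (hrt hx).1).trans ?_
    refine mul_le_mul_of_nonneg_left ?_ K.2
    have h2 : y ∈ Metric.closedBall x (max ‖u - x‖ ‖v - x‖) :=
      (convex_closedBall x _).segment_subset
        (by simp [dist_eq_norm]) (by simp [dist_eq_norm]) hy
    rw [mem_closedBall_iff_norm] at h2
    exact h2.trans (max_le_add_of_nonneg (norm_nonneg _) (norm_nonneg _))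
  have h2 := (convex_segment v u).norm_image_sub_le_of_norm_hasFDerivWithin_le'
    (f := f) (f' := fun y => fderiv ℝ f y) (φ := fderiv ℝ f x)
    (fun y hy => ((ContDiffAt.differentiableAt (n := 2) (hrt (hseg hy)).2
      (by simp)).hasFDerivAt).hasFDerivWithinAt)
    h1 (left_mem_segment ℝ v u) (right_mem_segment ℝ v u)
  refine h2.trans (le_of_eq ?_)
  dsimp only
  rw [Real.norm_of_nonneg (by positivity), mul_assoc]

end Estimates

/-! ### Taylor terms along a projection -/

section TaylorTerm

variable {Y V : Type*} [NormedAddCommGroup Y] [NormedSpace ℝ Y] [NormedAddCommGroup V]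
  [NormedSpace ℝ V] (π : Y →L[ℝ] Y)

/-- Homogeneity of degree `j` in the directions of the range of the projection `π`. -/
def IsHomogeneousAlong (j : ℕ) (γ : Y → V) : Prop :=
  ∀ (y : Y) (t : ℝ), γ (y - π y + t • π y) = t ^ j • γ y

/-- The degree `j` term of the Taylor expansion of `f` at `y - π y` in the direction `π y`. -/
noncomputable def taylorTerm (j : ℕ) (f : Y → V) (y : Y) : V :=
  (j.factorial : ℝ)⁻¹ • iteratedFDeriv ℝ j f (y - π y) fun _ => π y

variable {π}

theorem norm_sub_add_smul_le {a y : Y} (ha : π a = 0) {t : ℝ} (ht : t ∈ Icc (0 : ℝ) 1) :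
    ‖y - π y + t • π y - a‖ ≤ (1 + ‖π‖) * ‖y - a‖ := by
  have h1 : y - π y + t • π y - a = (y - a) - (1 - t) • π (y - a) := by
    rw [map_sub, ha, sub_zero, sub_smul, one_smul]; abel
  rw [h1, add_mul, one_mul]
  refine (norm_sub_le _ _).trans (add_le_add le_rfl ?_)
  rw [norm_smul, Real.norm_of_nonneg (by linarith [ht.2])]
  calc (1 - t) * ‖π (y - a)‖ ≤ 1 * ‖π (y - a)‖ := by gcongr; linarith [ht.1]
    _ ≤ ‖π‖ * ‖y - a‖ := by rw [one_mul]; exact π.le_opNorm _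

theorem eventually_forall_sub_add_smul {a : Y} (ha : π a = 0) {p : Y → Prop}
    (hp : ∀ᶠ y in 𝓝 a, p y) : ∀ᶠ y in 𝓝 a, ∀ t ∈ Icc (0 : ℝ) 1, p (y - π y + t • π y) := by
  obtain ⟨r, hr, h⟩ := Metric.eventually_nhds_iff_ball.1 hp
  have h0 : 0 < 1 + ‖π‖ := by positivity
  refine Metric.eventually_nhds_iff_ball.2 ⟨r / (1 + ‖π‖), by positivity, fun y hy t ht => ?_⟩
  refine h _ ?_
  rw [mem_ball_iff_norm] at hy ⊢
  refine (norm_sub_add_smul_le ha ht).trans_lt ?_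
  rwa [lt_div_iff₀' h0] at hy

theorem isHomogeneousAlong_taylorTerm (hπ : ∀ y, π (π y) = π y) (j : ℕ) (f : Y → V) :
    IsHomogeneousAlong π j (taylorTerm π j f) := by
  intro y t
  have h1 : π (y - π y + t • π y) = t • π y := by simp [hπ]
  have h2 : y - π y + t • π y - t • π y = y - π y := by abel
  rw [taylorTerm, taylorTerm, h1, h2]
  rw [(iteratedFDeriv ℝ j f (y - π y)).map_smul_univ (fun _ => t) (fun _ => π y), smul_comm]
  simp only [Finset.prod_const, Finset.card_univ, Fintype.card_fin]

theorem contDiffAt_taylorTerm [CompleteSpace V] (j : ℕ) {f : Y → V} {y : Y} (hf : ContDiffAt ℝ ∞ f (y - π y)) :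
    ContDiffAt ℝ ∞ (taylorTerm π j f) y := by
  have h1 : ContDiffAt ℝ ∞ (iteratedFDeriv ℝ j f) (y - π y) :=
    hf.iteratedFDeriv_right (by exact_mod_cast le_top)
  have h2 : ContDiffAt ℝ ∞ (fun y => iteratedFDeriv ℝ j f (y - π y)) y :=
    ContDiffAt.comp y h1 (by fun_prop)
  refine contDiffAt_const.smul ?_
  have h3 : ContDiffAt ℝ ∞ (fun p : (Y [×j]→L[ℝ] V) × (Fin j → Y) => p.1 p.2)
      (iteratedFDeriv ℝ j f (y - π y), fun _ => π y) :=
    ((ContinuousLinearMap.id ℝ (Y [×j]→L[ℝ] V)).analyticAt_uncurry_of_multilinear).contDiffAt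
  exact ContDiffAt.comp (f := fun y => (iteratedFDeriv ℝ j f (y - π y), fun _ => π y)) y h3
    (h2.prodMk (by fun_prop))

theorem isBigO_sub_sum_taylorTerm [CompleteSpace V] {f : Y → V} {a : Y} (ha : π a = 0)
    (hf : ContDiffAt ℝ ∞ f a) (j : ℕ) :
    (fun y => f y - ∑ i ∈ Finset.range (j + 1), taylorTerm π i f y) =O[𝓝 a]
      fun y => ‖π y‖ ^ (j + 1) := by
  have h1 : ∀ᶠ y in 𝓝 a, ContDiffAt ℝ (j + 1 : ℕ) f y :=
    ((contDiffAt_infty.1 hf) (j + 1)).eventually (by simp)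
  have h2 : ∀ᶠ y in 𝓝 a, ‖iteratedFDeriv ℝ (j + 1) f y‖ ≤ ‖iteratedFDeriv ℝ (j + 1) f a‖ + 1 := by
    have : ContinuousAt (iteratedFDeriv ℝ (j + 1) f) a :=
      (hf.iteratedFDeriv_right (m := 0) (by simp; exact_mod_cast le_top)).continuousAt
    exact (this.norm.eventually_lt continuousAt_const (by simp)).mono fun y hy => hy.le
  set C := ‖iteratedFDeriv ℝ (j + 1) f a‖ + 1
  refine IsBigO.of_bound ((j.factorial : ℝ)⁻¹ * C) ?_
  filter_upwards [eventually_forall_sub_add_smul ha (h1.and h2)] with y hy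
  have h3 := map_add_eq_sum_add_integral_iteratedFDeriv (f := f) (x := y - π y) (y := π y)
    (n := j) fun t ht => by exact_mod_cast (hy t ht).1
  rw [sub_add_cancel] at h3
  have h4 : f y - ∑ i ∈ Finset.range (j + 1), taylorTerm π i f y =
      (j.factorial : ℝ)⁻¹ • ∫ t in (0 : ℝ)..1, (1 - t) ^ j •
        iteratedFDeriv ℝ (j + 1) f (y - π y + t • π y) fun _ => π y := by
    rw [h3]; simp [taylorTerm]
  rw [h4, norm_smul, norm_inv, Real.norm_natCast, mul_assoc]
  refine mul_le_mul_of_nonneg_left ?_ (by positivity)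
  have h5 : ∀ t ∈ uIoc (0 : ℝ) 1, ‖(1 - t) ^ j •
      iteratedFDeriv ℝ (j + 1) f (y - π y + t • π y) fun _ => π y‖ ≤ C * ‖π y‖ ^ (j + 1) := by
    intro t ht
    rw [uIoc_of_le zero_le_one] at ht
    have ht' := Ioc_subset_Icc_self ht
    rw [norm_smul, norm_pow, Real.norm_of_nonneg (by linarith [ht.2])]
    have e1 : (1 - t) ^ j ≤ 1 := pow_le_one₀ (by linarith [ht.2]) (by linarith [ht.1])
    have e2 := (iteratedFDeriv ℝ (j + 1) f (y - π y + t • π y)).le_opNorm fun _ => π y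
    simp only [Finset.prod_const, Finset.card_univ, Fintype.card_fin] at e2
    calc _ ≤ 1 * (‖iteratedFDeriv ℝ (j + 1) f (y - π y + t • π y)‖ * ‖π y‖ ^ (j + 1)) := by
            gcongr
      _ ≤ _ := by rw [one_mul]; gcongr; exact (hy t ht').2
  have h6 := intervalIntegral.norm_integral_le_of_norm_le_const h5
  simpa using h6

/-- A polynomial in t of degree below j that is O(t^j) vanishes, by removing the coefficients one
after another from the lowest. -/
theorem eq_zero_of_sum_pow_smul_le {j : ℕ} {c : ℕ → V} {C : ℝ}
    (h : ∀ t ∈ Ioc (0 : ℝ) 1, ‖∑ i ∈ Finset.range j, t ^ i • c i‖ ≤ C * t ^ j) :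
    ∀ i < j, c i = 0 := by
  intro i
  induction i using Nat.strong_induction_on with
  | _ i ih =>
  intro hij
  -- Coefficients below i vanish by induction and those above i are bounded with a spare factor t;
  -- dividing by t^i leaves ‖c i‖ ≤ D t, and t tends to 0.
  set D := C + ∑ k ∈ Finset.range j, ‖c k‖ with hD
  have h1 : ∀ t ∈ Ioc (0 : ℝ) 1, ‖c i‖ ≤ D * t := by
    intro t ht
    have ht0 : 0 < t := ht.1
    have e1 : ∑ k ∈ Finset.range j, t ^ k • c k =
        t ^ i • c i + ∑ k ∈ (Finset.range j).erase i, t ^ k • c k :=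
      (Finset.add_sum_erase _ _ (Finset.mem_range.2 hij)).symm
    have hle : ∀ k, i < k → t ^ k ≤ t ^ (i + 1) := fun k hk =>
      pow_le_pow_of_le_one ht0.le ht.2 hk
    have e2 : ‖∑ k ∈ (Finset.range j).erase i, t ^ k • c k‖ ≤
        ∑ k ∈ (Finset.range j).erase i, t ^ (i + 1) * ‖c k‖ := by
      refine norm_sum_le_of_le _ fun k hk => ?_
      rw [Finset.mem_erase, Finset.mem_range] at hk
      rcases lt_or_gt_of_ne hk.1 with h2 | h2
      · rw [ih k h2 hk.2]; simp
      · rw [norm_smul, norm_pow, Real.norm_of_nonneg ht0.le]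
        exact mul_le_mul_of_nonneg_right (hle k h2) (norm_nonneg _)
    have e3 : ∑ k ∈ (Finset.range j).erase i, t ^ (i + 1) * ‖c k‖ ≤
        t ^ (i + 1) * ∑ k ∈ Finset.range j, ‖c k‖ := by
      rw [← Finset.mul_sum]
      refine mul_le_mul_of_nonneg_left ?_ (by positivity)
      exact Finset.sum_le_sum_of_subset_of_nonneg (Finset.erase_subset _ _)
        fun _ _ _ => norm_nonneg _
    have hC : 0 ≤ C := by
      have := (norm_nonneg _).trans (h 1 ⟨one_pos, le_rfl⟩)
      simpa using this
    have e4 : t ^ i * ‖c i‖ ≤ t ^ i * (D * t) := by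
      have : t ^ i • c i = (∑ k ∈ Finset.range j, t ^ k • c k) -
          ∑ k ∈ (Finset.range j).erase i, t ^ k • c k := by rw [e1]; abel
      calc t ^ i * ‖c i‖ = ‖t ^ i • c i‖ := by
            rw [norm_smul, norm_pow, Real.norm_of_nonneg ht0.le]
        _ ≤ C * t ^ j + t ^ (i + 1) * ∑ k ∈ Finset.range j, ‖c k‖ := by
            rw [this]
            exact (norm_sub_le _ _).trans (add_le_add (h t ht) (e2.trans e3))
        _ ≤ C * t ^ (i + 1) + t ^ (i + 1) * ∑ k ∈ Finset.range j, ‖c k‖ := by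
            gcongr ?_ + _; exact mul_le_mul_of_nonneg_left (hle j hij) hC
        _ = t ^ i * (D * t) := by rw [hD]; ring
    exact le_of_mul_le_mul_left e4 (by positivity)
  have h2 : ‖c i‖ ≤ 0 := by
    have : Tendsto (fun t : ℝ => D * t) (𝓝[>] 0) (𝓝 (D * 0)) :=
      (tendsto_const_nhds.mul tendsto_id).mono_left nhdsWithin_le_nhds
    rw [mul_zero] at this
    refine ge_of_tendsto this ?_
    filter_upwards [Ioc_mem_nhdsGT (zero_lt_one (α := ℝ))] with t ht using h1 t ht
  exact norm_le_zero_iff.1 h2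

/-- Along the ray t ↦ y − π y + t π y the Taylor sum is a polynomial in t, and the bound on f makes
it O(t^j). This works at every y near a, so the terms vanish at all neighbouring base points as
well. -/
theorem eventually_taylorTerm_eq_zero [CompleteSpace V] (hπ : ∀ y, π (π y) = π y) {f : Y → V} {a : Y}
    (ha : π a = 0) (hf : ContDiffAt ℝ ∞ f a) {j : ℕ} (h : f =O[𝓝 a] fun y => ‖π y‖ ^ j) :
    ∀ᶠ y in 𝓝 a, ∀ i < j, taylorTerm π i f y = 0 := by
  rcases j with - | j
  · simp
  obtain ⟨C1, h1⟩ := h.bound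
  obtain ⟨C2, h2⟩ := (isBigO_sub_sum_taylorTerm ha hf j).bound
  filter_upwards [eventually_forall_sub_add_smul ha (h1.and h2)] with y hy
  refine eq_zero_of_sum_pow_smul_le (C := (C1 + C2) * ‖π y‖ ^ (j + 1)) fun t ht => ?_
  have ht' := Ioc_subset_Icc_self ht
  obtain ⟨e1, e2⟩ := hy t ht'
  have e3 : ‖π (y - π y + t • π y)‖ = t * ‖π y‖ := by
    have : π (y - π y + t • π y) = t • π y := by simp [hπ]
    rw [this, norm_smul, Real.norm_of_nonneg ht.1.le]
  have e4 : ∀ i, taylorTerm π i f (y - π y + t • π y) = t ^ i • taylorTerm π i f y := fun i =>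
    isHomogeneousAlong_taylorTerm hπ i f y t
  rw [norm_pow, norm_norm, e3] at e1 e2
  simp only [e4] at e2
  calc _ = ‖f (y - π y + t • π y) - (f (y - π y + t • π y) -
        ∑ i ∈ Finset.range (j + 1), t ^ i • taylorTerm π i f y)‖ := by congr 1; abel
    _ ≤ _ := norm_sub_le _ _
    _ ≤ C1 * (t * ‖π y‖) ^ (j + 1) + C2 * (t * ‖π y‖) ^ (j + 1) := add_le_add e1 e2
    _ = _ := by ring

theorem isBigO_sub_taylorTerm [CompleteSpace V] (hπ : ∀ y, π (π y) = π y) {f : Y → V} {a : Y} (ha : π a = 0)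
    (hf : ContDiffAt ℝ ∞ f a) {j : ℕ} (h : f =O[𝓝 a] fun y => ‖π y‖ ^ j) :
    (fun y => f y - taylorTerm π j f y) =O[𝓝 a] fun y => ‖π y‖ ^ (j + 1) := by
  refine (isBigO_sub_sum_taylorTerm ha hf j).congr' ?_ EventuallyEq.rfl
  filter_upwards [eventually_taylorTerm_eq_zero hπ ha hf h] with y hy
  rw [Finset.sum_range_succ, Finset.sum_eq_zero fun i hi => hy i (Finset.mem_range.1 hi), zero_add]

theorem IsHomogeneousAlong.eq_zero {j : ℕ} {γ : Y → V} (h : IsHomogeneousAlong π j γ)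
    (hj : j ≠ 0) {y : Y} (hy : π y = 0) : γ y = 0 := by
  have := h y 0
  simpa [hy, hj] using this

/-- Rescale the fast parts of both points by s / N to unit size, use the Lipschitz bound there, and
scale back. A displacement in the fast direction is magnified by the rescaling, so it costs one
power of N; any other displacement keeps the full power. -/
theorem IsHomogeneousAlong.norm_sub_le {j : ℕ} {γ : Y → V}
    (h : IsHomogeneousAlong π (j + 1) γ) {a : Y} (ha : π a = 0) {n : WithTop ℕ∞}
    (hγ : ContDiffAt ℝ n γ a) (hn : n ≠ 0) :
    ∃ C, ∀ᶠ p in 𝓝 (a, a), ∀ N, ‖π p.1‖ ≤ N → ‖π p.2‖ ≤ N →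
      ‖γ p.1 - γ p.2‖ ≤ C * (N ^ (j + 1) * ‖p.1 - p.2‖ + N ^ j * ‖π (p.1 - p.2)‖) := by
  obtain ⟨K, t, ht, hK⟩ := (hγ.of_le (m := 1) (ENat.one_le_iff_ne_zero_withTop.2 hn)).exists_lipschitzOnWith
  obtain ⟨r, hr, hrt⟩ := Metric.mem_nhds_iff.1 ht
  have hp0 : 0 < 1 + ‖π‖ := by positivity
  -- Half of the radius r is reserved for the slow part and half for the rescaled fast part.
  set δ := r / 2 / (1 + ‖π‖) with hδ
  have hδ0 : 0 < δ := by positivity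
  set s := r / 2 with hs
  have hs0 : 0 < s := by positivity
  have hmem : ∀ y ∈ Metric.ball a δ, ∀ N, 0 < N → ‖π y‖ ≤ N →
      y - π y + (s / N) • π y ∈ Metric.ball a r := by
    intro y hy N hN hyN
    rw [mem_ball_iff_norm] at hy ⊢
    have e1 : ‖y - π y + (0 : ℝ) • π y - a‖ ≤ (1 + ‖π‖) * ‖y - a‖ :=
      norm_sub_add_smul_le ha ⟨le_rfl, zero_le_one⟩
    rw [zero_smul, add_zero] at e1
    have e2 : y - π y + (s / N) • π y - a = (y - π y - a) + (s / N) • π y := by abel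
    have e3 : ‖(s / N) • π y‖ ≤ s := by
      rw [norm_smul, Real.norm_of_nonneg (by positivity)]
      calc s / N * ‖π y‖ ≤ s / N * N := by gcongr
        _ = s := by field_simp
    rw [hδ, lt_div_iff₀' hp0] at hy
    rw [e2]
    refine (norm_add_le _ _).trans_lt ?_
    linarith
  refine ⟨K * (1 + ‖π‖) * s⁻¹ ^ (j + 1) + K * s⁻¹ ^ j, ?_⟩
  have hb : Metric.ball a δ ∈ 𝓝 a := Metric.ball_mem_nhds a hδ0
  filter_upwards [prod_mem_nhds hb hb] with ⟨u, v⟩ ⟨hu, hv⟩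
  intro N huN hvN
  simp only at huN hvN hu hv ⊢
  rcases eq_or_lt_of_le ((norm_nonneg _).trans huN) with hN | hN
  · rw [← hN] at huN hvN
    rw [h.eq_zero j.succ_ne_zero (norm_le_zero_iff.1 huN),
      h.eq_zero j.succ_ne_zero (norm_le_zero_iff.1 hvN)]
    simp only [sub_self, norm_zero]
    positivity
  have e1 := hK.norm_sub_le (hrt (hmem u hu N hN huN)) (hrt (hmem v hv N hN hvN))
  rw [h u, h v, ← smul_sub, norm_smul, norm_pow, Real.norm_of_nonneg (by positivity)] at e1
  have e2 : u - π u + (s / N) • π u - (v - π v + (s / N) • π v) =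
      (u - v) - π (u - v) + (s / N) • π (u - v) := by
    rw [map_sub, smul_sub]; abel
  have e3 : ‖u - π u + (s / N) • π u - (v - π v + (s / N) • π v)‖ ≤
      (1 + ‖π‖) * ‖u - v‖ + s / N * ‖π (u - v)‖ := by
    rw [e2]
    refine (norm_add_le _ _).trans (add_le_add ?_ ?_)
    · rw [add_mul, one_mul]
      exact (_root_.norm_sub_le _ _).trans (add_le_add le_rfl (π.le_opNorm _))
    · rw [norm_smul, Real.norm_of_nonneg (by positivity)]
  have e4 : (s / N) ^ (j + 1) * ‖γ u - γ v‖ ≤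
      K * ((1 + ‖π‖) * ‖u - v‖ + s / N * ‖π (u - v)‖) :=
    e1.trans (mul_le_mul_of_nonneg_left e3 K.2)
  have e5 : ‖γ u - γ v‖ ≤ (s / N)⁻¹ ^ (j + 1) *
      (K * ((1 + ‖π‖) * ‖u - v‖ + s / N * ‖π (u - v)‖)) := by
    rw [inv_pow, ← div_eq_inv_mul, le_div_iff₀' (by positivity)]
    exact e4
  refine e5.trans ?_
  have e6 : (s / N)⁻¹ ^ (j + 1) * (K * ((1 + ‖π‖) * ‖u - v‖ + s / N * ‖π (u - v)‖)) =
      K * (1 + ‖π‖) * s⁻¹ ^ (j + 1) * (N ^ (j + 1) * ‖u - v‖) +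
        K * s⁻¹ ^ j * (N ^ j * ‖π (u - v)‖) := by
    have h1 : N * s⁻¹ * (s / N) = 1 := by field_simp
    rw [inv_div, div_eq_mul_inv N s]
    linear_combination (K * (N * s⁻¹) ^ j * ‖π (u - v)‖) * h1
  rw [e6]
  have f1 : 0 ≤ K * (1 + ‖π‖) * s⁻¹ ^ (j + 1) := by positivity
  have f2 : 0 ≤ K * s⁻¹ ^ j := by positivity
  have f3 : 0 ≤ N ^ (j + 1) * ‖u - v‖ := by positivity
  have f4 : 0 ≤ N ^ j * ‖π (u - v)‖ := by positivity
  nlinarith [mul_nonneg f1 f4, mul_nonneg f2 f3]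

/-- Compare y with y − π y, where the homogeneous map vanishes. -/
theorem IsHomogeneousAlong.isBigO (hπ : ∀ y, π (π y) = π y) {j : ℕ} {γ : Y → V}
    (h : IsHomogeneousAlong π (j + 1) γ) {a : Y} (ha : π a = 0) {n : WithTop ℕ∞}
    (hγ : ContDiffAt ℝ n γ a) (hn : n ≠ 0) : γ =O[𝓝 a] fun y => ‖π y‖ ^ (j + 1) := by
  obtain ⟨C, hC⟩ := h.norm_sub_le ha hγ hn
  have h1 : Tendsto (fun y => (y, y - π y)) (𝓝 a) (𝓝 (a, a)) := by
    have : ContinuousAt (fun y => (y, y - π y)) a := by fun_prop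
    simpa [ContinuousAt, ha] using this
  refine IsBigO.of_bound (|C| * (‖π‖ + 1)) ?_
  have h2 : ∀ᶠ y in 𝓝 a, ‖y - a‖ < 1 := by
    filter_upwards [Metric.ball_mem_nhds a one_pos] with y hy using mem_ball_iff_norm.1 hy
  filter_upwards [h1.eventually hC, h2] with y hy hy2
  have e1 := hy ‖π y‖ le_rfl (by simp [hπ])
  rw [h.eq_zero j.succ_ne_zero (y := y - π y) (by simp [hπ]), sub_zero, sub_sub_cancel, hπ] at e1
  refine e1.trans ?_
  rw [norm_pow, norm_norm]
  have e2 : ‖π y‖ ≤ ‖π‖ := by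
    have : π y = π (y - a) := by simp [ha]
    rw [this]
    exact (π.le_opNorm _).trans (by nlinarith [norm_nonneg π])
  have e3 : ‖π y‖ ^ (j + 1) * ‖π y‖ ≤ ‖π y‖ ^ (j + 1) * ‖π‖ := by gcongr
  calc _ ≤ |C| * (‖π y‖ ^ (j + 1) * ‖π y‖ + ‖π y‖ ^ j * ‖π y‖) := by
        gcongr; exact le_abs_self C
    _ ≤ |C| * (‖π y‖ ^ (j + 1) * ‖π‖ + ‖π y‖ ^ j * ‖π y‖) := by gcongr
    _ = _ := by ring

end TaylorTerm

/-! ### Trigonometric polynomials and irrational rotations -/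

section Trigonometric

open Polynomial in
/-- Real trigonometric polynomials of degree at most `d`. -/
def IsTrigPoly (d : ℕ) (f : ℝ → ℝ) : Prop :=
  ∃ p : ℂ[X], p.natDegree ≤ 2 * d ∧
    ∀ φ : ℝ, (f φ : ℂ) * Complex.exp (φ * Complex.I) ^ d = p.eval (Complex.exp (φ * Complex.I))

theorem isTrigPoly_const (c : ℝ) : IsTrigPoly 0 fun _ => c :=
  ⟨Polynomial.C (c : ℂ), by simp, by simp⟩

theorem IsTrigPoly.mul {d e : ℕ} {f g : ℝ → ℝ} (hf : IsTrigPoly d f) (hg : IsTrigPoly e g) :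
    IsTrigPoly (d + e) fun φ => f φ * g φ := by
  obtain ⟨p, hp, hp2⟩ := hf
  obtain ⟨q, hq, hq2⟩ := hg
  refine ⟨p * q, Polynomial.natDegree_mul_le.trans (by omega), fun φ => ?_⟩
  rw [Polynomial.eval_mul, ← hp2, ← hq2, pow_add]
  push_cast
  ring

theorem IsTrigPoly.succ {d : ℕ} {f : ℝ → ℝ} (hf : IsTrigPoly d f) : IsTrigPoly (d + 1) f := by
  obtain ⟨p, hp, hp2⟩ := hf
  refine ⟨p * Polynomial.X, Polynomial.natDegree_mul_le.trans ?_, fun φ => ?_⟩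
  · have := Polynomial.natDegree_X_le (R := ℂ); omega
  · rw [Polynomial.eval_mul, ← hp2, Polynomial.eval_X, pow_succ, mul_assoc]

theorem isTrigPoly_cos : IsTrigPoly 1 Real.cos := by
  refine ⟨Polynomial.C (1 / 2 : ℂ) * Polynomial.X ^ 2 + Polynomial.C (1 / 2 : ℂ), by
    compute_degree, fun φ => ?_⟩
  have h : Complex.exp (φ * Complex.I) * Complex.exp (-φ * Complex.I) = 1 := by
    rw [← Complex.exp_add]; simp
  rw [Complex.ofReal_cos, Complex.cos]
  simp only [Polynomial.eval_add, Polynomial.eval_mul, Polynomial.eval_C, Polynomial.eval_pow,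
    Polynomial.eval_X]
  linear_combination (1 / 2) * h

theorem isTrigPoly_sin : IsTrigPoly 1 Real.sin := by
  refine ⟨Polynomial.C (-Complex.I / 2 : ℂ) * Polynomial.X ^ 2 + Polynomial.C (Complex.I / 2 : ℂ),
    by compute_degree, fun φ => ?_⟩
  have h : Complex.exp (φ * Complex.I) * Complex.exp (-φ * Complex.I) = 1 := by
    rw [← Complex.exp_add]; simp
  rw [Complex.ofReal_sin, Complex.sin]
  simp only [Polynomial.eval_add, Polynomial.eval_mul, Polynomial.eval_C, Polynomial.eval_pow,
    Polynomial.eval_X]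
  linear_combination (Complex.I / 2) * h

theorem isTrigPoly_prod {c : Fin 3 → ℝ → ℝ} (hc : ∀ i, IsTrigPoly 1 (c i)) (j : ℕ)
    (r : Fin j → Fin 3) : IsTrigPoly j fun φ => ∏ i, c (r i) φ := by
  induction j with
  | zero => simpa using isTrigPoly_const 1
  | succ j ih =>
    have := (ih fun i => r i.castSucc).mul (hc (r (Fin.last j)))
    simpa [Fin.prod_univ_castSucc] using this

variable {V W : Type*} [NormedAddCommGroup V] [NormedSpace ℝ V] [NormedAddCommGroup W]
  [NormedSpace ℝ W]

variable (V) in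
/-- Trigonometric polynomials of degree at most `d` with values in `V`. -/
def trigPoly (d : ℕ) : Submodule ℝ (ℝ → V) :=
  Submodule.span ℝ {f | ∃ c : ℝ → ℝ, IsTrigPoly d c ∧ ∃ v : V, f = fun φ => c φ • v}

theorem smul_mem_trigPoly {d : ℕ} {c : ℝ → ℝ} (hc : IsTrigPoly d c) (v : V) :
    (fun φ => c φ • v) ∈ trigPoly V d :=
  Submodule.subset_span ⟨c, hc, v, rfl⟩

theorem mul_mem_trigPoly {d e : ℕ} {c : ℝ → ℝ} (hc : IsTrigPoly e c) {f : ℝ → V}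
    (hf : f ∈ trigPoly V d) : (fun φ => c φ • f φ) ∈ trigPoly V (d + e) := by
  induction hf using Submodule.span_induction with
  | mem f h =>
    obtain ⟨b, hb, v, rfl⟩ := h
    simp only [smul_smul, mul_comm (c _)]
    exact smul_mem_trigPoly (hb.mul hc) v
  | zero => simp only [Pi.zero_apply, smul_zero]; exact Submodule.zero_mem _
  | add f g _ _ hf hg =>
    simp only [Pi.add_apply, smul_add]
    exact Submodule.add_mem _ hf hg
  | smul a f _ hf =>
    simp only [Pi.smul_apply, smul_comm (c _) a]
    exact Submodule.smul_mem _ a hf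

theorem comp_mem_trigPoly {d : ℕ} (L : V →ₗ[ℝ] W) {f : ℝ → V} (hf : f ∈ trigPoly V d) :
    (fun φ => L (f φ)) ∈ trigPoly W d := by
  induction hf using Submodule.span_induction with
  | mem f h =>
    obtain ⟨b, hb, v, rfl⟩ := h
    simp only [map_smul]
    exact smul_mem_trigPoly hb (L v)
  | zero => simp only [Pi.zero_apply, map_zero]; exact Submodule.zero_mem _
  | add f g _ _ hf hg =>
    simp only [Pi.add_apply, map_add]
    exact Submodule.add_mem _ hf hg
  | smul a f _ hf =>
    simp only [Pi.smul_apply, map_smul]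
    exact Submodule.smul_mem _ a hf

/-- Expanding by multilinearity leaves products of j factors, each of them 1, cos or sin. -/
theorem multilinear_mem_trigPoly {j : ℕ} (M : V [×j]→L[ℝ] W) (a₀ a₁ a₂ : V) :
    (fun φ => M fun _ => a₀ + Real.cos φ • a₁ + Real.sin φ • a₂) ∈ trigPoly W j := by
  set c : Fin 3 → ℝ → ℝ := ![fun _ => 1, Real.cos, Real.sin] with hc
  set a : Fin 3 → V := ![a₀, a₁, a₂] with ha
  have hc1 : ∀ i, IsTrigPoly 1 (c i) := by
    intro i
    fin_cases i
    · exact (isTrigPoly_const 1).succ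
    · exact isTrigPoly_cos
    · exact isTrigPoly_sin
  have h1 : (fun φ => M fun _ => a₀ + Real.cos φ • a₁ + Real.sin φ • a₂) =
      ∑ r : Fin j → Fin 3, fun φ => (∏ i, c (r i) φ) • M fun i => a (r i) := by
    ext φ
    have h2 : (fun _ : Fin j => a₀ + Real.cos φ • a₁ + Real.sin φ • a₂) =
        fun _ => ∑ i : Fin 3, c i φ • a i := by
      ext; simp [Fin.sum_univ_three, hc, ha]
    rw [h2, M.map_sum, Finset.sum_apply]
    exact Finset.sum_congr rfl fun r _ => M.map_smul_univ (fun i => c (r i) φ) fun i => a (r i)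
  rw [h1]
  exact Submodule.sum_mem _ fun r _ => smul_mem_trigPoly (isTrigPoly_prod hc1 j r) _

theorem exp_mul_I_ne_one {θ : ℝ} (hθ : Irrational (θ / (2 * Real.pi))) {k : ℤ} (hk : k ≠ 0) :
    Complex.exp (k * θ * Complex.I) ≠ 1 := by
  intro h
  obtain ⟨n, hn⟩ := Complex.exp_eq_one_iff.1 h
  have h1 : ((k * θ : ℝ) : ℂ) = ((n * (2 * Real.pi) : ℝ) : ℂ) := by
    have : (k * θ : ℂ) * Complex.I = (n * (2 * Real.pi)) * Complex.I := by
      rw [hn]; ring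
    push_cast
    exact mul_right_cancel₀ Complex.I_ne_zero this
  have h2 : (k * θ : ℝ) = n * (2 * Real.pi) := Complex.ofReal_injective h1
  have h3 : θ / (2 * Real.pi) = ((n / k : ℚ) : ℝ) := by
    have hk' : (k : ℝ) ≠ 0 := by exact_mod_cast hk
    have := Real.pi_ne_zero
    push_cast
    field_simp
    linarith
  rw [h3] at hθ
  exact hθ ⟨_, rfl⟩

open Polynomial in
-- Multiply the real quadratics with roots e^{±ikθ}, 1 ≤ k ≤ d, each normalized to 1 at the point 1.
-- The normalization is possible because e^{ikθ} ≠ 1, the only place where irrationality enters.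
theorem exists_rotation_annihilator {θ : ℝ} (hθ : Irrational (θ / (2 * Real.pi))) (d : ℕ) :
    ∃ m : ℝ[X], m.eval 1 = 1 ∧ ∀ k : ℤ, k ≠ 0 → |k| ≤ d →
      (m.map (algebraMap ℝ ℂ)).eval (Complex.exp (k * θ * Complex.I)) = 0 := by
  induction d with
  | zero =>
    refine ⟨1, by simp, fun k hk hk2 => absurd (abs_nonpos_iff.1 (by simpa using hk2)) hk⟩
  | succ d ih =>
    obtain ⟨m, hm, hm2⟩ := ih
    set ψ : ℝ := (d + 1) * θ with hψ
    set s : ℝ[X] := X ^ 2 - C (2 * Real.cos ψ) * X + 1 with hs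
    have hroot : ∀ z : ℂ, (s.map (algebraMap ℝ ℂ)).eval z = z ^ 2 - 2 * Real.cos ψ * z + 1 := by
      intro z; simp [hs]
    have h1 : s.eval 1 ≠ 0 := by
      intro h0
      have e1 : Real.cos ψ = 1 := by
        simp [hs] at h0; linarith
      have e2 : Real.sin ψ = 0 := by
        have := Real.sin_sq_add_cos_sq ψ
        rw [e1] at this; nlinarith
      refine exp_mul_I_ne_one hθ (k := (d + 1 : ℕ)) (by positivity) ?_
      have : ((d + 1 : ℕ) : ℤ) * (θ : ℂ) * Complex.I = (ψ : ℂ) * Complex.I := by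
        rw [hψ]; push_cast; ring
      rw [this, Complex.exp_mul_I, ← Complex.ofReal_cos, ← Complex.ofReal_sin, e1, e2]
      simp
    refine ⟨m * (C (s.eval 1)⁻¹ * s), by simp [hm, h1], fun k hk hk2 => ?_⟩
    rw [Polynomial.map_mul, eval_mul]
    rcases eq_or_ne |k| ((d + 1 : ℕ) : ℤ) with he | he
    · have e0 : Complex.cos ψ ^ 2 + Complex.sin ψ ^ 2 = 1 := Complex.cos_sq_add_sin_sq _
      have : (s.map (algebraMap ℝ ℂ)).eval (Complex.exp (k * θ * Complex.I)) = 0 := by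
        rw [hroot]
        rcases (abs_eq (by positivity)).1 he with hk' | hk'
        · have : (k : ℂ) * θ * Complex.I = (ψ : ℂ) * Complex.I := by
            rw [hk', hψ]; push_cast; ring
          rw [this, Complex.exp_mul_I, Complex.ofReal_cos]
          linear_combination (-1) * e0 + Complex.sin ψ ^ 2 * Complex.I_sq
        · have : (k : ℂ) * θ * Complex.I = (-ψ : ℂ) * Complex.I := by
            rw [hk', hψ]; push_cast; ring
          rw [this, Complex.exp_mul_I, Complex.ofReal_cos, Complex.cos_neg, Complex.sin_neg]
          linear_combination (-1) * e0 + Complex.sin ψ ^ 2 * Complex.I_sq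
      rw [Polynomial.map_mul, eval_mul, this, mul_zero, mul_zero]
    · rw [hm2 k hk (by push_cast at he hk2; omega), zero_mul]

open Polynomial in
-- With T the shift by θ, the left side is m(T)c. On the mode e^{ikφ} the operator m(T) acts as the
-- scalar m(e^{ikθ}), so only the constant mode survives; the right side is the value at φ = 0.
theorem sum_coeff_mul_add_eq {d : ℕ} {c : ℝ → ℝ} (hc : IsTrigPoly d c) {θ : ℝ} {m : ℝ[X]}
    (hm : ∀ k : ℤ, k ≠ 0 → |k| ≤ d →
      (m.map (algebraMap ℝ ℂ)).eval (Complex.exp (k * θ * Complex.I)) = 0)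
    {K : ℕ} (hK : m.natDegree < K) (φ : ℝ) :
    ∑ k ∈ Finset.range K, m.coeff k * c (φ + k * θ) = ∑ k ∈ Finset.range K, m.coeff k * c (k * θ) := by
  obtain ⟨p, hp, hp2⟩ := hc
  have h1 : ∀ φ : ℝ, (c φ : ℂ) = ∑ i ∈ Finset.range (2 * d + 1),
      p.coeff i * Complex.exp (((i : ℤ) - d : ℤ) * φ * Complex.I) := by
    intro φ
    have hne : Complex.exp (φ * Complex.I) ^ d ≠ 0 := pow_ne_zero _ (Complex.exp_ne_zero _)
    refine mul_right_cancel₀ hne ?_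
    rw [hp2, eval_eq_sum_range' (Nat.lt_succ_of_le hp), Finset.sum_mul]
    refine Finset.sum_congr rfl fun i _ => ?_
    rw [mul_assoc, ← Complex.exp_nat_mul, ← Complex.exp_nat_mul, ← Complex.exp_add]
    congr 2
    push_cast
    ring
  have h2 : ∀ φ : ℝ, ((∑ k ∈ Finset.range K, m.coeff k * c (φ + k * θ) : ℝ) : ℂ) =
      p.coeff d * (m.map (algebraMap ℝ ℂ)).eval 1 := by
    intro φ
    have e1 : ((∑ k ∈ Finset.range K, m.coeff k * c (φ + k * θ) : ℝ) : ℂ) =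
        ∑ i ∈ Finset.range (2 * d + 1),
          p.coeff i * Complex.exp (((i : ℤ) - d : ℤ) * φ * Complex.I) *
          (m.map (algebraMap ℝ ℂ)).eval (Complex.exp (((i : ℤ) - d : ℤ) * θ * Complex.I)) := by
      push_cast
      simp only [h1, Finset.mul_sum]
      rw [Finset.sum_comm]
      refine Finset.sum_congr rfl fun i _ => ?_
      rw [eval_eq_sum_range' (n := K) (by rwa [natDegree_map]), Finset.mul_sum]
      refine Finset.sum_congr rfl fun k _ => ?_
      rw [coeff_map, ← Complex.exp_nat_mul]
      have : Complex.exp (((i : ℤ) - d : ℤ) * (φ + k * θ : ℝ) * Complex.I) =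
          Complex.exp (((i : ℤ) - d : ℤ) * φ * Complex.I) *
          Complex.exp (k * (((i : ℤ) - d : ℤ) * θ * Complex.I)) := by
        rw [← Complex.exp_add]; congr 1; push_cast; ring
      push_cast at this ⊢
      rw [this, Complex.coe_algebraMap]
      ring
    rw [e1, Finset.sum_eq_single d]
    · simp
    · intro i hi hid
      rw [Finset.mem_range] at hi
      rw [hm ((i : ℤ) - d) (by omega) (by rw [abs_le]; omega), mul_zero]
    · intro h; exact absurd (Finset.mem_range.2 (by omega)) h
  have h3 := (h2 φ).trans (h2 0).symm
  simpa using Complex.ofReal_injective h3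

open Polynomial in
/-- Universal weights that average trigonometric polynomials of degree `d` over the rotation by
`θ`, and solve the corresponding cohomological equation. -/
theorem exists_rotation_weights {θ : ℝ} (hθ : Irrational (θ / (2 * Real.pi))) (d : ℕ)
    (V : Type*) [NormedAddCommGroup V] [NormedSpace ℝ V] :
    ∃ (K : ℕ) (m n : ℕ → ℝ),
      (∀ f ∈ trigPoly V d, ∀ φ, ∑ k ∈ Finset.range K, m k • f (φ + k * θ) =
        ∑ k ∈ Finset.range K, m k • f (k * θ)) ∧
      ∀ (f : ℝ → V) (φ : ℝ), ∑ k ∈ Finset.range K, n k • f (φ + θ + k * θ) -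
        ∑ k ∈ Finset.range K, n k • f (φ + k * θ) =
          f φ - ∑ k ∈ Finset.range K, m k • f (φ + k * θ) := by
  obtain ⟨m, hm1, hm⟩ := exists_rotation_annihilator hθ d
  -- From m(1) = 1 one gets 1 − m = (X − 1)n; applied to the shift operator T this is the
  -- cohomological equation f − m(T)f = (T − 1)n(T)f, valid for every f.
  obtain ⟨n, hn⟩ : X - C 1 ∣ 1 - m := by
    rw [dvd_iff_isRoot]; simp [hm1]
  set K := max m.natDegree n.natDegree + 1 with hK
  have hmK : m.natDegree < K := Nat.lt_succ_of_le (le_max_left _ _)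
  have hnK : n.natDegree < K := Nat.lt_succ_of_le (le_max_right _ _)
  refine ⟨K, m.coeff, n.coeff, fun f hf φ => ?_, fun f φ => ?_⟩
  · induction hf using Submodule.span_induction with
    | mem f h =>
      obtain ⟨c, hc, v, rfl⟩ := h
      simp only [smul_smul, ← Finset.sum_smul]
      rw [sum_coeff_mul_add_eq hc hm hmK]
    | zero => simp
    | add f g _ _ hf hg => simp only [Pi.add_apply, smul_add, Finset.sum_add_distrib, hf, hg]
    | smul a f _ hf =>
      simp only [Pi.smul_apply, smul_comm _ a, ← Finset.smul_sum, hf]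
  · set U : Module.End ℝ (ℝ → V) := LinearMap.funLeft ℝ V fun φ => φ + θ with hU
    have hUk : ∀ (k : ℕ) (f : ℝ → V) (φ : ℝ), (U ^ k) f φ = f (φ + k * θ) := by
      intro k
      induction k with
      | zero => simp
      | succ k ih =>
        intro f φ
        rw [pow_succ, Module.End.mul_apply, ih, hU, LinearMap.funLeft_apply]
        congr 1; push_cast; ring
    have hev : ∀ (p : ℝ[X]), p.natDegree < K → ∀ (f : ℝ → V) (φ : ℝ), aeval U p f φ =
        ∑ k ∈ Finset.range K, p.coeff k • f (φ + k * θ) := by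
      intro p hp f φ
      rw [aeval_eq_sum_range' hp]
      simp [LinearMap.sum_apply, hUk]
    have h1 := congrArg (fun p => aeval U p f φ) hn
    simp only [map_sub, map_one, map_mul, aeval_X, LinearMap.sub_apply, Module.End.one_apply,
      Pi.sub_apply, Module.End.mul_apply] at h1
    rw [← hev m hmK, h1, ← hev n hnK, ← hev n hnK]
    rfl

end Trigonometric

/-! ### Normal forms of nearly periodic maps -/

section NormalForm

/-- The space of triples `(ħ, q, w)`. -/
abbrev ParamSpace (E : Type*) := ℝ × E × E

variable {E : Type*} [NormedAddCommGroup E] [NormedSpace ℝ E]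

variable (E) in
/-- The projection `(ħ, q, w) ↦ (ħ, 0, w)`. -/
noncomputable def fastProj : ParamSpace E →L[ℝ] ParamSpace E :=
  (ContinuousLinearMap.fst ℝ ℝ (E × E)).prod
    ((0 : ParamSpace E →L[ℝ] E).prod
      ((ContinuousLinearMap.snd ℝ E E).comp (ContinuousLinearMap.snd ℝ ℝ (E × E))))

@[simp] theorem fastProj_apply (y : ParamSpace E) : fastProj E y = (y.1, 0, y.2.2) := rfl

theorem fastProj_fastProj (y : ParamSpace E) : fastProj E (fastProj E y) = fastProj E y := rfl

theorem sub_fastProj (y : ParamSpace E) : y - fastProj E y = (0, y.2.1, 0) := by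
  ext <;> simp

theorem abs_fst_le_norm_fastProj (y : ParamSpace E) : |y.1| ≤ ‖fastProj E y‖ := by
  exact norm_fst_le (fastProj E y)

theorem norm_snd_snd_le_norm_fastProj (y : ParamSpace E) : ‖y.2.2‖ ≤ ‖fastProj E y‖ :=
  (norm_snd_le (fastProj E y).2).trans (norm_snd_le (fastProj E y))

/-- The rotation by the angle `-φ` in the complex structure `J`. -/
noncomputable def rot (J : E → E →L[ℝ] E) (φ : ℝ) (q : E) : E →L[ℝ] E :=
  Real.cos φ • ContinuousLinearMap.id ℝ E - Real.sin φ • J q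

theorem rot_apply (J : E → E →L[ℝ] E) (φ : ℝ) (q w : E) :
    rot J φ q w = Real.cos φ • w - Real.sin φ • J q w := by simp [rot]

@[simp] theorem rot_zero_apply (J : E → E →L[ℝ] E) (q w : E) : rot J 0 q w = w := by
  simp [rot_apply]

theorem rot_rot {J : E → E →L[ℝ] E} {q : E} (hJ : ∀ v, J q (J q v) = -v) (φ ψ : ℝ) (w : E) :
    rot J φ q (rot J ψ q w) = rot J (φ + ψ) q w := by
  simp only [rot_apply, map_sub, map_smul, hJ, Real.cos_add, Real.sin_add]
  module

/-- Transport of `rot J θ q m` from `q` to `q'` by a map that intertwines `J q` and `J q'`. -/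
noncomputable def transport (J : E → E →L[ℝ] E) (θ : ℝ) (p : E × E × E) : E :=
  (1 / 2 : ℝ) • (rot J θ p.1 p.2.2 - J p.2.1 (J p.1 (rot J θ p.1 p.2.2)))

/-- With J = J q and J' = J q', both J'(1 − J'J) and (1 − J'J)J equal J + J', so ½(1 − J'J)
intertwines the two complex structures and hence their rotations. -/
theorem transport_rot {J : E → E →L[ℝ] E} {q q' : E} (hJ : ∀ v, J q (J q v) = -v)
    (hJ' : ∀ v, J q' (J q' v) = -v) (θ φ : ℝ) (m : E) :
    transport J θ (q, q', rot J φ q m) = rot J φ q' (transport J θ (q, q', m)) := by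
  simp only [transport, rot_rot hJ, add_comm θ φ]
  simp only [← rot_rot hJ, rot_apply J φ, map_sub, map_smul, map_neg, hJ, hJ']
  module

variable {Q : Set E} {J : E → E →L[ℝ] E} {θ : ℝ}

theorem contDiffAt_rot {q : E} (hJ : ContDiffAt ℝ ∞ J q) (φ : ℝ) :
    ContDiffAt ℝ ∞ (rot J φ) q :=
  contDiffAt_const.sub (hJ.const_smul (Real.sin φ))

theorem contDiffAt_transport {p : E × E × E} (hJ : ContDiffAt ℝ ∞ J p.1)
    (hJ' : ContDiffAt ℝ ∞ J p.2.1) : ContDiffAt ℝ ∞ (transport J θ) p := by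
  have h1 : ContDiffAt ℝ ∞ (fun p : E × E × E => rot J θ p.1 p.2.2) p :=
    ((contDiffAt_rot hJ θ).comp p contDiffAt_fst).clm_apply contDiffAt_snd.snd
  have h2 : ContDiffAt ℝ ∞ (fun p : E × E × E => J p.1) p := hJ.comp p contDiffAt_fst
  have h3 : ContDiffAt ℝ ∞ (fun p : E × E × E => J p.2.1) p :=
    hJ'.comp p contDiffAt_snd.fst
  exact contDiffAt_const.smul (h1.sub (h3.clm_apply (h2.clm_apply h1)))

/-- The map is linear in m, so at m = 0 moving the base points contributes nothing, and for q' = q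
the intertwiner is the identity. -/
theorem fderiv_transport {q : E} (hJ : ContDiffAt ℝ ∞ J q) (hJ2 : ∀ v, J q (J q v) = -v)
    (u u' m : E) : fderiv ℝ (transport J θ) (q, q, 0) (u, u', m) = rot J θ q m := by
  have hr : DifferentiableAt ℝ (fun p : E × E × E => rot J θ p.1) (q, q, 0) :=
    DifferentiableAt.comp (g := rot J θ) (q, q, (0 : E))
      ((contDiffAt_rot hJ θ).differentiableAt (by simp)) differentiableAt_fst
  have h2 : DifferentiableAt ℝ (fun p : E × E × E => J p.1) (q, q, 0) :=
    (hJ.differentiableAt (by simp)).comp (q, q, (0 : E)) differentiableAt_fst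
  have h3 : DifferentiableAt ℝ (fun p : E × E × E => J p.2.1) (q, q, 0) :=
    DifferentiableAt.comp (g := J) (q, q, (0 : E)) (hJ.differentiableAt (by simp))
      differentiableAt_snd.fst
  have hm : HasFDerivAt (fun p : E × E × E => p.2.2)
    ((ContinuousLinearMap.snd ℝ E E).comp (ContinuousLinearMap.snd ℝ E (E × E))) (q, q, 0) :=
    ContinuousLinearMap.hasFDerivAt ((ContinuousLinearMap.snd ℝ E E).comp (ContinuousLinearMap.snd ℝ E (E × E)))
  have h4 := hr.hasFDerivAt.clm_apply hm
  have h5 := h2.hasFDerivAt.clm_apply h4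
  have h6 := h3.hasFDerivAt.clm_apply h5
  have h7 := (h4.sub h6).const_smul (1 / 2 : ℝ)
  have h8 : HasFDerivAt (transport J θ) _ (q, q, 0) := h7
  rw [h8.fderiv]
  simp [hJ2]
  module

variable (Q J θ) in
/-- The map on `(ħ, q, w)` that is determined by the averaged data `P`. -/
noncomputable def slowMap (P : ParamSpace E → E × E) (y : ParamSpace E) : ParamSpace E :=
  (y.1, (P y).1, transport J θ (y.2.1, (P y).1, (P y).2))

/-- `Γ` conjugates `F`, up to errors of order `j`, to a map that commutes with rotations. -/
structure IsNormalForm (Q : Set E) (J : E → E →L[ℝ] E) (θ : ℝ) (F : ParamSpace E → E × E) (j : ℕ)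
    (Γ P : ParamSpace E → E × E) : Prop where
  smooth : ∀ q ∈ Q, ContDiffAt ℝ ∞ Γ (0, q, 0)
  smooth_avg : ∀ q ∈ Q, ContDiffAt ℝ ∞ P (0, q, 0)
  base : ∀ q ∈ Q, Γ (0, q, 0) = (q, 0)
  base_avg : ∀ q ∈ Q, P (0, q, 0) = (q, 0)
  deriv : ∀ q ∈ Q, ∀ h u w, fderiv ℝ Γ (0, q, 0) (h, u, w) = (u - J q w, w)
  avg_snd : ∀ q ∈ Q, (fun y => (P y).2 - y.2.2) =O[𝓝 (0, q, 0)] fun y => ‖fastProj E y‖ ^ 2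
  avg_rot : ∀ h, ∀ q ∈ Q, ∀ w φ,
    P (h, q, rot J φ q w) = ((P (h, q, w)).1, rot J φ q (P (h, q, w)).2)
  error : ∀ q ∈ Q, (fun y => F (y.1, Γ y) - Γ (slowMap J θ P y)) =O[𝓝 (0, q, 0)]
    fun y => ‖fastProj E y‖ ^ j

end NormalForm

/-! ### Averages over the rotation and the cohomological equations -/

section RotationAverage

variable {E : Type*} [NormedAddCommGroup E] [NormedSpace ℝ E]

/-- The weighted sum of `f` over the points `(ħ, q, R ^ k w)`, where `R = rot J θ q`. -/
noncomputable def slowAvg (J : E → E →L[ℝ] E) (θ : ℝ) (K : ℕ) (c : ℕ → ℝ) (f : ParamSpace E → E)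
    (y : ParamSpace E) : E :=
  ∑ k ∈ Finset.range K, c k • f (y.1, y.2.1, rot J (k * θ) y.2.1 y.2.2)

/-- The weighted sum of `R ^ (-k - 1) f` over the points `(ħ, q, R ^ k w)`, where
`R = rot J θ q`. -/
noncomputable def fastAvg (J : E → E →L[ℝ] E) (θ : ℝ) (K : ℕ) (c : ℕ → ℝ) (f : ParamSpace E → E)
    (y : ParamSpace E) : E :=
  ∑ k ∈ Finset.range K, c k • rot J (-(k * θ) - θ) y.2.1
    (f (y.1, y.2.1, rot J (k * θ) y.2.1 y.2.2))

variable {J : E → E →L[ℝ] E} {θ : ℝ} {K : ℕ} {c : ℕ → ℝ} {f : ParamSpace E → E}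

theorem contDiffAt_rot_snd {q : E} (hJ : ContDiffAt ℝ ∞ J q) (φ : ℝ) :
    ContDiffAt ℝ ∞ (fun y : ParamSpace E => (y.1, y.2.1, rot J φ y.2.1 y.2.2)) (0, q, 0) := by
  refine contDiffAt_fst.prodMk (contDiffAt_snd.fst.prodMk ?_)
  exact (ContDiffAt.comp (g := rot J φ) ((0, q, 0) : ParamSpace E) (contDiffAt_rot hJ φ)
    contDiffAt_snd.fst).clm_apply contDiffAt_snd.snd

theorem contDiffAt_comp_rot_snd {q : E} (hJ : ContDiffAt ℝ ∞ J q) (φ : ℝ) {V : Type*}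
    [NormedAddCommGroup V] [NormedSpace ℝ V] {f : ParamSpace E → V}
    (hf : ContDiffAt ℝ ∞ f (0, q, 0)) :
    ContDiffAt ℝ ∞ (fun y : ParamSpace E => f (y.1, y.2.1, rot J φ y.2.1 y.2.2)) (0, q, 0) := by
  refine ContDiffAt.comp (g := f) ((0, q, 0) : ParamSpace E) ?_ (contDiffAt_rot_snd hJ φ)
  simpa using hf

theorem contDiffAt_slowAvg {q : E} (hJ : ContDiffAt ℝ ∞ J q) (hf : ContDiffAt ℝ ∞ f (0, q, 0)) :
    ContDiffAt ℝ ∞ (slowAvg J θ K c f) (0, q, 0) :=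
  ContDiffAt.sum fun _ _ => contDiffAt_const.smul (contDiffAt_comp_rot_snd hJ _ hf)

theorem contDiffAt_fastAvg {q : E} (hJ : ContDiffAt ℝ ∞ J q) (hf : ContDiffAt ℝ ∞ f (0, q, 0)) :
    ContDiffAt ℝ ∞ (fastAvg J θ K c f) (0, q, 0) := by
  refine ContDiffAt.sum fun k _ => contDiffAt_const.smul ?_
  exact (ContDiffAt.comp (g := rot J _) ((0, q, 0) : ParamSpace E) (contDiffAt_rot hJ _)
    contDiffAt_snd.fst).clm_apply (contDiffAt_comp_rot_snd hJ _ hf)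

theorem isHomogeneousAlong_fastProj_iff {V : Type*} [NormedAddCommGroup V] [NormedSpace ℝ V]
    {j : ℕ} {f : ParamSpace E → V} : IsHomogeneousAlong (fastProj E) j f ↔
      ∀ h q w, ∀ t : ℝ, f (t * h, q, t • w) = t ^ j • f (h, q, w) := by
  constructor
  · intro H h q w t
    simpa using H (h, q, w) t
  · intro H y t
    rw [sub_fastProj]
    simpa using H y.1 y.2.1 y.2.2 t

theorem isHomogeneousAlong_slowAvg {j : ℕ} (hf : IsHomogeneousAlong (fastProj E) j f) :
    IsHomogeneousAlong (fastProj E) j (slowAvg J θ K c f) := by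
  rw [isHomogeneousAlong_fastProj_iff] at hf ⊢
  intro h q w t
  simp only [slowAvg, map_smul, hf, Finset.smul_sum, smul_comm (t ^ j)]

theorem isHomogeneousAlong_fastAvg {j : ℕ} (hf : IsHomogeneousAlong (fastProj E) j f) :
    IsHomogeneousAlong (fastProj E) j (fastAvg J θ K c f) := by
  rw [isHomogeneousAlong_fastProj_iff] at hf ⊢
  intro h q w t
  simp only [fastAvg, map_smul, hf, Finset.smul_sum, smul_comm (t ^ j)]

theorem fastAvg_eq_zero {h : ℝ} {q : E} (hf : f (h, q, 0) = 0) :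
    fastAvg J θ K c f (h, q, 0) = 0 := by
  simp [fastAvg, hf]

/-- The shift identity for the weights, applied to φ ↦ f(ħ, q, R_φ w) and evaluated at φ = 0. -/
theorem slowAvg_cohomology {m n : ℕ → ℝ}
    (hmn : ∀ (f : ℝ → E) (φ : ℝ), ∑ k ∈ Finset.range K, n k • f (φ + θ + k * θ) -
        ∑ k ∈ Finset.range K, n k • f (φ + k * θ) =
          f φ - ∑ k ∈ Finset.range K, m k • f (φ + k * θ))
    {q : E} (hJ : ∀ v, J q (J q v) = -v) (h : ℝ) (w : E) :
    f (h, q, w) + slowAvg J θ K n f (h, q, w) - slowAvg J θ K n f (h, q, rot J θ q w) =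
      slowAvg J θ K m f (h, q, w) := by
  have h1 := hmn (fun φ => f (h, q, rot J φ q w)) 0
  simp only [zero_add, rot_zero_apply] at h1
  simp only [slowAvg, rot_rot hJ, add_comm _ θ]
  rw [add_sub_assoc, ← neg_sub, h1]
  abel

theorem slowAvg_rot {m : ℕ → ℝ} {q : E} (hJ : ∀ v, J q (J q v) = -v) {h : ℝ} {w : E}
    (hm : ∀ φ, ∑ k ∈ Finset.range K, m k • f (h, q, rot J (φ + k * θ) q w) =
      ∑ k ∈ Finset.range K, m k • f (h, q, rot J (k * θ) q w)) (φ : ℝ) :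
    slowAvg J θ K m f (h, q, rot J φ q w) = slowAvg J θ K m f (h, q, w) := by
  simp only [slowAvg, rot_rot hJ]
  simp only [add_comm _ φ, hm]

/-- The same for the fast component, which is rotated as well: the weights are applied to the pulled
back function φ ↦ R_{−φ} f(ħ, q, R_φ w). -/
theorem fastAvg_cohomology {m n : ℕ → ℝ}
    (hmn : ∀ (f : ℝ → E) (φ : ℝ), ∑ k ∈ Finset.range K, n k • f (φ + θ + k * θ) -
        ∑ k ∈ Finset.range K, n k • f (φ + k * θ) =
          f φ - ∑ k ∈ Finset.range K, m k • f (φ + k * θ))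
    {q : E} (hJ : ∀ v, J q (J q v) = -v) (h : ℝ) (w : E) :
    f (h, q, w) + rot J θ q (fastAvg J θ K n f (h, q, w)) -
      fastAvg J θ K n f (h, q, rot J θ q w) = rot J θ q (fastAvg J θ K m f (h, q, w)) := by
  have h1 := hmn (fun φ => rot J (-φ) q (f (h, q, rot J φ q w))) 0
  simp only [zero_add, rot_zero_apply, neg_zero] at h1
  simp only [fastAvg, rot_rot hJ, map_sum, map_smul]
  have e1 : ∀ k : ℕ, θ + (-(k * θ) - θ) = -(k * θ) := fun k => by ring
  have e2 : ∀ k : ℕ, -(k * θ) - θ = -(θ + k * θ) := fun k => by ring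
  simp only [e1]
  simp only [e2, add_comm _ θ]
  rw [add_sub_assoc, ← neg_sub, h1]
  abel

/-- The average of the pulled back function is independent of the starting angle; undoing the
pullback turns invariance into equivariance. -/
theorem fastAvg_rot {m : ℕ → ℝ} {q : E} (hJ : ∀ v, J q (J q v) = -v) {h : ℝ} {w : E}
    (hm : ∀ φ, ∑ k ∈ Finset.range K,
        m k • rot J (-(φ + k * θ)) q (f (h, q, rot J (φ + k * θ) q w)) =
      ∑ k ∈ Finset.range K, m k • rot J (-(k * θ)) q (f (h, q, rot J (k * θ) q w))) (φ : ℝ) :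
    fastAvg J θ K m f (h, q, rot J φ q w) = rot J φ q (fastAvg J θ K m f (h, q, w)) := by
  have e0 : fastAvg J θ K m f (h, q, w) = rot J (-θ) q (∑ k ∈ Finset.range K,
      m k • rot J (-(k * θ)) q (f (h, q, rot J (k * θ) q w))) := by
    simp only [fastAvg, map_sum, map_smul, rot_rot hJ]
    refine Finset.sum_congr rfl fun k _ => ?_
    rw [show -θ + -(k * θ) = -(k * θ) - θ by ring]
  rw [e0, ← hm φ, rot_rot hJ]
  simp only [fastAvg, map_sum, map_smul, rot_rot hJ]
  refine Finset.sum_congr rfl fun k _ => ?_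
  rw [show φ + -θ + -(φ + k * θ) = -(k * θ) - θ by ring, add_comm φ]

/-- A Taylor term is a j-linear form on the fast direction (ħ, 0, cos φ w − sin φ J w), which is
affine in cos φ and sin φ. Hence finitely many non-resonance conditions are enough at each order. -/
theorem taylorTerm_rot_mem_trigPoly {V : Type*} [NormedAddCommGroup V] [NormedSpace ℝ V] (j : ℕ)
    (g : ParamSpace E → V) (h : ℝ) (q w : E) :
    (fun φ => taylorTerm (fastProj E) j g (h, q, rot J φ q w)) ∈ trigPoly V j := by
  have h1 : (fun φ => taylorTerm (fastProj E) j g (h, q, rot J φ q w)) =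
      (j.factorial : ℝ)⁻¹ • fun φ => iteratedFDeriv ℝ j g (0, q, 0) fun _ =>
        ((h, 0, 0) : ParamSpace E) + Real.cos φ • ((0, 0, w) : ParamSpace E) +
          Real.sin φ • ((0, 0, -(J q w)) : ParamSpace E) := by
    ext φ
    simp only [taylorTerm, sub_fastProj, Pi.smul_apply]
    congr 2
    ext i <;> simp [rot_apply, sub_eq_add_neg]
  rw [h1]
  exact Submodule.smul_mem _ _ (multilinear_mem_trigPoly _ _ _ _)

theorem rot_neg_mem_trigPoly {j : ℕ} {q : E} {f : ℝ → E} (hf : f ∈ trigPoly E j) :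
    (fun φ => rot J (-φ) q (f φ)) ∈ trigPoly E (j + 1) := by
  have h1 : (fun φ => rot J (-φ) q (f φ)) =
      (fun φ => Real.cos φ • f φ) + fun φ => Real.sin φ • J q (f φ) := by
    ext φ; simp [rot_apply]
  rw [h1]
  exact Submodule.add_mem _ (mul_mem_trigPoly isTrigPoly_cos hf)
    (mul_mem_trigPoly isTrigPoly_sin (comp_mem_trigPoly (J q : E →ₗ[ℝ] E) hf))

theorem mem_trigPoly_succ {j : ℕ} {f : ℝ → E} (hf : f ∈ trigPoly E j) :
    f ∈ trigPoly E (j + 1) := by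
  simpa using mul_mem_trigPoly (isTrigPoly_const 1).succ hf

end RotationAverage

/-! ### Nearly periodic maps and estimates for the slow map -/

section NormalFormStep

variable {E : Type*} [NormedAddCommGroup E] [NormedSpace ℝ E]

/-- The hypotheses of the normal form theorem: at `ħ = 0` the map `F` fixes the points `(q, 0)`,
and its linearization there is conjugate to the identity times the rotation `rot J θ q`. -/
structure IsNearlyPeriodicMap (Q : Set E) (J : E → E →L[ℝ] E) (θ : ℝ) (X : E → E)
    (F : ParamSpace E → E × E) : Prop where
  isOpen : IsOpen Q
  smooth_J : ∀ q ∈ Q, ContDiffAt ℝ ∞ J q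
  J_sq : ∀ q ∈ Q, ∀ v, J q (J q v) = -v
  smooth_X : ∀ q ∈ Q, ContDiffAt ℝ ∞ X q
  smooth : ∀ q ∈ Q, ContDiffAt ℝ ∞ F (0, q, 0)
  base : ∀ q ∈ Q, F (0, q, 0) = (q, 0)
  deriv : ∀ q ∈ Q, ∀ h u w, fderiv ℝ F (0, q, 0) (h, u, w) =
    (u + h • X q - J q (rot J θ q w - w), rot J θ q w)

variable {Q : Set E} {J : E → E →L[ℝ] E} {θ : ℝ} {X : E → E} {F : ParamSpace E → E × E}
  {j : ℕ} {Γ P : ParamSpace E → E × E}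

theorem two_le_infty : (2 : WithTop ℕ∞) ≤ ∞ :=
  WithTop.coe_le_coe.2 (le_top (a := (2 : ℕ∞)))

theorem eventually_fst_snd_mem (hQ : IsOpen Q) {q : E} (hq : q ∈ Q) :
    ∀ᶠ y : ParamSpace E in 𝓝 (0, q, 0), y.2.1 ∈ Q :=
  (continuous_fst.comp continuous_snd).continuousAt.eventually_mem (hQ.mem_nhds hq)

theorem contDiffAt_slowMap (hJ : ∀ q ∈ Q, ContDiffAt ℝ ∞ J q) {q : E} (hq : q ∈ Q)
    (hP : ContDiffAt ℝ ∞ P (0, q, 0)) (hP0 : P (0, q, 0) = (q, 0)) :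
    ContDiffAt ℝ ∞ (slowMap J θ P) (0, q, 0) := by
  refine contDiffAt_fst.prodMk (hP.fst.prodMk ?_)
  refine ContDiffAt.comp (g := transport J θ) ((0, q, 0) : ParamSpace E) ?_
    (contDiffAt_snd.fst.prodMk (hP.fst.prodMk hP.snd))
  exact contDiffAt_transport (hJ q hq) (by rw [hP0]; exact hJ q hq)

theorem transport_zero (q q' : E) : transport J θ (q, q', 0) = 0 := by
  simp [transport]

theorem slowMap_base {q : E} (hP0 : P (0, q, 0) = (q, 0)) :
    slowMap J θ P (0, q, 0) = (0, q, 0) := by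
  simp [slowMap, hP0, transport_zero]

theorem tendsto_sub_fastProj (q : E) :
    Tendsto (fun y : ParamSpace E => y - fastProj E y) (𝓝 (0, q, 0)) (𝓝 (0, q, 0)) := by
  have : ContinuousAt (fun y : ParamSpace E => y - fastProj E y) (0, q, 0) := by fun_prop
  simpa only [ContinuousAt, sub_fastProj] using this

theorem isBigO_sub_base {V : Type*} [NormedAddCommGroup V] [NormedSpace ℝ V]
    {f : ParamSpace E → V} {q : E} (hf : ContDiffAt ℝ ∞ f (0, q, 0)) :
    (fun y : ParamSpace E => f y - f (0, y.2.1, 0)) =O[𝓝 (0, q, 0)]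
      fun y => ‖fastProj E y‖ := by
  have h1 := (hf.isBigO_sub_nhds (by simp)).comp_tendsto
    (tendsto_id.prodMk_nhds (tendsto_sub_fastProj q))
  refine (h1.congr' ?_ ?_).norm_right
  · exact Eventually.of_forall fun y => by simp only [Function.comp_apply, sub_fastProj]; rfl
  · exact Eventually.of_forall fun y => by simp

/-- Taylor's estimate for `transport` about the points (q', q', 0), where the derivative sees only
the fast argument. -/
theorem isBigO_transport_sub {q : E} (hJ : ContDiffAt ℝ ∞ J q)
    (hJe : ∀ᶠ q' in 𝓝 q, ContDiffAt ℝ ∞ J q' ∧ ∀ v, J q' (J q' v) = -v)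
    {u v : ParamSpace E → E × E}
    (hu : Tendsto u (𝓝 (0, q, 0)) (𝓝 (q, 0))) (hv : Tendsto v (𝓝 (0, q, 0)) (𝓝 (q, 0)))
    (huN : (fun y => u y - (y.2.1, 0)) =O[𝓝 (0, q, 0)] fun y => ‖fastProj E y‖)
    (hvN : (fun y => v y - (y.2.1, 0)) =O[𝓝 (0, q, 0)] fun y => ‖fastProj E y‖) :
    (fun y => transport J θ (y.2.1, u y) - transport J θ (y.2.1, v y) -
      rot J θ y.2.1 ((u y).2 - (v y).2)) =O[𝓝 (0, q, 0)]
      fun y => ‖fastProj E y‖ * ‖u y - v y‖ := by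
  have hJq := hJe.self_of_nhds
  have hT : ContDiffAt ℝ ∞ (transport J θ) (q, q, 0) := contDiffAt_transport hJ hJ
  have hfst : Tendsto (fun y : ParamSpace E => y.2.1) (𝓝 (0, q, 0)) (𝓝 q) :=
    (continuous_fst.comp continuous_snd).tendsto' _ _ rfl
  have h1 := (hT.isBigO_sub_sub_fderiv two_le_infty).comp_tendsto
    ((hfst.prodMk_nhds hu).prodMk_nhds ((hfst.prodMk_nhds hv).prodMk_nhds
      (hfst.prodMk_nhds (hfst.prodMk_nhds (tendsto_const_nhds (x := (0 : E)))))))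
  refine (h1.congr' (f₂ := fun y => transport J θ (y.2.1, u y) - transport J θ (y.2.1, v y) -
      rot J θ y.2.1 ((u y).2 - (v y).2)) ?_ EventuallyEq.rfl).trans ?_
  · filter_upwards [hfst.eventually hJe] with y hy
    simp only [Function.comp_apply]
    congr 1
    exact fderiv_transport hy.1 hy.2 _ _ _
  · have e1 : ∀ z : E × E, ∀ p : E, ‖(p, z) - (p, p, (0 : E))‖ = ‖z - (p, 0)‖ := by
      intro z p; simp [Prod.norm_def]
    have e2 : ∀ z z' : E × E, ∀ p : E, ‖(p, z) - (p, z')‖ = ‖z - z'‖ := by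
      intro z z' p; simp [Prod.norm_def]
    simp only [Function.comp_def, e1, e2]
    exact (huN.norm_left.add hvN.norm_left).mul (isBigO_refl _ _)

end NormalFormStep

/-! ### Change of the normal form error under a correction -/

section NormalFormStep

variable {E : Type*} [NormedAddCommGroup E] [NormedSpace ℝ E]
variable {Q : Set E} {J : E → E →L[ℝ] E} {θ : ℝ} {X : E → E} {F : ParamSpace E → E × E}
  {j : ℕ} {Γ P : ParamSpace E → E × E}

theorem IsNormalForm.contDiffAt_error (hF : IsNearlyPeriodicMap Q J θ X F)
    (h : IsNormalForm Q J θ F j Γ P) {q : E} (hq : q ∈ Q) :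
    ContDiffAt ℝ ∞ (fun y => F (y.1, Γ y) - Γ (slowMap J θ P y)) (0, q, 0) := by
  have h1 : ContDiffAt ℝ ∞ (fun y : ParamSpace E => (y.1, Γ y)) (0, q, 0) :=
    contDiffAt_fst.prodMk (h.smooth q hq)
  refine (ContDiffAt.comp (g := F) ((0, q, 0) : ParamSpace E) ?_ h1).sub
    (ContDiffAt.comp (g := Γ) ((0, q, 0) : ParamSpace E) ?_
      (contDiffAt_slowMap hF.smooth_J hq (h.smooth_avg q hq) (h.base_avg q hq)))
  · simpa only [h.base q hq] using hF.smooth q hq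
  · rw [slowMap_base (h.base_avg q hq)]; exact h.smooth q hq

/-- Adding to `Γ` and `P` terms of degree `j` changes the error by the linearized expression. -/
theorem IsNormalForm.error_update (hF : IsNearlyPeriodicMap Q J θ X F)
    (h : IsNormalForm Q J θ F (j + 2) Γ P) {γ δ : ParamSpace E → E × E}
    (hγ : ∀ q ∈ Q, ContDiffAt ℝ ∞ γ (0, q, 0)) (hδ : ∀ q ∈ Q, ContDiffAt ℝ ∞ δ (0, q, 0))
    (hγh : IsHomogeneousAlong (fastProj E) (j + 2) γ)
    (hδh : IsHomogeneousAlong (fastProj E) (j + 2) δ) {q : E} (hq : q ∈ Q) :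
    (fun y => F (y.1, (Γ + γ) y) - (Γ + γ) (slowMap J θ (P + δ) y) -
      (F (y.1, Γ y) - Γ (slowMap J θ P y) + fderiv ℝ F (0, y.2.1, 0) (0, γ y) -
        fderiv ℝ Γ (0, y.2.1, 0) (0, (δ y).1, rot J θ y.2.1 (δ y).2) -
        γ (y.1, y.2.1, rot J θ y.2.1 y.2.2))) =O[𝓝 (0, q, 0)]
      fun y => ‖fastProj E y‖ ^ (j + 3) := by
  set a : ParamSpace E := (0, q, 0) with ha
  set N : ParamSpace E → ℝ := fun y => ‖fastProj E y‖ with hN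
  have hpa : fastProj E a = 0 := by simp [ha]
  have hQ := eventually_fst_snd_mem hF.isOpen hq
  have hfst : Tendsto (fun y : ParamSpace E => y.2.1) (𝓝 a) (𝓝 q) :=
    (continuous_fst.comp continuous_snd).tendsto' _ _ rfl
  have hN0 : Tendsto N (𝓝 a) (𝓝 0) := by
    have : Continuous N := by fun_prop
    exact this.tendsto' _ _ (by rw [hN]; simp only [hpa, norm_zero])
  have hNpow : ∀ {k l : ℕ}, k ≤ l → (fun y => N y ^ l) =O[𝓝 a] fun y => N y ^ k := by
    intro k l hkl
    refine IsBigO.of_bound 1 ?_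
    filter_upwards [hN0.eventually (ge_mem_nhds (zero_lt_one))] with y hy
    rw [one_mul, norm_pow, norm_pow, Real.norm_of_nonneg (norm_nonneg _)]
    exact pow_le_pow_of_le_one (norm_nonneg _) hy hkl
  have hγO : γ =O[𝓝 a] fun y => N y ^ (j + 2) :=
    hγh.isBigO fastProj_fastProj hpa (hγ q hq) (by simp)
  have hδO : δ =O[𝓝 a] fun y => N y ^ (j + 2) :=
    hδh.isBigO fastProj_fastProj hpa (hδ q hq) (by simp)
  have hγN : γ =O[𝓝 a] N := by simpa using hγO.trans (hNpow (k := 1) (by omega))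
  have hδN : δ =O[𝓝 a] N := by simpa using hδO.trans (hNpow (k := 1) (by omega))
  have hγa : γ a = 0 := hγh.eq_zero (by omega) hpa
  have hδa : δ a = 0 := hδh.eq_zero (by omega) hpa
  have hΓt : Tendsto Γ (𝓝 a) (𝓝 (q, 0)) := by
    have := (h.smooth q hq).continuousAt.tendsto; rwa [h.base q hq] at this
  have hγt : Tendsto γ (𝓝 a) (𝓝 0) := by
    have := (hγ q hq).continuousAt.tendsto; rwa [← ha, hγa] at this
  have hPt : Tendsto P (𝓝 a) (𝓝 (q, 0)) := by
    have := (h.smooth_avg q hq).continuousAt.tendsto; rwa [h.base_avg q hq] at this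
  have hδt : Tendsto δ (𝓝 a) (𝓝 0) := by
    have := (hδ q hq).continuousAt.tendsto; rwa [← ha, hδa] at this
  have h1t : Tendsto (fun y : ParamSpace E => y.1) (𝓝 a) (𝓝 0) :=
    continuous_fst.tendsto' _ _ rfl
  have hΓ'N : (fun y => Γ y - (y.2.1, 0)) =O[𝓝 a] N := by
    refine (isBigO_sub_base (h.smooth q hq)).congr' ?_ EventuallyEq.rfl
    filter_upwards [hQ] with y hy
    rw [h.base _ hy]
  have hPN : (fun y => P y - (y.2.1, 0)) =O[𝓝 a] N := by
    refine (isBigO_sub_base (h.smooth_avg q hq)).congr' ?_ EventuallyEq.rfl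
    filter_upwards [hQ] with y hy
    rw [h.base_avg _ hy]
  have hfstN : (fun y : ParamSpace E => y.1) =O[𝓝 a] N :=
    IsBigO.of_bound 1 (Eventually.of_forall fun y => by
      rw [one_mul, Real.norm_eq_abs, Real.norm_of_nonneg (norm_nonneg _)]
      exact abs_fst_le_norm_fastProj y)
  have hPδt : Tendsto (fun y => (P + δ) y) (𝓝 a) (𝓝 (q, 0)) := by
    simpa using hPt.add hδt
  have hPδN : (fun y => (P + δ) y - (y.2.1, 0)) =O[𝓝 a] N := by
    refine (hPN.add hδN).congr_left fun y => ?_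
    simp only [Pi.add_apply]; abel
  have hJe : ∀ᶠ q' in 𝓝 q, ContDiffAt ℝ ∞ J q' ∧ ∀ v, J q' (J q' v) = -v :=
    (hF.isOpen.eventually_mem hq).mono fun q' hq' => ⟨hF.smooth_J q' hq', hF.J_sq q' hq'⟩
  -- the change of the term with `F`
  have s1 : (fun y => F (y.1, Γ y + γ y) - F (y.1, Γ y) -
      fderiv ℝ F (0, y.2.1, 0) (0, γ y)) =O[𝓝 a] fun y => N y ^ (j + 3) := by
    have t1 : Tendsto (fun y => (y.1, Γ y + γ y)) (𝓝 a) (𝓝 a) :=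
      h1t.prodMk_nhds (by simpa using hΓt.add hγt)
    have t2 : Tendsto (fun y => (y.1, Γ y)) (𝓝 a) (𝓝 a) := h1t.prodMk_nhds hΓt
    have k1 := ((hF.smooth q hq).isBigO_sub_sub_fderiv two_le_infty).comp_tendsto
      (t1.prodMk_nhds (t2.prodMk_nhds (tendsto_sub_fastProj q)))
    have e0 : ∀ y : ParamSpace E, ∀ z z' : E × E, (y.1, z) - (y.1, z') = (0, z - z') := by
      intro y z z'; ext <;> simp
    have e1 : ∀ y : ParamSpace E, ∀ z : E × E,
        (y.1, z) - (0, y.2.1, 0) = (y.1, z - (y.2.1, 0)) := by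
      intro y z; ext <;> simp
    have e2 : ∀ x y z : E × E, x + y - z = (x - z) + y := fun x y z => by abel
    simp only [Function.comp_def, e0, add_sub_cancel_left, sub_fastProj, e1] at k1
    refine k1.trans ?_
    have k2 : (fun y => ‖((y.1, Γ y + γ y - (y.2.1, 0)) : ParamSpace E)‖ +
        ‖((y.1, Γ y - (y.2.1, 0)) : ParamSpace E)‖) =O[𝓝 a] N := by
      refine IsBigO.add (hfstN.prod_left ?_).norm_left (hfstN.prod_left hΓ'N).norm_left
      simp only [e2]
      exact hΓ'N.add hγN
    have k3 : (fun y => ‖((0, γ y) : ParamSpace E)‖) =O[𝓝 a] fun y => N y ^ (j + 2) :=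
      ((isBigO_zero _ _).prod_left hγO).norm_left
    refine (k2.mul k3).congr_right fun y => ?_
    exact (pow_succ' (N y) (j + 2)).symm
  -- the slow maps
  have hsl : Tendsto (slowMap J θ P) (𝓝 a) (𝓝 a) := by
    have := (contDiffAt_slowMap (θ := θ) hF.smooth_J hq (h.smooth_avg q hq)
      (h.base_avg q hq)).continuousAt.tendsto
    rwa [slowMap_base (h.base_avg q hq)] at this
  have hb' : (P + δ) (0, q, 0) = (q, 0) := by
    rw [Pi.add_apply, h.base_avg q hq, ← ha, hδa, add_zero]
  have hsl' : Tendsto (slowMap J θ (P + δ)) (𝓝 a) (𝓝 a) := by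
    have := (contDiffAt_slowMap (P := P + δ) (θ := θ) hF.smooth_J hq
      ((h.smooth_avg q hq).add (hδ q hq)) hb').continuousAt.tendsto
    rwa [slowMap_base hb'] at this
  have s2 : (fun y => slowMap J θ (P + δ) y - slowMap J θ P y -
      (0, (δ y).1, rot J θ y.2.1 (δ y).2)) =O[𝓝 a] fun y => N y ^ (j + 3) := by
    have k1 := isBigO_transport_sub (θ := θ) (hF.smooth_J q hq) hJe hPδt hPt hPδN hPN
    simp only [Pi.add_apply, add_sub_cancel_left, Prod.snd_add] at k1
    have k2 := k1.trans ((isBigO_refl N _).mul hδO.norm_left)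
    have k3 : (fun y => N y * N y ^ (j + 2)) = fun y => N y ^ (j + 3) := by
      ext y; ring
    rw [k3] at k2
    refine (((isBigO_zero _ _).prod_left ((isBigO_zero _ _).prod_left k2)) :
      (fun y => ((0 : ℝ), (0 : E), _)) =O[𝓝 a] _).congr_left fun y => ?_
    ext
    · simp [slowMap]
    · simp [slowMap]
    · simp only [slowMap, Pi.add_apply, Prod.fst_add, Prod.snd_add, Prod.snd_sub]; rfl
  have s2O : (fun y => slowMap J θ (P + δ) y - slowMap J θ P y) =O[𝓝 a]
      fun y => N y ^ (j + 2) := by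
    have k1 : (fun y => ((0, (δ y).1, rot J θ y.2.1 (δ y).2) : ParamSpace E)) =O[𝓝 a]
        fun y => N y ^ (j + 2) := by
      have k3 : (fun y : ParamSpace E => rot J θ y.2.1) =O[𝓝 a] fun _ => (1 : ℝ) :=
        (ContinuousAt.comp (g := rot J θ) (f := fun y : ParamSpace E => y.2.1) (x := a)
          (contDiffAt_rot (hF.smooth_J q hq) θ).continuousAt (by fun_prop)).isBigO_one ℝ
      have k2 : (fun y => rot J θ y.2.1 (δ y).2) =O[𝓝 a] fun y => N y ^ (j + 2) := by
        refine IsBigO.trans (IsBigO.of_bound 1 (Eventually.of_forall fun y => ?_))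
          ((k3.norm_left.mul hδO.norm_left).congr_right fun y => one_mul _)
        rw [one_mul, norm_mul, norm_norm, norm_norm]
        refine (ContinuousLinearMap.le_opNorm _ _).trans ?_
        gcongr
        exact norm_snd_le _
      refine (isBigO_zero _ _).prod_left (IsBigO.prod_left ?_ k2)
      exact isBigO_fst_prod.trans hδO
    refine ((s2.trans (hNpow (by omega))).add k1).congr_left fun y => ?_
    abel
  have hslN : (fun y => slowMap J θ P y - (0, y.2.1, 0)) =O[𝓝 a] N := by
    refine (isBigO_sub_base (contDiffAt_slowMap (θ := θ) hF.smooth_J hq (h.smooth_avg q hq)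
      (h.base_avg q hq))).congr' ?_ EventuallyEq.rfl
    filter_upwards [hQ] with y hy
    rw [slowMap_base (h.base_avg _ hy)]
  have hslN' : (fun y => slowMap J θ (P + δ) y - (0, y.2.1, 0)) =O[𝓝 a] N := by
    refine (hslN.add (s2O.trans (by simpa using hNpow (k := 1) (l := j + 2) (by omega)))).congr_left
      fun y => ?_
    abel
  -- The derivative of Γ is evaluated at the base point (0, q', 0). This costs a factor N on a
  -- difference that is already O(N^{j+2}).
  have s3 : (fun y => Γ (slowMap J θ (P + δ) y) - Γ (slowMap J θ P y) -
      fderiv ℝ Γ (0, y.2.1, 0) (0, (δ y).1, rot J θ y.2.1 (δ y).2)) =O[𝓝 a]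
      fun y => N y ^ (j + 3) := by
    have k1 := ((h.smooth q hq).isBigO_sub_sub_fderiv two_le_infty).comp_tendsto
      (hsl'.prodMk_nhds (hsl.prodMk_nhds (tendsto_sub_fastProj q)))
    simp only [Function.comp_def, sub_fastProj] at k1
    have k2 := k1.trans (((hslN'.norm_left.add hslN.norm_left)).mul s2O.norm_left)
    have k4 : (fun y : ParamSpace E => fderiv ℝ Γ (0, y.2.1, 0)) =O[𝓝 a] fun _ => (1 : ℝ) := by
      have : ContinuousAt (fun y : ParamSpace E => fderiv ℝ Γ (0, y.2.1, 0)) a :=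
        ContinuousAt.comp (g := fderiv ℝ Γ) (f := fun y : ParamSpace E => ((0 : ℝ), y.2.1, (0 : E)))
          (x := a) (((h.smooth q hq).fderiv_right (m := 0) (by simp)).continuousAt) (by fun_prop)
      exact this.isBigO_one ℝ
    have k5 : (fun y => fderiv ℝ Γ (0, y.2.1, 0) (slowMap J θ (P + δ) y - slowMap J θ P y -
      (0, (δ y).1, rot J θ y.2.1 (δ y).2))) =O[𝓝 a] fun y => N y ^ (j + 3) := by
      refine IsBigO.trans (IsBigO.of_bound 1 (Eventually.of_forall fun y => ?_))
          ((k4.norm_left.mul s2.norm_left).congr_right fun y => one_mul _)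
      rw [one_mul, norm_mul, norm_norm, norm_norm]
      exact ContinuousLinearMap.le_opNorm _ _
    refine ((k2.congr_right fun y => ?_).add k5).congr_left fun y => ?_
    · exact (pow_succ' (N y) (j + 2)).symm
    · rw [map_sub (fderiv ℝ Γ (0, y.2.1, 0)) (slowMap J θ (P + δ) y - slowMap J θ P y)]; abel
  have hδ2 : (fun y => ((P + δ) y).2 - y.2.2) =O[𝓝 a] fun y => N y ^ 2 := by
    refine ((h.avg_snd q hq).add ((isBigO_snd_prod.trans hδO).trans
      (hNpow (k := 2) (by omega)))).congr_left fun y => ?_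
    simp only [Pi.add_apply, Prod.snd_add]; abel
  -- The arguments of γ differ by O(N), but their fast parts only by O(N²), which is what `avg_snd`
  -- is for. The two terms in the estimate for homogeneous maps are then N^{j+2}·N and N^{j+1}·N².
  have s4 : (fun y => γ (slowMap J θ (P + δ) y) - γ (y.1, y.2.1, rot J θ y.2.1 y.2.2)) =O[𝓝 a]
      fun y => N y ^ (j + 3) := by
    have tS : Tendsto (fun y : ParamSpace E => (y.1, y.2.1, rot J θ y.2.1 y.2.2)) (𝓝 a) (𝓝 a) := by
      have := (contDiffAt_rot_snd (hF.smooth_J q hq) θ).continuousAt.tendsto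
      simpa using this
    have hSN : (fun y : ParamSpace E => (y.1, y.2.1, rot J θ y.2.1 y.2.2) - (0, y.2.1, 0))
        =O[𝓝 a] N := by
      refine (isBigO_sub_base (contDiffAt_rot_snd (hF.smooth_J q hq) θ)).congr_left fun y => ?_
      simp
    obtain ⟨C, hC⟩ := hγh.norm_sub_le hpa (hγ q hq) (by simp)
    have hC' := (hsl'.prodMk_nhds tS).eventually hC
    -- the difference of the arguments, and its fast part
    have d1 : (fun y => slowMap J θ (P + δ) y - (y.1, y.2.1, rot J θ y.2.1 y.2.2)) =O[𝓝 a] N :=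
      (hslN'.sub hSN).congr_left fun y => by abel
    have d2 : (fun y => fastProj E (slowMap J θ (P + δ) y - (y.1, y.2.1, rot J θ y.2.1 y.2.2)))
        =O[𝓝 a] fun y => N y ^ 2 := by
      have t0 : Tendsto (fun y : ParamSpace E => (y.2.1, (0 : E))) (𝓝 a) (𝓝 (q, 0)) :=
        hfst.prodMk_nhds tendsto_const_nhds
      have k1 := isBigO_transport_sub (θ := θ) (hF.smooth_J q hq) hJe hPδt t0 hPδN
        ((isBigO_zero _ _).congr_left fun y => (sub_self _).symm)
      have k2 := k1.trans ((isBigO_refl N _).mul hPδN.norm_left)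
      simp only [transport_zero, sub_zero] at k2
      have k3 : (fun y : ParamSpace E => rot J θ y.2.1) =O[𝓝 a] fun _ => (1 : ℝ) :=
        (ContinuousAt.comp (g := rot J θ) (f := fun y : ParamSpace E => y.2.1) (x := a)
          (contDiffAt_rot (hF.smooth_J q hq) θ).continuousAt (by fun_prop)).isBigO_one ℝ
      have k4 : (fun y => rot J θ y.2.1 (((P + δ) y).2 - y.2.2)) =O[𝓝 a] fun y => N y ^ 2 := by
        refine IsBigO.trans (IsBigO.of_bound 1 (Eventually.of_forall fun y => ?_))
          ((k3.norm_left.mul hδ2.norm_left).congr_right fun y => one_mul _)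
        rw [one_mul, norm_mul, norm_norm, norm_norm]
        exact ContinuousLinearMap.le_opNorm _ _
      have k5 := (k2.congr_right fun y => (pow_two (N y)).symm).add k4
      refine (((isBigO_zero _ _).prod_left ((isBigO_zero _ _).prod_left k5)) :
        (fun y => ((0 : ℝ), (0 : E), _)) =O[𝓝 a] _).congr_left fun y => ?_
      ext
      · simp [slowMap]
      · simp [slowMap]
      · simp only [slowMap, fastProj_apply, map_sub, Prod.snd_sub]; abel
    have d3 : (fun y => fastProj E (slowMap J θ (P + δ) y)) =O[𝓝 a] N := by
      refine (((fastProj E).isBigO_comp _ _).trans hslN').congr_left fun y => ?_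
      simp
    have d4 : (fun y : ParamSpace E => fastProj E (y.1, y.2.1, rot J θ y.2.1 y.2.2)) =O[𝓝 a] N := by
      refine (((fastProj E).isBigO_comp _ _).trans hSN).congr_left fun y => ?_
      simp
    obtain ⟨c1, hc1, b1⟩ := d1.exists_pos
    obtain ⟨c2, hc2, b2⟩ := d2.exists_pos
    obtain ⟨c3, hc3, b3⟩ := d3.exists_pos
    obtain ⟨c4, hc4, b4⟩ := d4.exists_pos
    set D := c3 + c4 with hD
    refine IsBigO.of_bound (|C| * (D ^ (j + 2) * c1 + D ^ (j + 1) * c2)) ?_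
    filter_upwards [hC', b1.bound, b2.bound, b3.bound, b4.bound] with y hy f1 f2 f3 f4
    have hNy : ‖N y‖ = N y := Real.norm_of_nonneg (norm_nonneg _)
    have hNy0 : 0 ≤ N y := norm_nonneg _
    rw [norm_pow] at f2
    rw [hNy] at f1 f2 f3 f4
    rw [norm_pow, hNy]
    have g3 : ‖fastProj E (slowMap J θ (P + δ) y)‖ ≤ D * N y :=
      f3.trans (by rw [hD]; gcongr; linarith)
    have g4 : ‖fastProj E (y.1, y.2.1, rot J θ y.2.1 y.2.2)‖ ≤ D * N y :=
      f4.trans (by rw [hD]; gcongr; linarith)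
    refine (hy (D * N y) g3 g4).trans ?_
    calc C * ((D * N y) ^ (j + 1 + 1) * ‖slowMap J θ (P + δ) y -
          (y.1, y.2.1, rot J θ y.2.1 y.2.2)‖ + (D * N y) ^ (j + 1) *
          ‖fastProj E (slowMap J θ (P + δ) y - (y.1, y.2.1, rot J θ y.2.1 y.2.2))‖)
        ≤ |C| * ((D * N y) ^ (j + 1 + 1) * (c1 * N y) + (D * N y) ^ (j + 1) * (c2 * N y ^ 2)) := by
          gcongr
          exact le_abs_self C
      _ = _ := by ring_nf
  refine ((s1.sub s3).sub s4).congr_left fun y => ?_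
  simp only [Pi.add_apply]
  abel

end NormalFormStep

/-! ### Existence of normal forms of every order -/

section NormalFormExistence

variable {E : Type*} [NormedAddCommGroup E] [NormedSpace ℝ E]
variable {Q : Set E} {J : E → E →L[ℝ] E} {θ : ℝ} {X : E → E} {F : ParamSpace E → E × E}
  {j : ℕ} {Γ P : ParamSpace E → E × E}

theorem isBigO_fastProj_pow (q : E) {k l : ℕ} (hkl : k ≤ l) :
    (fun y => ‖fastProj E y‖ ^ l) =O[𝓝 (0, q, 0)] fun y => ‖fastProj E y‖ ^ k := by
  have hN0 : Tendsto (fun y => ‖fastProj E y‖) (𝓝 (0, q, 0)) (𝓝 0) := by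
    have : Continuous fun y => ‖fastProj E y‖ := by fun_prop
    exact this.tendsto' _ _ (by simp)
  refine IsBigO.of_bound 1 ?_
  filter_upwards [hN0.eventually (ge_mem_nhds (zero_lt_one))] with y hy
  rw [one_mul, norm_pow, norm_pow, norm_norm]
  exact pow_le_pow_of_le_one (norm_nonneg _) hy hkl

/-- Corrections of degree at least 2 vanish to second order at the base points, so the linearization
of Γ found at the start is never disturbed. -/
theorem fderiv_add_homogeneous {V : Type*} [NormedAddCommGroup V] [NormedSpace ℝ V]
    {Γ γ : ParamSpace E → V} {q : E} (hΓ : ContDiffAt ℝ ∞ Γ (0, q, 0))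
    (hγ : ContDiffAt ℝ ∞ γ (0, q, 0)) (hγh : IsHomogeneousAlong (fastProj E) (j + 2) γ) :
    fderiv ℝ (Γ + γ) (0, q, 0) = fderiv ℝ Γ (0, q, 0) := by
  have h1 : HasFDerivAt γ (0 : ParamSpace E →L[ℝ] V) (0, q, 0) := by
    refine HasFDerivAt.of_isLittleO ?_
    have h2 : γ =O[𝓝 (0, q, 0)] fun y => ‖fastProj E y‖ ^ (j + 2) :=
      hγh.isBigO fastProj_fastProj (by simp) hγ (by simp)
    have h3 : γ (0, q, 0) = 0 := hγh.eq_zero (by omega) (by simp)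
    have h4 : (fun y => fastProj E y) =O[𝓝 (0, q, 0)] fun y => y - (0, q, 0) := by
      refine ((fastProj E).isBigO_comp (fun y => y - (0, q, 0)) _).congr_left fun y => ?_
      simp
    simp only [h3, sub_zero, zero_apply]
    refine (h2.trans (isBigO_fastProj_pow q (k := 2) (by omega))).trans_isLittleO ?_
    have h5 : (fun y : ParamSpace E => y - (0, q, 0)) =o[𝓝 (0, q, 0)] fun _ => (1 : ℝ) := by
      rw [isLittleO_one_iff]
      have : Continuous fun y : ParamSpace E => y - (0, q, 0) := by fun_prop
      exact this.tendsto' _ _ (by simp)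
    have h6 := (h4.norm_left.trans_isLittleO h5).mul_isBigO h4.norm_norm
    simpa [pow_two] using h6
  rw [fderiv_add (hΓ.differentiableAt (by simp)) h1.differentiableAt, h1.fderiv, add_zero]

theorem eq_zero_of_homogeneous_of_isBigO {V : Type*} [NormedAddCommGroup V] [NormedSpace ℝ V]
    {k : ℕ} {v : V} (h : (fun t : ℝ => t ^ k • v) =O[𝓝 0] fun t => t ^ (k + 1)) : v = 0 := by
  obtain ⟨C, hC⟩ := h.bound
  have h2 : ‖v‖ ≤ 0 := by
    have : Tendsto (fun t : ℝ => C * t) (𝓝[>] 0) (𝓝 (C * 0)) :=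
      (tendsto_const_nhds.mul tendsto_id).mono_left nhdsWithin_le_nhds
    rw [mul_zero] at this
    refine ge_of_tendsto this ?_
    filter_upwards [self_mem_nhdsWithin, hC.filter_mono nhdsWithin_le_nhds] with t ht hb
    have ht' : 0 < t := ht
    rw [norm_smul, norm_pow, norm_pow, Real.norm_of_nonneg ht'.le, pow_succ] at hb
    have : t ^ k * ‖v‖ ≤ t ^ k * (C * t) := by linarith
    exact le_of_mul_le_mul_left this (by positivity)
  exact norm_le_zero_iff.1 h2

/-- Let r = (r₁, r₂) be the leading Taylor term of the error. In the combinations r₁ + J r₂ and r₂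
the linearized equation for the corrections decouples into a cohomological equation for invariant
functions and one for equivariant functions. Both are solved by the rotation weights, their averages
being added to P. The last conclusion is used once, at the lowest order: if the fast error is small
on w = 0, the correction does not move the second component of Γ there. -/
theorem IsNormalForm.exists_succ [CompleteSpace E] (hF : IsNearlyPeriodicMap Q J θ X F)
    (hθ : Irrational (θ / (2 * Real.pi))) (h : IsNormalForm Q J θ F (j + 2) Γ P) :
    ∃ Γ' P', IsNormalForm Q J θ F (j + 3) Γ' P' ∧
      (∀ q ∈ Q, (Γ' - Γ) =O[𝓝 (0, q, 0)] fun y => ‖fastProj E y‖ ^ (j + 2)) ∧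
      ((∀ q ∈ Q, (fun t : ℝ => (F (t, Γ (t, q, 0)) - Γ (slowMap J θ P (t, q, 0))).2)
        =O[𝓝 0] fun t => t ^ (j + 3)) → ∀ h, ∀ q ∈ Q, (Γ' (h, q, 0)).2 = (Γ (h, q, 0)).2) := by
  set err : ParamSpace E → E × E := fun y => F (y.1, Γ y) - Γ (slowMap J θ P y) with herr
  have herrs : ∀ q ∈ Q, ContDiffAt ℝ ∞ err (0, q, 0) := fun q hq => h.contDiffAt_error hF hq
  set r : ParamSpace E → E × E := taylorTerm (fastProj E) (j + 2) err with hr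
  have hrs : ∀ q ∈ Q, ContDiffAt ℝ ∞ r (0, q, 0) := fun q hq => by
    refine contDiffAt_taylorTerm _ ?_
    rw [sub_fastProj]; exact herrs q hq
  have hrh : IsHomogeneousAlong (fastProj E) (j + 2) r :=
    isHomogeneousAlong_taylorTerm fastProj_fastProj _ _
  have hrO : ∀ q ∈ Q, (fun y => err y - r y) =O[𝓝 (0, q, 0)]
      fun y => ‖fastProj E y‖ ^ (j + 3) := fun q hq =>
    isBigO_sub_taylorTerm fastProj_fastProj (by simp) (herrs q hq) (h.error q hq)
  set rp : ParamSpace E → E := fun y => (r y).2 with hrp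
  set rq : ParamSpace E → E := fun y => (r y).1 + J y.2.1 (r y).2 with hrq
  have hJs : ∀ q ∈ Q, ContDiffAt ℝ ∞ (fun y : ParamSpace E => J y.2.1) (0, q, 0) := fun q hq =>
    ContDiffAt.comp (g := J) ((0, q, 0) : ParamSpace E) (hF.smooth_J q hq) contDiffAt_snd.fst
  have hrps : ∀ q ∈ Q, ContDiffAt ℝ ∞ rp (0, q, 0) := fun q hq => (hrs q hq).snd
  have hrqs : ∀ q ∈ Q, ContDiffAt ℝ ∞ rq (0, q, 0) := fun q hq =>
    (hrs q hq).fst.add ((hJs q hq).clm_apply (hrs q hq).snd)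
  have hrph : IsHomogeneousAlong (fastProj E) (j + 2) rp := fun y t => by
    simp only [hrp, hrh y t, Prod.smul_snd]
  have hrqh : IsHomogeneousAlong (fastProj E) (j + 2) rq := by
    rw [isHomogeneousAlong_fastProj_iff] at hrh ⊢
    intro h q w t
    simp only [hrq, hrh, Prod.smul_snd, Prod.smul_fst, map_smul, smul_add]
  -- The Taylor term has trigonometric degree j + 2, and rotating the fast component back raises it
  -- by one.
  obtain ⟨K, m, n, hm, hmn⟩ := exists_rotation_weights hθ (j + 3) E
  have hrtrig := fun (t : ℝ) (q w : E) =>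
    taylorTerm_rot_mem_trigPoly (J := J) (j + 2) err t q w
  have hrptrig : ∀ (t : ℝ) (q w : E), (fun φ => rp (t, q, rot J φ q w)) ∈ trigPoly E (j + 2) :=
    fun t q w => comp_mem_trigPoly (LinearMap.snd ℝ E E) (hrtrig t q w)
  have hrqtrig : ∀ (t : ℝ) (q w : E), (fun φ => rq (t, q, rot J φ q w)) ∈ trigPoly E (j + 2) :=
    fun t q w => Submodule.add_mem _ (comp_mem_trigPoly (LinearMap.fst ℝ E E) (hrtrig t q w))
      (comp_mem_trigPoly ((J q : E →ₗ[ℝ] E) ∘ₗ LinearMap.snd ℝ E E) (hrtrig t q w))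
  set γ : ParamSpace E → E × E := fun y =>
    (slowAvg J θ K n rq y - J y.2.1 (fastAvg J θ K n rp y), fastAvg J θ K n rp y) with hγ
  set δ : ParamSpace E → E × E := fun y => (slowAvg J θ K m rq y, fastAvg J θ K m rp y) with hδ
  have hγs : ∀ q ∈ Q, ContDiffAt ℝ ∞ γ (0, q, 0) := fun q hq =>
    ((contDiffAt_slowAvg (hF.smooth_J q hq) (hrqs q hq)).sub
      ((hJs q hq).clm_apply (contDiffAt_fastAvg (hF.smooth_J q hq) (hrps q hq)))).prodMk
      (contDiffAt_fastAvg (hF.smooth_J q hq) (hrps q hq))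
  have hδs : ∀ q ∈ Q, ContDiffAt ℝ ∞ δ (0, q, 0) := fun q hq =>
    (contDiffAt_slowAvg (hF.smooth_J q hq) (hrqs q hq)).prodMk
      (contDiffAt_fastAvg (hF.smooth_J q hq) (hrps q hq))
  have hah := isHomogeneousAlong_fastProj_iff.1 (isHomogeneousAlong_fastAvg (J := J) (θ := θ)
    (K := K) (c := n) hrph)
  have hbh := isHomogeneousAlong_fastProj_iff.1 (isHomogeneousAlong_slowAvg (J := J) (θ := θ)
    (K := K) (c := n) hrqh)
  have hch := isHomogeneousAlong_fastProj_iff.1 (isHomogeneousAlong_fastAvg (J := J) (θ := θ)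
    (K := K) (c := m) hrph)
  have hdh := isHomogeneousAlong_fastProj_iff.1 (isHomogeneousAlong_slowAvg (J := J) (θ := θ)
    (K := K) (c := m) hrqh)
  have hγh : IsHomogeneousAlong (fastProj E) (j + 2) γ := by
    rw [isHomogeneousAlong_fastProj_iff]
    intro h q w t
    simp only [hγ, hah, hbh, map_smul, Prod.smul_mk, smul_sub]
  have hδh : IsHomogeneousAlong (fastProj E) (j + 2) δ := by
    rw [isHomogeneousAlong_fastProj_iff]
    intro h q w t
    simp only [hδ, hch, hdh, Prod.smul_mk]
  have hγO : ∀ q ∈ Q, γ =O[𝓝 (0, q, 0)] fun y => ‖fastProj E y‖ ^ (j + 2) := fun q hq =>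
    hγh.isBigO fastProj_fastProj (by simp) (hγs q hq) (by simp)
  have hδO : ∀ q ∈ Q, δ =O[𝓝 (0, q, 0)] fun y => ‖fastProj E y‖ ^ (j + 2) := fun q hq =>
    hδh.isBigO fastProj_fastProj (by simp) (hδs q hq) (by simp)
  refine ⟨Γ + γ, P + δ, ⟨?_, ?_, ?_, ?_, ?_, ?_, ?_, ?_⟩, ?_, ?_⟩
  · exact fun q hq => (h.smooth q hq).add (hγs q hq)
  · exact fun q hq => (h.smooth_avg q hq).add (hδs q hq)
  · intro q hq
    rw [Pi.add_apply, h.base q hq, hγh.eq_zero (by omega) (by simp), add_zero]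
  · intro q hq
    rw [Pi.add_apply, h.base_avg q hq, hδh.eq_zero (by omega) (by simp), add_zero]
  · intro q hq
    rw [fderiv_add_homogeneous (h.smooth q hq) (hγs q hq) hγh]
    exact h.deriv q hq
  · intro q hq
    refine ((h.avg_snd q hq).add ((isBigO_snd_prod.trans (hδO q hq)).trans
      (isBigO_fastProj_pow q (k := 2) (by omega)))).congr_left fun y => ?_
    simp only [Pi.add_apply, Prod.snd_add]; abel
  · intro t q hq w φ
    have hJq := hF.J_sq q hq
    simp only [Pi.add_apply, h.avg_rot t q hq w φ, hδ]
    rw [slowAvg_rot hJq fun φ => hm _ (mem_trigPoly_succ (hrqtrig t q w)) φ,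
      fastAvg_rot hJq fun φ => hm _ (rot_neg_mem_trigPoly (J := J) (q := q) (hrptrig t q w)) φ]
    ext <;> simp
  · intro q hq
    have h1 := (h.error_update hF hγs hδs hγh hδh hq).add (hrO q hq)
    refine h1.congr' ?_ EventuallyEq.rfl
    filter_upwards [eventually_fst_snd_mem hF.isOpen hq] with y hy
    have hJq := hF.J_sq y.2.1 hy
    have e1 := fastAvg_cohomology (f := rp) hmn hJq y.1 y.2.2
    have e2 := slowAvg_cohomology (f := rq) hmn hJq y.1 y.2.2
    simp only [Prod.mk.eta] at e1 e2
    -- The linearized equation: its second component is the fast cohomological equation, and its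
    -- first component is the slow one minus J of the fast one.
    have e3 : r y + fderiv ℝ F (0, y.2.1, 0) (0, γ y) -
        fderiv ℝ Γ (0, y.2.1, 0) (0, (δ y).1, rot J θ y.2.1 (δ y).2) -
        γ (y.1, y.2.1, rot J θ y.2.1 y.2.2) = 0 := by
      have e4 : ((0 : ℝ), γ y) = (0, (γ y).1, (γ y).2) := rfl
      rw [e4, hF.deriv _ hy, h.deriv _ hy]
      simp only [hγ, hδ]
      have e5 : (r y).2 = rp y := rfl
      have e6 : (r y).1 = rq y - J y.2.1 (rp y) := by simp [hrq, hrp]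
      have e7 := congrArg (J y.2.1) e1
      simp only [map_sub, map_add] at e7
      refine Prod.ext ?_ ?_
      · simp only [Prod.fst_add, Prod.fst_sub, Prod.fst_zero, e6, zero_smul, add_zero, map_sub]
        rw [← e2, ← e7]
        abel
      · simp only [Prod.snd_add, Prod.snd_sub, Prod.snd_zero, e5]
        rw [← e1]
        abel
    have e8 : err y = F (y.1, Γ y) - Γ (slowMap J θ P y) := rfl
    rw [← e8]
    refine sub_eq_zero.1 (Eq.trans ?_ (neg_eq_zero.2 e3))
    abel
  · intro q hq
    exact (hγO q hq).congr_left fun y => by simp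
  · intro h0 t q hq
    -- By homogeneity rp(t, q, 0) = t^{j+2} rp(1, q, 0), whereas the hypothesis makes it O(t^{j+3}).
    have hz : rp (1, q, 0) = 0 := by
      refine eq_zero_of_homogeneous_of_isBigO (k := j + 2) ?_
      have t1 : Tendsto (fun t : ℝ => ((t, q, 0) : ParamSpace E)) (𝓝 0) (𝓝 (0, q, 0)) := by
        have : Continuous fun t : ℝ => ((t, q, 0) : ParamSpace E) := by fun_prop
        exact this.tendsto' _ _ rfl
      have k1 := isBigO_snd_prod.trans ((hrO q hq).comp_tendsto t1)
      have k2 : (fun t : ℝ => ‖fastProj E (t, q, 0)‖ ^ (j + 3)) = fun t => ‖t ^ (j + 3)‖ := by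
        ext t; simp
      have k3 := ((h0 q hq).sub (k1.trans (by
        simp only [Function.comp_def, k2]; exact (isBigO_refl _ _).norm_left)))
      refine k3.congr_left fun t => ?_
      have := isHomogeneousAlong_fastProj_iff.1 hrph 1 q 0 t
      rw [mul_one, smul_zero] at this
      rw [← this]
      simp [herr, hrp]
    have hz' : rp (t, q, 0) = 0 := by
      have := isHomogeneousAlong_fastProj_iff.1 hrph 1 q 0 t
      rw [mul_one, smul_zero, hz, smul_zero] at this
      exact this
    simp only [Pi.add_apply, Prod.snd_add, hγ, fastAvg_eq_zero hz', add_zero]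

/-- The coordinates q − J w and w split the linearization of F into the identity and the rotation,
so the error vanishes to first order at every base point. -/
theorem IsNearlyPeriodicMap.isNormalForm_two (hF : IsNearlyPeriodicMap Q J θ X F) :
    IsNormalForm Q J θ F 2 (fun y => (y.2.1 - J y.2.1 y.2.2, y.2.2))
      (fun y => (y.2.1 + y.1 • X y.2.1, y.2.2)) := by
  set Γ : ParamSpace E → E × E := fun y => (y.2.1 - J y.2.1 y.2.2, y.2.2) with hΓ
  set P : ParamSpace E → E × E := fun y => (y.2.1 + y.1 • X y.2.1, y.2.2) with hP
  have hJs : ∀ q ∈ Q, ContDiffAt ℝ ∞ (fun y : ParamSpace E => J y.2.1) (0, q, 0) := fun q hq =>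
    ContDiffAt.comp (g := J) ((0, q, 0) : ParamSpace E) (hF.smooth_J q hq) contDiffAt_snd.fst
  have hXs : ∀ q ∈ Q, ContDiffAt ℝ ∞ (fun y : ParamSpace E => X y.2.1) (0, q, 0) := fun q hq =>
    ContDiffAt.comp (g := X) ((0, q, 0) : ParamSpace E) (hF.smooth_X q hq) contDiffAt_snd.fst
  have hΓs : ∀ q ∈ Q, ContDiffAt ℝ ∞ Γ (0, q, 0) := fun q hq =>
    (contDiffAt_snd.fst.sub ((hJs q hq).clm_apply contDiffAt_snd.snd)).prodMk contDiffAt_snd.snd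
  have hPs : ∀ q ∈ Q, ContDiffAt ℝ ∞ P (0, q, 0) := fun q hq =>
    (contDiffAt_snd.fst.add (contDiffAt_fst.smul (hXs q hq))).prodMk contDiffAt_snd.snd
  have hΓb : ∀ q ∈ Q, Γ (0, q, 0) = (q, 0) := fun q _ => by simp [hΓ]
  have hPb : ∀ q ∈ Q, P (0, q, 0) = (q, 0) := fun q _ => by simp [hP]
  have d1 : ∀ y, HasFDerivAt (fun y : ParamSpace E => y.1)
      (ContinuousLinearMap.fst ℝ ℝ (E × E)) y := fun y => hasFDerivAt_fst
  have d2 : ∀ y, HasFDerivAt (fun y : ParamSpace E => y.2.1)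
      ((ContinuousLinearMap.fst ℝ E E).comp (ContinuousLinearMap.snd ℝ ℝ (E × E))) y := fun y =>
    ((ContinuousLinearMap.fst ℝ E E).comp (ContinuousLinearMap.snd ℝ ℝ (E × E))).hasFDerivAt
  have d3 : ∀ y, HasFDerivAt (fun y : ParamSpace E => y.2.2)
      ((ContinuousLinearMap.snd ℝ E E).comp (ContinuousLinearMap.snd ℝ ℝ (E × E))) y := fun y =>
    ((ContinuousLinearMap.snd ℝ E E).comp (ContinuousLinearMap.snd ℝ ℝ (E × E))).hasFDerivAt
  have hΓd : ∀ q ∈ Q, ∀ h u w, fderiv ℝ Γ (0, q, 0) (h, u, w) = (u - J q w, w) := by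
    intro q hq h u w
    have h1 : HasFDerivAt Γ _ (0, q, 0) := ((d2 (0, q, 0)).sub
      (((hJs q hq).differentiableAt (by simp)).hasFDerivAt.clm_apply (d3 (0, q, 0)))).prodMk
      (d3 (0, q, 0))
    rw [h1.fderiv]
    simp
  have hPd : ∀ q ∈ Q, ∀ h u w, fderiv ℝ P (0, q, 0) (h, u, w) = (u + h • X q, w) := by
    intro q hq h u w
    have h1 : HasFDerivAt P _ (0, q, 0) := ((d2 (0, q, 0)).add
      ((d1 (0, q, 0)).smul ((hXs q hq).differentiableAt (by simp)).hasFDerivAt)).prodMk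
      (d3 (0, q, 0))
    rw [h1.fderiv]
    simp
  refine ⟨hΓs, hPs, hΓb, hPb, hΓd, fun q _ => ?_, fun h q hq w φ => by simp [hP], fun q hq => ?_⟩
  · simp only [hP, sub_self]; exact isBigO_zero _ _
  set err : ParamSpace E → E × E := fun y => F (y.1, Γ y) - Γ (slowMap J θ P y) with herr
  have hsd : ∀ q ∈ Q, ∃ A : ParamSpace E →L[ℝ] ParamSpace E, HasFDerivAt (slowMap J θ P) A (0, q, 0) ∧
      ∀ h u w, A (h, u, w) = (h, u + h • X q, rot J θ q w) := by
    intro q hq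
    have hJq := hF.smooth_J q hq
    have hT : HasFDerivAt (transport J θ) _ (q, q, 0) :=
      ((contDiffAt_transport (θ := θ) (p := (q, q, 0)) hJq hJq).differentiableAt
        (by simp)).hasFDerivAt
    have hPf := ((hPs q hq).differentiableAt (by simp)).hasFDerivAt
    have hin : HasFDerivAt (fun y : ParamSpace E => (y.2.1, P y)) _ (0, q, 0) :=
      (d2 (0, q, 0)).prodMk hPf
    have hT' : HasFDerivAt (transport J θ) (fderiv ℝ (transport J θ) (q, q, 0))
        ((fun y : ParamSpace E => (y.2.1, P y)) (0, q, 0)) := by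
      simpa only [hPb q hq] using hT
    refine ⟨_, (d1 (0, q, 0)).prodMk ((hPf.fst).prodMk (HasFDerivAt.comp
      (g := transport J θ) (f := fun y : ParamSpace E => (y.2.1, P y)) (0, q, 0) hT' hin)), fun h u w => ?_⟩
    simp only [ContinuousLinearMap.prod_apply, ContinuousLinearMap.comp_apply,
      ContinuousLinearMap.coe_fst', ContinuousLinearMap.coe_snd', hPd q hq]
    rw [fderiv_transport hJq (hF.J_sq q hq)]
  have herrd : ∀ q ∈ Q, ContDiffAt ℝ ∞ err (0, q, 0) ∧ err (0, q, 0) = 0 ∧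
      fderiv ℝ err (0, q, 0) = 0 := by
    intro q hq
    have h0 : slowMap J θ P (0, q, 0) = (0, q, 0) := slowMap_base (hPb q hq)
    have hΓf := ((hΓs q hq).differentiableAt (by simp)).hasFDerivAt
    obtain ⟨A, hA, hA'⟩ := hsd q hq
    have e1 : HasFDerivAt (fun y : ParamSpace E => (y.1, Γ y)) _ (0, q, 0) :=
      (d1 (0, q, 0)).prodMk hΓf
    have c1 : ContDiffAt ℝ ∞ (fun y : ParamSpace E => (y.1, Γ y)) (0, q, 0) :=
      contDiffAt_fst.prodMk (hΓs q hq)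
    have c2 : ContDiffAt ℝ ∞ F ((fun y : ParamSpace E => (y.1, Γ y)) (0, q, 0)) := by
      simpa only [hΓb q hq] using hF.smooth q hq
    have e2 : HasFDerivAt F (fderiv ℝ F (0, q, 0))
        ((fun y : ParamSpace E => (y.1, Γ y)) (0, q, 0)) := by
      simpa only [hΓb q hq] using ((hF.smooth q hq).differentiableAt (by simp)).hasFDerivAt
    have c3 : ContDiffAt ℝ ∞ Γ (slowMap J θ P (0, q, 0)) := by rw [h0]; exact hΓs q hq
    have e3 : HasFDerivAt Γ (fderiv ℝ Γ (0, q, 0)) (slowMap J θ P (0, q, 0)) := by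
      rw [h0]; exact hΓf
    have e4 : HasFDerivAt err _ (0, q, 0) := (HasFDerivAt.comp (g := F)
      (f := fun y : ParamSpace E => (y.1, Γ y)) (0, q, 0) e2 e1).sub (e3.comp _ hA)
    refine ⟨(ContDiffAt.comp (g := F)
      (f := fun y : ParamSpace E => (y.1, Γ y)) (0, q, 0) c2 c1).sub (c3.comp _ (contDiffAt_slowMap hF.smooth_J hq (hPs q hq)
      (hPb q hq))), ?_, ?_⟩
    · simp only [herr, h0, hΓb q hq, hF.base q hq, sub_self]
    · rw [e4.fderiv]
      refine ContinuousLinearMap.ext fun ⟨h, u, w⟩ => ?_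
      have hp : ((h, u - J q w, w) : ParamSpace E) = (h, (u - J q w, w)) := rfl
      simp only [_root_.sub_apply, ContinuousLinearMap.comp_apply,
        ContinuousLinearMap.prod_apply, hΓd q hq, hA', ContinuousLinearMap.coe_fst',
        hF.deriv q hq, zero_apply]
      rw [Prod.mk_sub_mk, map_sub]
      ext <;> simp
      abel
  have hQ := eventually_fst_snd_mem hF.isOpen hq
  -- Taylor's estimate from the moving base point y − π y, where the error and its derivative both
  -- vanish.
  have k1 := ((herrd q hq).1.isBigO_sub_sub_fderiv two_le_infty).comp_tendsto
    (tendsto_id.prodMk_nhds ((tendsto_sub_fastProj q).prodMk_nhds (tendsto_sub_fastProj q)))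
  refine k1.congr' ?_ (Eventually.of_forall fun y => ?_)
  · filter_upwards [hQ] with y hy
    simp only [Function.comp_apply, sub_fastProj, id, (herrd _ hy).2.1, (herrd _ hy).2.2,
      zero_apply, sub_zero]
  · simp only [Function.comp_apply, id, sub_sub_cancel, sub_self, norm_zero, add_zero, pow_two]

/-- The bound on the second component of Γ at w = 0 makes w comparable with p up to O(|ħ|³). The
correction of degree 2 could destroy it, but that one vanishes on w = 0 by the hypothesis on F;
later corrections have degree at least 3. -/
theorem IsNearlyPeriodicMap.exists_isNormalForm [CompleteSpace E]
    (hF : IsNearlyPeriodicMap Q J θ X F) (hθ : Irrational (θ / (2 * Real.pi)))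
    (h3 : ∀ q ∈ Q, (fun y : ParamSpace E => (F (y.1, y.2.1, 0)).2) =O[𝓝 (0, q, 0)]
      fun y => |y.1| ^ 3) (L : ℕ) :
    ∃ Γ P, IsNormalForm Q J θ F (L + 3) Γ P ∧
      ∀ q ∈ Q, (fun y : ParamSpace E => (Γ (y.1, y.2.1, 0)).2) =O[𝓝 (0, q, 0)]
        fun y => |y.1| ^ 3 := by
  induction L with
  | zero =>
    obtain ⟨Γ, P, h, -, h0⟩ := hF.isNormalForm_two.exists_succ hF hθ
    refine ⟨Γ, P, h, fun q hq => ?_⟩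
    have hz := h0 fun q hq => ?_
    · refine (isBigO_zero _ _).congr' ?_ EventuallyEq.rfl
      filter_upwards [eventually_fst_snd_mem hF.isOpen hq] with y hy
      exact (hz y.1 _ hy).symm
    · have t1 : Tendsto (fun t : ℝ => ((t, q, 0) : ParamSpace E)) (𝓝 0) (𝓝 (0, q, 0)) := by
        have : Continuous fun t : ℝ => ((t, q, 0) : ParamSpace E) := by fun_prop
        exact this.tendsto' _ _ rfl
      have k1 := (h3 q hq).comp_tendsto t1
      simp only [Function.comp_def, ← Real.norm_eq_abs, ← norm_pow] at k1
      simpa [slowMap, transport_zero] using k1.of_norm_right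
  | succ L ih =>
    obtain ⟨Γ, P, h, hz⟩ := ih
    obtain ⟨Γ', P', h', hd, -⟩ := h.exists_succ hF hθ
    refine ⟨Γ', P', h', fun q hq => ?_⟩
    have t1 : Tendsto (fun y : ParamSpace E => ((y.1, y.2.1, 0) : ParamSpace E)) (𝓝 (0, q, 0))
        (𝓝 (0, q, 0)) := by
      have : Continuous fun y : ParamSpace E => ((y.1, y.2.1, 0) : ParamSpace E) := by fun_prop
      exact this.tendsto' _ _ rfl
    have k1 := ((hd q hq).trans (isBigO_fastProj_pow q (k := 3) (by omega))).comp_tendsto t1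
    have k2 := isBigO_snd_prod.trans k1
    refine ((k2.trans ?_).add (hz q hq)).congr_left fun y => ?_
    · simp [Function.comp_def, isBigO_refl]
    · simp

end NormalFormExistence

/-! ### The generating function -/

namespace HamSystem

section GeneratingFunction

set_option maxSynthPendingDepth 3

variable {E : Type*} [NormedAddCommGroup E] [NormedSpace ℝ E] (D : HamSystem E)
variable {D} {q q' : E}

theorem contDiffAt_ϑ (hq : q ∈ D.Q) : ContDiffAt ℝ ∞ D.ϑ q :=
  D.smooth_ϑ.contDiffAt (D.isOpen_Q.mem_nhds hq)

theorem contDiffAt_H (hq : q ∈ D.Q) : ContDiffAt ℝ ∞ D.H q :=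
  D.smooth_H.contDiffAt (D.isOpen_Q.mem_nhds hq)

theorem contDiffAt_J (hq : q ∈ D.Q) : ContDiffAt ℝ ∞ D.J q :=
  D.smooth_J.contDiffAt (D.isOpen_Q.mem_nhds hq)

theorem contDiffAt_omega (hq : q ∈ D.Q) : ContDiffAt ℝ ∞ D.omega q := by
  have h1 : ContDiffAt ℝ ∞ (fderiv ℝ D.ϑ) q := (contDiffAt_ϑ hq).fderiv_right (by simp)
  have h2 : ContDiffAt ℝ ∞ (fun q => (fderiv ℝ D.ϑ q).flip) q :=
    (ContinuousLinearMap.flipₗᵢ ℝ E E ℝ).contDiff.contDiffAt.comp q h1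
  exact h2.sub h1

theorem omega_swap (q v w : E) : D.omega q v w = -D.omega q w v := by
  rw [omega_apply, omega_apply]; ring

theorem omega_J_J (hq : q ∈ D.Q) (v w : E) :
    D.omega q (D.J q v) (D.J q w) = D.omega q v w := by
  rw [omega_apply, omega_apply]; exact D.J_symplectic q hq v w

variable (D) in
/-- The metric `g` as a continuous bilinear map. -/
noncomputable def metric (q : E) : E →L[ℝ] E →L[ℝ] ℝ :=
  ((ContinuousLinearMap.compL ℝ E E ℝ).flip (D.J q)).comp (D.omega q)

theorem metric_apply (q v w : E) : D.metric q v w = D.omega q v (D.J q w) := rfl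

theorem g_eq_metric (q v w : E) : D.g q v w = D.metric q v w := rfl

theorem metric_J (hq : q ∈ D.Q) (v w : E) : D.metric q (D.J q v) w = D.omega q v w :=
  omega_J_J hq v w

theorem metric_symm (hq : q ∈ D.Q) (v w : E) : D.metric q v w = D.metric q w v := by
  rw [metric_apply, metric_apply, ← omega_J_J hq v, D.J_sq q hq, map_neg, ← omega_swap]

theorem metric_pos (hq : q ∈ D.Q) {v : E} (hv : v ≠ 0) : 0 < D.metric q v v := by
  rw [metric_apply, omega_apply]; exact D.J_pos q hq v hv

theorem contDiffAt_metric (hq : q ∈ D.Q) : ContDiffAt ℝ ∞ D.metric q := by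
  have h1 : ContDiffAt ℝ ∞ (fun q => (ContinuousLinearMap.compL ℝ E E ℝ).flip (D.J q)) q :=
    (ContinuousLinearMap.contDiff _).contDiffAt.comp q (contDiffAt_J hq)
  exact h1.clm_comp (contDiffAt_omega hq)

section Complete

variable [FiniteDimensional ℝ E]

theorem contDiffAt_omega_inverse (hq : q ∈ D.Q) :
    ContDiffAt ℝ ∞ (fun q => (D.omega q).inverse) q := by
  have := FiniteDimensional.complete ℝ E
  obtain ⟨e, he⟩ := D.omega_isInvertible hq
  refine ContDiffAt.comp (g := ContinuousLinearMap.inverse) q ?_ (contDiffAt_omega hq)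
  rw [← he]
  exact contDiffAt_map_inverse e

theorem contDiffAt_XH (hq : q ∈ D.Q) : ContDiffAt ℝ ∞ D.XH q :=
  (contDiffAt_omega_inverse hq).clm_apply ((contDiffAt_H hq).fderiv_right (by simp))

/-- g(v, ·) = ω(−J v, ·), a composition of two isomorphisms. -/
theorem metric_isInvertible (hq : q ∈ D.Q) : (D.metric q).IsInvertible := by
  obtain ⟨e, he⟩ := D.omega_isInvertible hq
  refine ⟨(ContinuousLinearEquiv.equivOfInverse (-D.J q) (D.J q) (fun v => ?_) fun v => ?_).trans e,
    ?_⟩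
  · simp [D.J_sq q hq]
  · simp [D.J_sq q hq]
  · ext v w
    have : (e : E →L[ℝ] E →L[ℝ] ℝ) (-(D.J q v)) w = D.metric q v w := by
      rw [he, map_neg, neg_apply, ← metric_J hq, D.J_sq q hq, map_neg, neg_apply, neg_neg]
    exact this

theorem contDiffAt_metric_inverse (hq : q ∈ D.Q) :
    ContDiffAt ℝ ∞ (fun q => (D.metric q).inverse) q := by
  have := FiniteDimensional.complete ℝ E
  obtain ⟨e, he⟩ := D.metric_isInvertible hq
  refine ContDiffAt.comp (g := ContinuousLinearMap.inverse) q ?_ (contDiffAt_metric hq)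
  rw [← he]
  exact contDiffAt_map_inverse e

theorem metric_inverse_apply (hq : q ∈ D.Q) (v : E) :
    (D.metric q).inverse (D.metric q v) = v := by
  obtain ⟨e, he⟩ := D.metric_isInvertible hq
  rw [← he, ContinuousLinearMap.inverse_equiv]; simp

theorem metric_apply_inverse (hq : q ∈ D.Q) (l : E →L[ℝ] ℝ) :
    D.metric q ((D.metric q).inverse l) = l := by
  obtain ⟨e, he⟩ := D.metric_isInvertible hq
  rw [← he, ContinuousLinearMap.inverse_equiv]
  exact e.apply_symm_apply l

end Complete

variable (D) in
/-- The covector that is multiplied by `ħ² ξ` in `Sig`. -/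
noncomputable def sigCovector (x : E) : E →L[ℝ] ℝ :=
  D.metric x (D.XH x) - (1 / 12 : ℝ) • fderiv ℝ D.omega x (D.XH x) (D.XH x)

variable (D) in
/-- The deviation of `ξ` from `ħ X_H`, at the midpoint `x` of `q` and `q + ξ`. -/
noncomputable def deviation (y : ParamSpace E) : E :=
  y.2.2 - y.1 • D.XH (y.2.1 + (1 / 2 : ℝ) • y.2.2)

variable (D) in
/-- The covector `-∂_q S - ϑ_q - ħ² g_q(X_H, ·)` at the points `q` and `q + ξ`. -/
noncomputable def momentumCovector (θ : ℝ) (y : ParamSpace E) : E →L[ℝ] ℝ :=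
  -((∫ t in (0 : ℝ)..1, (1 - t) • D.omega (y.2.1 + t • y.2.2)) y.2.2)
    + (y.1 / 2) • D.omega (y.2.1 + (1 / 2 : ℝ) • y.2.2) (D.XH (y.2.1 + (1 / 2 : ℝ) • y.2.2))
    - (y.1 ^ 2 / 2) • (fderiv ℝ D.sigCovector (y.2.1 + (1 / 2 : ℝ) • y.2.2)).flip y.2.2
    + y.1 ^ 2 • D.sigCovector (y.2.1 + (1 / 2 : ℝ) • y.2.2)
    - y.1 ^ 2 • D.metric y.2.1 (D.XH y.2.1)
    + (Real.sin θ / (1 - Real.cos θ)) • (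
      (1 / 8 : ℝ) • ((fderiv ℝ D.metric (y.2.1 + (1 / 2 : ℝ) • y.2.2)).flip
        (D.deviation y)).flip (D.deviation y)
      - (1 / 2 : ℝ) • D.metric (y.2.1 + (1 / 2 : ℝ) • y.2.2) (D.deviation y)
      - (y.1 / 4) • (D.metric (y.2.1 + (1 / 2 : ℝ) • y.2.2) (D.deviation y)).comp
        (fderiv ℝ D.XH (y.2.1 + (1 / 2 : ℝ) • y.2.2)))

theorem Sig_eq (θ h : ℝ) (x ξ : E) : D.Sig θ h x ξ = -h * D.H x + h ^ 2 * D.sigCovector x ξ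
    - (1 / 4) * (Real.sin θ / (1 - Real.cos θ)) *
      D.metric x (ξ - h • D.XH x) (ξ - h • D.XH x) := by
  simp only [Sig, sigCovector, g_eq_metric, _root_.sub_apply, _root_.smul_apply, smul_eq_mul]
  ring

theorem Sig_neg (θ h : ℝ) (x ξ : E) : D.Sig (-θ) (-h) x (-ξ) = -D.Sig θ h x ξ := by
  have : -ξ - -h • D.XH x = -(ξ - h • D.XH x) := by module
  simp only [Sig_eq, this, map_neg, neg_apply, Real.sin_neg, Real.cos_neg]
  ring

/-- Reversal symmetry: the midpoint is unchanged, ξ and X_H-terms change sign together, and sin θ /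
(1 − cos θ) is odd. It reduces derivatives in the second endpoint to derivatives in the first. -/
theorem S_neg (θ h : ℝ) (q q' : E) : D.S (-θ) (-h) q' q = -D.S θ h q q' := by
  have h1 : q - q' = -(q' - q) := by abel
  have h2 : (1 / 2 : ℝ) • q' + (1 / 2 : ℝ) • q = (1 / 2 : ℝ) • q + (1 / 2 : ℝ) • q' :=
    add_comm _ _
  have h3 := intervalIntegral.integral_comp_sub_left (a := 0) (b := 1)
    (fun t : ℝ => D.ϑ (q + t • (q' - q)) (q' - q)) 1
  simp only [sub_zero, sub_self] at h3
  rw [S, S, h1, h2, Sig_neg, neg_add, ← h3, ← intervalIntegral.integral_neg]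
  congr 1
  refine intervalIntegral.integral_congr fun t _ => ?_
  simp only [map_neg]
  congr 3
  module

theorem contDiffAt_sigCovector [FiniteDimensional ℝ E] (hq : q ∈ D.Q) : ContDiffAt ℝ ∞ D.sigCovector q := by
  have h1 : ContDiffAt ℝ ∞ (fderiv ℝ D.omega) q := (contDiffAt_omega hq).fderiv_right (by simp)
  exact ((contDiffAt_metric hq).clm_apply (contDiffAt_XH hq)).sub
    (((h1.clm_apply (contDiffAt_XH hq)).clm_apply (contDiffAt_XH hq)).const_smul (1 / 12 : ℝ))

theorem midpoint_mem (h : segment ℝ q q' ⊆ D.Q) : q + (1 / 2 : ℝ) • (q' - q) ∈ D.Q :=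
  h (by rw [segment_eq_image']; exact ⟨1 / 2, by norm_num, rfl⟩)

theorem add_smul_mem (h : segment ℝ q q' ⊆ D.Q) {t : ℝ} (ht : t ∈ Icc (0 : ℝ) 1) :
    q + t • (q' - q) ∈ D.Q :=
  h (by rw [segment_eq_image']; exact ⟨t, ht, rfl⟩)

theorem integral_one_sub_mul_deriv {f f' : ℝ → ℝ}
    (h : ∀ t ∈ Icc (0 : ℝ) 1, HasDerivAt f (f' t) t)
    (hi : IntervalIntegrable (fun t => (1 - t) * f' t - f t) MeasureTheory.volume 0 1) :
    ∫ t in (0 : ℝ)..1, ((1 - t) * f' t - f t) = -f 0 := by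
  rw [intervalIntegral.integral_eq_sub_of_hasDerivAt (f := fun t : ℝ => (1 - t) * f t) _ hi]
  · simp
  · intro t ht
    rw [uIcc_of_le zero_le_one] at ht
    refine (((hasDerivAt_id t).const_sub 1).mul (h t ht)).congr_deriv ?_
    simp only [id]
    ring

/-- Differentiation under the integral yields (1 − t) Dϑ[w](ξ) − ϑ(w). Writing Dϑ[w](ξ) = Dϑ[ξ](w) +
ω(ξ, w), the first part together with −ϑ(w) is the derivative of (1 − t) ϑ(w) along the segment and
leaves only −ϑ_q(w). -/
theorem hasFDerivAt_lineIntegral (h : segment ℝ q q' ⊆ D.Q) :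
    HasFDerivAt (fun z => ∫ t in (0 : ℝ)..1, D.ϑ (z + t • (q' - z)) (q' - z))
      (-D.ϑ q + (∫ t in (0 : ℝ)..1, (1 - t) • D.omega (q + t • (q' - q))) (q' - q)) q := by
  set ξ := q' - q with hξ
  set f : E × ℝ → ℝ := fun y => D.ϑ (y.1 + y.2 • (q' - y.1)) (q' - y.1) with hf
  have hmem : ∀ t ∈ Icc (0 : ℝ) 1, q + t • ξ ∈ D.Q := fun t ht => add_smul_mem h ht
  have hfs : ∀ t ∈ Icc (0 : ℝ) 1, ContDiffAt ℝ ∞ f (q, t) := fun t ht => by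
    refine ContDiffAt.clm_apply (ContDiffAt.comp (g := D.ϑ)
      (f := fun y : E × ℝ => y.1 + y.2 • (q' - y.1)) (q, t) (contDiffAt_ϑ (hmem t ht)) ?_) ?_
    · fun_prop
    · fun_prop
  have hline : ∀ t : ℝ, HasDerivAt (fun t : ℝ => q + t • ξ) ξ t := fun t => by
    simpa using ((hasDerivAt_id t).smul_const ξ).const_add q
  have hcl : ∀ {V : Type _} [TopologicalSpace V] {F : E → V},
      (∀ x ∈ D.Q, ContinuousAt F x) → ContinuousOn (fun t : ℝ => F (q + t • ξ)) (Icc 0 1) :=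
    fun hF t ht => ((hF _ (hmem t ht)).comp (f := fun t : ℝ => q + t • ξ)
      (by fun_prop)).continuousWithinAt
  have hfd : ∀ t ∈ Icc (0 : ℝ) 1, ∀ w, fderiv ℝ f (q, t) (w, 0) =
      (1 - t) * fderiv ℝ D.ϑ (q + t • ξ) w ξ - D.ϑ (q + t • ξ) w := by
    intro t ht w
    have hfst : HasFDerivAt (fun y : E × ℝ => y.1) (ContinuousLinearMap.fst ℝ E ℝ) (q, t) :=
      hasFDerivAt_fst
    have e1 : HasFDerivAt (fun y : E × ℝ => y.1 + y.2 • (q' - y.1)) _ (q, t) :=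
      hfst.add (hasFDerivAt_snd.smul (hfst.const_sub q'))
    have e2 : HasFDerivAt D.ϑ (fderiv ℝ D.ϑ (q + t • ξ)) (q + t • (q' - q)) :=
      ((contDiffAt_ϑ (hmem t ht)).differentiableAt (by simp)).hasFDerivAt
    have e3 := (HasFDerivAt.comp (g := D.ϑ) (f := fun y : E × ℝ => y.1 + y.2 • (q' - y.1))
      (q, t) e2 e1).clm_apply (hfst.const_sub q')
    have e4 : HasFDerivAt f _ (q, t) := e3
    rw [e4.fderiv]
    simp [← hξ]
    ring
  have h1 := hasFDerivAt_integral_param fun t ht => (hfs t ht).of_le (by simp)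
  refine h1.congr_fderiv (ContinuousLinearMap.ext fun w => ?_)
  have i1 : IntervalIntegrable (fun t => (fderiv ℝ f (q, t)).comp
      (ContinuousLinearMap.inl ℝ E ℝ)) MeasureTheory.volume 0 1 := by
    refine ContinuousOn.intervalIntegrable_of_Icc zero_le_one fun t ht => ?_
    have := ((hfs t ht).fderiv_right (m := 0) (by simp)).continuousAt
    exact ((ContinuousAt.comp (g := fderiv ℝ f) (f := fun t : ℝ => (q, t)) this
      (by fun_prop)).clm_comp continuousAt_const).continuousWithinAt
  have cω : ContinuousOn (fun t : ℝ => (1 - t) • D.omega (q + t • ξ)) (Icc 0 1) :=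
    ContinuousOn.smul (continuous_const.sub continuous_id).continuousOn (hcl fun x hx => (contDiffAt_omega hx).continuousAt)
  have i2 : IntervalIntegrable (fun t : ℝ => (1 - t) • D.omega (q + t • ξ))
      MeasureTheory.volume 0 1 := cω.intervalIntegrable_of_Icc zero_le_one
  have i3 : IntervalIntegrable (fun t : ℝ => (1 - t) • D.omega (q + t • ξ) ξ)
      MeasureTheory.volume 0 1 :=
    (cω.clm_apply continuousOn_const).intervalIntegrable_of_Icc zero_le_one
  have c4 : ContinuousOn (fun t : ℝ => (1 - t) * fderiv ℝ D.ϑ (q + t • ξ) ξ w -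
      D.ϑ (q + t • ξ) w) (Icc 0 1) := by
    refine ContinuousOn.sub (ContinuousOn.mul (by fun_prop) (((hcl fun x hx =>
      ((contDiffAt_ϑ hx).fderiv_right (m := 0) (by simp)).continuousAt).clm_apply
      continuousOn_const).clm_apply continuousOn_const)) ?_
    exact (hcl fun x hx => (contDiffAt_ϑ hx).continuousAt).clm_apply continuousOn_const
  have c5 : ContinuousOn (fun t : ℝ => ((1 - t) • D.omega (q + t • ξ) ξ) w) (Icc 0 1) :=
    (cω.clm_apply continuousOn_const).clm_apply continuousOn_const
  have hderiv : ∀ t ∈ Icc (0 : ℝ) 1, HasDerivAt (fun t : ℝ => D.ϑ (q + t • ξ) w)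
      (fderiv ℝ D.ϑ (q + t • ξ) ξ w) t := by
    intro t ht
    have e2 : HasFDerivAt D.ϑ (fderiv ℝ D.ϑ (q + t • ξ)) (q + t • ξ) :=
      ((contDiffAt_ϑ (hmem t ht)).differentiableAt (by simp)).hasFDerivAt
    exact ((ContinuousLinearMap.apply ℝ ℝ w).hasFDerivAt).comp_hasDerivAt t
      (e2.comp_hasDerivAt t (hline t))
  have h2 : ∫ t in (0 : ℝ)..1, ((1 - t) * fderiv ℝ D.ϑ (q + t • ξ) ξ w - D.ϑ (q + t • ξ) w) =
      -D.ϑ q w := by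
    rw [integral_one_sub_mul_deriv hderiv (c4.intervalIntegrable_of_Icc zero_le_one), zero_smul,
      add_zero]
  rw [ContinuousLinearMap.intervalIntegral_apply i1, add_apply, neg_apply, ← h2,
    ContinuousLinearMap.intervalIntegral_apply i2]
  simp only [smul_apply]
  rw [ContinuousLinearMap.intervalIntegral_apply i3, ← intervalIntegral.integral_add
    (c4.intervalIntegrable_of_Icc zero_le_one) (c5.intervalIntegrable_of_Icc zero_le_one)]
  refine intervalIntegral.integral_congr fun t ht => ?_
  rw [uIcc_of_le zero_le_one] at ht
  simp only [ContinuousLinearMap.comp_apply, ContinuousLinearMap.inl_apply, hfd t ht, omega_apply,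
    smul_apply, smul_eq_mul]
  ring

theorem hasFDerivAt_comp_midpoint {V : Type*} [NormedAddCommGroup V] [NormedSpace ℝ V] {f : E → V}
    (hf : ContDiffAt ℝ ∞ f (q + (1 / 2 : ℝ) • (q' - q))) :
    HasFDerivAt (fun z : E => f ((1 / 2 : ℝ) • z + (1 / 2 : ℝ) • q'))
      ((fderiv ℝ f (q + (1 / 2 : ℝ) • (q' - q))).comp
        ((1 / 2 : ℝ) • ContinuousLinearMap.id ℝ E)) q := by
  have hmid : (1 / 2 : ℝ) • q + (1 / 2 : ℝ) • q' = q + (1 / 2 : ℝ) • (q' - q) := by module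
  have m1 : HasFDerivAt (fun z : E => (1 / 2 : ℝ) • z + (1 / 2 : ℝ) • q')
      ((1 / 2 : ℝ) • ContinuousLinearMap.id ℝ E) q :=
    ((hasFDerivAt_id q).const_smul (1 / 2 : ℝ)).add_const _
  have hf' : HasFDerivAt f (fderiv ℝ f (q + (1 / 2 : ℝ) • (q' - q)))
      ((1 / 2 : ℝ) • q + (1 / 2 : ℝ) • q') := by
    rw [hmid]; exact (hf.differentiableAt (by simp)).hasFDerivAt
  exact HasFDerivAt.comp (g := f) q hf' m1

theorem hasFDerivAt_S [FiniteDimensional ℝ E] (θ ħ : ℝ) (h : segment ℝ q q' ⊆ D.Q) :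
    HasFDerivAt (fun z => D.S θ ħ z q') (-D.ϑ q - ħ ^ 2 • D.metric q (D.XH q)
      - D.momentumCovector θ (ħ, q, q' - q)) q := by
  have hx := midpoint_mem h
  have hmid : (1 / 2 : ℝ) • q + (1 / 2 : ℝ) • q' = q + (1 / 2 : ℝ) • (q' - q) := by module
  set x := q + (1 / 2 : ℝ) • (q' - q) with hxdef
  have m2 : HasFDerivAt (fun z : E => q' - z) (-ContinuousLinearMap.id ℝ E) q :=
    (hasFDerivAt_id q).const_sub q'
  have dH := hasFDerivAt_comp_midpoint (contDiffAt_H hx)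
  have dβ := hasFDerivAt_comp_midpoint (contDiffAt_sigCovector hx)
  have dG := hasFDerivAt_comp_midpoint (contDiffAt_metric hx)
  have dX := hasFDerivAt_comp_midpoint (contDiffAt_XH hx)
  have dκ := m2.sub (dX.const_smul ħ)
  have dS := (hasFDerivAt_lineIntegral h).add (((dH.const_mul (-ħ)).add
    ((dβ.clm_apply m2).const_mul (ħ ^ 2))).sub (((dG.clm_apply dκ).clm_apply dκ).const_mul
      ((1 / 4) * (Real.sin θ / (1 - Real.cos θ)))))
  have hS : (fun z => D.S θ ħ z q') = _ := funext fun z => by rw [S, Sig_eq]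
  rw [hS]
  refine dS.congr_fderiv ?_
  ext w
  -- Hamilton's equation turns the contribution −(ħ/2) dH into −(ħ/2) ω(X_H, ·).
  have hω := D.omega_XH hx
  have hs := metric_symm (D := D) hx
  have hκ : D.deviation (ħ, q, q' - q) = q' - q - ħ • D.XH x := rfl
  simp only [momentumCovector, hκ, ← hxdef, hmid, Pi.sub_apply, Pi.smul_apply]
  simp [hω, hs]
  ring

end GeneratingFunction

end HamSystem

/-! ### The implicit relations in terms of rescaled momenta -/

namespace HamSystem

section Momentum

set_option maxSynthPendingDepth 3

variable {E : Type*} [NormedAddCommGroup E] [NormedSpace ℝ E]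
  {D : HamSystem E} {q q' : E}

theorem contDiffAt_midpoint {V : Type*} [NormedAddCommGroup V] [NormedSpace ℝ V] {f : E → V}
    {y : ParamSpace E} (hf : ContDiffAt ℝ ∞ f (y.2.1 + (1 / 2 : ℝ) • y.2.2)) :
    ContDiffAt ℝ ∞ (fun y : ParamSpace E => f (y.2.1 + (1 / 2 : ℝ) • y.2.2)) y :=
  ContDiffAt.comp (g := f) y hf (by fun_prop)

variable [FiniteDimensional ℝ E]

theorem contDiffAt_momentumCovector (θ : ℝ) {y : ParamSpace E}
    (h : segment ℝ y.2.1 (y.2.1 + y.2.2) ⊆ D.Q) :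
    ContDiffAt ℝ ∞ (D.momentumCovector θ) y := by
  have hm : ∀ t ∈ Icc (0 : ℝ) 1, y.2.1 + t • y.2.2 ∈ D.Q := fun t ht => by
    simpa using add_smul_mem h ht
  have hx := hm (1 / 2) (by norm_num)
  have hq : y.2.1 ∈ D.Q := by simpa using hm 0 (by norm_num)
  have c1 := contDiffAt_midpoint (contDiffAt_omega hx)
  have c2 := contDiffAt_midpoint (contDiffAt_XH hx)
  have c3 := contDiffAt_midpoint ((contDiffAt_sigCovector hx).fderiv_right (m := ∞) (by simp))
  have c4 := contDiffAt_midpoint (contDiffAt_sigCovector hx)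
  have c5 := contDiffAt_midpoint (contDiffAt_metric hx)
  have c6 := contDiffAt_midpoint ((contDiffAt_metric hx).fderiv_right (m := ∞) (by simp))
  have c7 := contDiffAt_midpoint ((contDiffAt_XH hx).fderiv_right (m := ∞) (by simp))
  have d0 : ContDiffAt ℝ ∞ (fun y : ParamSpace E => y.1) y := contDiffAt_fst
  have d1 : ContDiffAt ℝ ∞ (fun y : ParamSpace E => y.2.1) y := contDiffAt_snd.fst
  have d2 : ContDiffAt ℝ ∞ (fun y : ParamSpace E => y.2.2) y := contDiffAt_snd.snd
  have c8 : ContDiffAt ℝ ∞ D.deviation y := d2.sub (d0.smul c2)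
  have c9 : ContDiffAt ℝ ∞ (fun y : ParamSpace E => D.metric y.2.1 (D.XH y.2.1)) y :=
    (ContDiffAt.comp (g := D.metric) y (contDiffAt_metric hq) d1).clm_apply
      (ContDiffAt.comp (g := D.XH) y (contDiffAt_XH hq) d1)
  have c10 : ContDiffAt ℝ ∞ (fun y : ParamSpace E =>
      ∫ t in (0 : ℝ)..1, (1 - t) • D.omega (y.2.1 + t • y.2.2)) y := by
    refine contDiffAt_integral_param
      (f := fun p : ParamSpace E × ℝ => (1 - p.2) • D.omega (p.1.2.1 + p.2 • p.1.2.2))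
      fun t ht => ?_
    refine ContDiffAt.smul (contDiffAt_const.sub contDiffAt_snd) (ContDiffAt.comp (g := D.omega)
      (f := fun p : ParamSpace E × ℝ => p.1.2.1 + p.2 • p.1.2.2) (y, t)
      (contDiffAt_omega (hm t ht)) (by fun_prop))
  have flip1 : ContDiffAt ℝ ∞ (fun y : ParamSpace E =>
      (fderiv ℝ D.sigCovector (y.2.1 + (1 / 2 : ℝ) • y.2.2)).flip) y :=
    (ContinuousLinearMap.flipₗᵢ ℝ E E ℝ).contDiff.contDiffAt.comp y c3
  have flip2 : ContDiffAt ℝ ∞ (fun y : ParamSpace E =>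
      (fderiv ℝ D.metric (y.2.1 + (1 / 2 : ℝ) • y.2.2)).flip) y :=
    (ContinuousLinearMap.flipₗᵢ ℝ E E (E →L[ℝ] ℝ)).contDiff.contDiffAt.comp y c6
  have flip3 : ContDiffAt ℝ ∞ (fun y : ParamSpace E =>
      ((fderiv ℝ D.metric (y.2.1 + (1 / 2 : ℝ) • y.2.2)).flip (D.deviation y)).flip) y :=
    (ContinuousLinearMap.flipₗᵢ ℝ E E ℝ).contDiff.contDiffAt.comp y (flip2.clm_apply c8)
  exact (((((c10.clm_apply d2).neg.add ((d0.div_const 2).smul (c1.clm_apply c2))).sub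
    (((d0.pow 2).div_const 2).smul (flip1.clm_apply d2))).add ((d0.pow 2).smul c4)).sub
    ((d0.pow 2).smul c9)).add ((((flip3.clm_apply c8).const_smul (1 / 8 : ℝ)).sub
      ((c5.clm_apply c8).const_smul (1 / 2 : ℝ))).sub ((d0.div_const 4).smul
        ((c5.clm_apply c8).clm_comp c7)) |>.const_smul (Real.sin θ / (1 - Real.cos θ)))

variable (D) in
/-- The rescaled momentum `ħ² (v - X_H(q))` of the point `q` that is mapped to `q + ξ`. -/
noncomputable def momentum (θ : ℝ) (y : ParamSpace E) : E :=
  (D.metric y.2.1).inverse (D.momentumCovector θ y)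

theorem contDiffAt_momentum (θ : ℝ) {y : ParamSpace E}
    (h : segment ℝ y.2.1 (y.2.1 + y.2.2) ⊆ D.Q) : ContDiffAt ℝ ∞ (D.momentum θ) y :=
  (ContDiffAt.comp (g := fun q => (D.metric q).inverse) y
    (contDiffAt_metric_inverse (h (left_mem_segment ℝ _ _))) contDiffAt_snd.fst).clm_apply
    (contDiffAt_momentumCovector θ h)

theorem metric_injective (hq : q ∈ D.Q) {u v : E} (h : ∀ w, D.metric q u w = D.metric q v w) :
    u = v := by
  rw [← metric_inverse_apply hq u, ← metric_inverse_apply hq v]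
  congr 1
  ext w
  exact h w

/-- The differential of the generating function in terms of the rescaled momenta. -/
theorem hasFDerivAt_S_fst (θ ħ : ℝ) (h : segment ℝ q q' ⊆ D.Q) :
    HasFDerivAt (fun z => D.S θ ħ z q') (-D.ϑ q - D.metric q (ħ ^ 2 • D.XH q
      + D.momentum θ (ħ, q, q' - q))) q := by
  refine (hasFDerivAt_S θ ħ h).congr_fderiv ?_
  rw [map_add, momentum, metric_apply_inverse (h (left_mem_segment ℝ _ _)), map_smul]
  abel

theorem hasFDerivAt_S_snd (θ ħ : ℝ) (h : segment ℝ q q' ⊆ D.Q) :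
    HasFDerivAt (fun z => D.S θ ħ q z) (D.ϑ q' + D.metric q' (ħ ^ 2 • D.XH q'
      + D.momentum (-θ) (-ħ, q', q - q'))) q' := by
  have h1 := (hasFDerivAt_S_fst (-θ) (-ħ) (by rwa [segment_symm] : segment ℝ q' q ⊆ D.Q)).neg
  simp only [Pi.neg_def, S_neg, neg_neg, even_two.neg_pow] at h1
  refine h1.congr_fderiv ?_
  abel

/-- The ϑ-terms cancel and g is nondegenerate, so each relation determines one of the rescaled
momenta from the pair of endpoints. The second is the first for the reversed data. -/
theorem lorentzRel_iff {θ ħ : ℝ} {z z' : E × E} : D.LorentzRel θ ħ z z' ↔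
    segment ℝ z.1 z'.1 ⊆ D.Q ∧
    D.momentum θ (ħ, z.1, z'.1 - z.1) = ħ ^ 2 • (z.2 - D.XH z.1) ∧
    D.momentum (-θ) (-ħ, z'.1, z.1 - z'.1) = ħ ^ 2 • (z'.2 - D.XH z'.1) := by
  refine and_congr_right fun h => ?_
  have hz := h (left_mem_segment ℝ _ _)
  have hz' := h (right_mem_segment ℝ _ _)
  rw [(hasFDerivAt_S_fst θ ħ h).fderiv, (hasFDerivAt_S_snd θ ħ h).fderiv, and_comm]
  refine and_congr ⟨fun H => metric_injective hz fun w => ?_, fun H w => ?_⟩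
    ⟨fun H => metric_injective hz' fun w => ?_, fun H w => ?_⟩
  · have := H w
    simp only [map_add, map_smul, map_sub, add_apply, sub_apply, neg_apply, smul_apply,
      smul_eq_mul, g_eq_metric] at this ⊢
    linarith
  · rw [H]
    simp only [map_add, map_smul, map_sub, add_apply, sub_apply, neg_apply, smul_apply,
      smul_eq_mul, g_eq_metric]
    ring
  · have := H w
    simp only [map_add, map_smul, map_sub, add_apply, sub_apply, smul_apply,
      smul_eq_mul, g_eq_metric] at this ⊢
    linarith
  · rw [H]
    simp only [map_add, map_smul, map_sub, add_apply, sub_apply, smul_apply,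
      smul_eq_mul, g_eq_metric]
    ring

theorem differentiableAt_S (θ ħ : ℝ) (h : segment ℝ q q' ⊆ D.Q) :
    DifferentiableAt ℝ (fun z : E × E => D.S θ ħ z.1 z.2) (q, q') := by
  have hmid : (1 / 2 : ℝ) • q + (1 / 2 : ℝ) • q' = q + (1 / 2 : ℝ) • (q' - q) := by module
  have hx := midpoint_mem h
  rw [← hmid] at hx
  have c1 : ∀ {V : Type _} [NormedAddCommGroup V] [NormedSpace ℝ V] {f : E → V},
      ContDiffAt ℝ ∞ f ((1 / 2 : ℝ) • q + (1 / 2 : ℝ) • q') → DifferentiableAt ℝ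
        (fun z : E × E => f ((1 / 2 : ℝ) • z.1 + (1 / 2 : ℝ) • z.2)) (q, q') := by
    intro V _ _ f hf
    exact DifferentiableAt.comp (g := f)
      (f := fun z : E × E => (1 / 2 : ℝ) • z.1 + (1 / 2 : ℝ) • z.2) (q, q')
      (hf.differentiableAt (by simp)) (by fun_prop)
  have d1 : DifferentiableAt ℝ
      (fun z : E × E => D.H ((1 / 2 : ℝ) • z.1 + (1 / 2 : ℝ) • z.2)) (q, q') :=
    DifferentiableAt.comp (g := D.H)
      (f := fun z : E × E => (1 / 2 : ℝ) • z.1 + (1 / 2 : ℝ) • z.2) (q, q')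
      ((contDiffAt_H hx).differentiableAt (by simp)) (by fun_prop)
  have d2 := c1 (contDiffAt_sigCovector hx)
  have d3 := c1 (contDiffAt_metric hx)
  have d4 := c1 (contDiffAt_XH hx)
  have d5 : DifferentiableAt ℝ (fun z : E × E => z.2 - z.1) (q, q') := by fun_prop
  have d6 := d5.sub (d4.const_smul ħ)
  have d7 : DifferentiableAt ℝ (fun z : E × E =>
      ∫ t in (0 : ℝ)..1, D.ϑ (z.1 + t • (z.2 - z.1)) (z.2 - z.1)) (q, q') := by
    refine (hasFDerivAt_integral_param (f := fun p : (E × E) × ℝ =>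
      D.ϑ (p.1.1 + p.2 • (p.1.2 - p.1.1)) (p.1.2 - p.1.1)) fun t ht => ?_).differentiableAt
    refine ContDiffAt.clm_apply (ContDiffAt.comp (g := D.ϑ)
      (f := fun p : (E × E) × ℝ => p.1.1 + p.2 • (p.1.2 - p.1.1)) ((q, q'), t)
      ((contDiffAt_ϑ (add_smul_mem h ht)).of_le (by simp)) ?_) ?_
    · fun_prop
    · fun_prop
  have hS : (fun z : E × E => D.S θ ħ z.1 z.2) = _ := funext fun z => by rw [S, Sig_eq]
  rw [hS]
  exact d7.add (((d1.const_mul (-ħ)).add ((d2.clm_apply d5).const_mul (ħ ^ 2))).sub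
    (((d3.clm_apply d6).clm_apply d6).const_mul _))

/-- dS is the difference of the Liouville forms at the image and at the initial point, which is
exact symplecticity. Partial derivatives alone would not suffice, hence the separate proof of joint
differentiability. -/
theorem hasFDerivAt_S_pair (θ ħ : ℝ) (h : segment ℝ q q' ⊆ D.Q) :
    HasFDerivAt (fun z : E × E => D.S θ ħ z.1 z.2)
      ((-D.ϑ q - D.metric q (ħ ^ 2 • D.XH q + D.momentum θ (ħ, q, q' - q))).coprod
        (D.ϑ q' + D.metric q' (ħ ^ 2 • D.XH q' + D.momentum (-θ) (-ħ, q', q - q')))) (q, q') := by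
  have hd := (differentiableAt_S θ ħ h).hasFDerivAt
  have h1 := (hasFDerivAt_S_fst θ ħ h).unique
    (HasFDerivAt.comp (g := fun z : E × E => D.S θ ħ z.1 z.2) (f := fun z => (z, q')) q hd
      ((hasFDerivAt_id q).prodMk (hasFDerivAt_const q' q)))
  have h2 := (hasFDerivAt_S_snd θ ħ h).unique
    (HasFDerivAt.comp (g := fun z : E × E => D.S θ ħ z.1 z.2) (f := fun z => (q, z)) q' hd
      ((hasFDerivAt_const q q').prodMk (hasFDerivAt_id q')))
  refine hd.congr_fderiv ?_
  rw [h1, h2]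
  ext w <;> simp

end Momentum

end HamSystem

/-! ### Expansion of the momentum in the deviation -/

theorem isBigO_clm_apply {Y V W : Type*} [NormedAddCommGroup V] [NormedSpace ℝ V]
    [NormedAddCommGroup W] [NormedSpace ℝ W] {l : Filter Y} {f : Y → V →L[ℝ] W} {u : Y → V}
    {a b : Y → ℝ} (hf : f =O[l] a) (hu : u =O[l] b) :
    (fun y => f y (u y)) =O[l] fun y => a y * b y := by
  refine IsBigO.trans (IsBigO.of_bound 1 (Eventually.of_forall fun y => ?_))
    (hf.norm_left.mul hu.norm_left)
  rw [one_mul, norm_mul, norm_norm, norm_norm]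
  exact ContinuousLinearMap.le_opNorm _ _

namespace HamSystem

section MomentumExpansion

set_option maxSynthPendingDepth 3

variable {E : Type*} [NormedAddCommGroup E] [NormedSpace ℝ E] {D : HamSystem E} {q q' : E}

theorem eventually_segment_mem (hq : q ∈ D.Q) :
    ∀ᶠ y : ParamSpace E in 𝓝 (0, q, 0), ∀ t ∈ Icc (0 : ℝ) 1, y.2.1 + t • y.2.2 ∈ D.Q := by
  refine eventually_forall_Icc_of_forall_Icc
    (p := fun p : ParamSpace E × ℝ => p.1.2.1 + p.2 • p.1.2.2 ∈ D.Q) fun t _ => ?_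
  have : Continuous fun p : ParamSpace E × ℝ => p.1.2.1 + p.2 • p.1.2.2 := by fun_prop
  exact this.continuousAt.eventually_mem (D.isOpen_Q.mem_nhds (by simpa using hq))

theorem segment_subset_of_forall {ξ : E} (h : ∀ t ∈ Icc (0 : ℝ) 1, q + t • ξ ∈ D.Q) :
    segment ℝ q (q + ξ) ⊆ D.Q := by
  rw [segment_eq_image']
  rintro _ ⟨t, ht, rfl⟩
  simpa using h t ht

/-- The moments ∫(1 − t) = 1/2 and ∫(1 − t)(t − 1/2) = −1/12; the second explains the coefficient
1/12 in Σ. -/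
theorem integral_one_sub_smul_affine {V : Type*} [NormedAddCommGroup V] [NormedSpace ℝ V]
    [CompleteSpace V] (a b : V) :
    ∫ t in (0 : ℝ)..1, (1 - t) • (a + (t - 1 / 2) • b) = (1 / 2 : ℝ) • a - (1 / 12 : ℝ) • b := by
  rw [intervalIntegral.integral_eq_sub_of_hasDerivAt
    (f := fun t : ℝ => (t - t ^ 2 / 2) • a + (-(t ^ 3) / 3 + 3 / 4 * t ^ 2 - t / 2) • b)]
  · norm_num
    rw [← sub_eq_zero]
    module
  · intro t _
    have e1 : HasDerivAt (fun t : ℝ => t - t ^ 2 / 2) (1 - t) t := by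
      refine ((hasDerivAt_id t).sub ((hasDerivAt_pow 2 t).div_const 2)).congr_deriv ?_
      simp
    have e2 : HasDerivAt (fun t : ℝ => -(t ^ 3) / 3 + 3 / 4 * t ^ 2 - t / 2)
        ((1 - t) * (t - 1 / 2)) t := by
      refine ((((hasDerivAt_pow 3 t).neg.div_const 3).add
        ((hasDerivAt_pow 2 t).const_mul (3 / 4))).sub ((hasDerivAt_id t).div_const 2)).congr_deriv ?_
      simp
      ring
    refine ((e1.smul_const a).add (e2.smul_const b)).congr_deriv ?_
    module
  · apply Continuous.intervalIntegrable
    fun_prop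

variable [FiniteDimensional ℝ E]

theorem isBigO_integral_omega (hq : q ∈ D.Q) :
    (fun y : ParamSpace E => (∫ t in (0 : ℝ)..1, (1 - t) • D.omega (y.2.1 + t • y.2.2)) -
      ((1 / 2 : ℝ) • D.omega (y.2.1 + (1 / 2 : ℝ) • y.2.2) -
        (1 / 12 : ℝ) • fderiv ℝ D.omega (y.2.1 + (1 / 2 : ℝ) • y.2.2) y.2.2))
      =O[𝓝 (0, q, 0)] fun y => ‖y.2.2‖ ^ 2 := by
  obtain ⟨C, hC⟩ := ((contDiffAt_omega hq).isBigO_sub_sub_fderiv two_le_infty).bound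
  have h1 : ∀ᶠ y : ParamSpace E in 𝓝 (0, q, 0), ∀ t ∈ Icc (0 : ℝ) 1,
      ‖D.omega (y.2.1 + t • y.2.2) - D.omega (y.2.1 + (1 / 2 : ℝ) • y.2.2) -
        fderiv ℝ D.omega (y.2.1 + (1 / 2 : ℝ) • y.2.2) ((t - 1 / 2) • y.2.2)‖ ≤
        |C| * ‖y.2.2‖ ^ 2 := by
    refine eventually_forall_Icc_of_forall_Icc (p := fun p : ParamSpace E × ℝ => ‖D.omega
      (p.1.2.1 + p.2 • p.1.2.2) - D.omega (p.1.2.1 + (1 / 2 : ℝ) • p.1.2.2) -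
        fderiv ℝ D.omega (p.1.2.1 + (1 / 2 : ℝ) • p.1.2.2) ((p.2 - 1 / 2) • p.1.2.2)‖ ≤
        |C| * ‖p.1.2.2‖ ^ 2) fun t ht => ?_
    have t1 : Tendsto (fun p : ParamSpace E × ℝ => (p.1.2.1 + p.2 • p.1.2.2,
        p.1.2.1 + (1 / 2 : ℝ) • p.1.2.2, p.1.2.1 + (1 / 2 : ℝ) • p.1.2.2)) (𝓝 ((0, q, 0), t))
        (𝓝 (q, q, q)) := by
      have : Continuous fun p : ParamSpace E × ℝ => (p.1.2.1 + p.2 • p.1.2.2,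
        p.1.2.1 + (1 / 2 : ℝ) • p.1.2.2, p.1.2.1 + (1 / 2 : ℝ) • p.1.2.2) := by fun_prop
      exact this.tendsto' _ _ (by simp)
    -- An open condition that contains [0, 1] and still gives |t − 1/2| ≤ 1.
    have t2 : ∀ᶠ p : ParamSpace E × ℝ in 𝓝 ((0, q, 0), t), p.2 ∈ Ioo (-1 / 2 : ℝ) (3 / 2) :=
      continuousAt_snd.eventually_mem (Ioo_mem_nhds (by linarith [ht.1]) (by linarith [ht.2]))
    filter_upwards [t1.eventually hC, t2] with p hp hp2
    have e1 : p.1.2.1 + p.2 • p.1.2.2 - (p.1.2.1 + (1 / 2 : ℝ) • p.1.2.2) =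
        (p.2 - 1 / 2) • p.1.2.2 := by module
    have e2 : ‖(p.2 - 1 / 2) • p.1.2.2‖ ≤ ‖p.1.2.2‖ := by
      rw [norm_smul]
      refine mul_le_of_le_one_left (norm_nonneg _) ?_
      rw [Real.norm_eq_abs, abs_le]
      constructor <;> linarith [hp2.1, hp2.2]
    simp only [e1, sub_self, norm_zero, add_zero, norm_mul, norm_norm] at hp
    refine hp.trans ?_
    rw [pow_two]
    gcongr
    exact le_abs_self C
  refine IsBigO.of_bound |C| ?_
  filter_upwards [h1, eventually_segment_mem hq] with y hy hm
  have i1 : IntervalIntegrable (fun t : ℝ => (1 - t) • D.omega (y.2.1 + t • y.2.2))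
      MeasureTheory.volume 0 1 := by
    refine ContinuousOn.intervalIntegrable_of_Icc zero_le_one fun t ht => ?_
    exact (ContinuousAt.smul (continuousAt_const.sub continuousAt_id) (ContinuousAt.comp
      (g := D.omega)
      (f := fun t : ℝ => y.2.1 + t • y.2.2) (contDiffAt_omega (hm t ht)).continuousAt
      (by fun_prop))).continuousWithinAt
  have := FiniteDimensional.complete ℝ E
  rw [← integral_one_sub_smul_affine, ← intervalIntegral.integral_sub i1
    (Continuous.intervalIntegrable (by fun_prop) _ _)]
  refine (intervalIntegral.norm_integral_le_of_norm_le_const (C := |C| * ‖y.2.2‖ ^ 2)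
    fun t ht => ?_).trans (by simp)
  rw [uIoc_of_le zero_le_one] at ht
  have ht' : t ∈ Icc (0 : ℝ) 1 := ⟨ht.1.le, ht.2⟩
  rw [← smul_sub, norm_smul, ← sub_sub, ← map_smul]
  have h2 : ‖1 - t‖ ≤ 1 := by rw [Real.norm_eq_abs, abs_le]; constructor <;> linarith [ht'.1, ht'.2]
  exact (mul_le_mul h2 (hy t ht') (norm_nonneg _) zero_le_one).trans (one_mul _).le

variable (D) in
/-- The size of the remainder in the expansion of the momentum. -/
noncomputable def remainder (y : ParamSpace E) : ℝ :=
  |y.1| ^ 3 + ‖D.deviation y‖ * (|y.1| + ‖D.deviation y‖)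

theorem tendsto_deviation (hq : q ∈ D.Q) :
    Tendsto D.deviation (𝓝 (0, q, 0)) (𝓝 0) := by
  have hx : (q : E) + (1 / 2 : ℝ) • (0 : E) ∈ D.Q := by simpa using hq
  have c1 := (contDiffAt_midpoint (y := (0, q, 0)) (contDiffAt_XH hx)).continuousAt
  have c2 : ContinuousAt D.deviation (0, q, 0) :=
    ContinuousAt.sub (by fun_prop) (ContinuousAt.smul (by fun_prop) c1)
  simpa [ContinuousAt, deviation] using c2

theorem isBigO_displacement (hq : q ∈ D.Q) :
    (fun y : ParamSpace E => y.2.2) =O[𝓝 (0, q, 0)] fun y => |y.1| + ‖D.deviation y‖ := by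
  have hx : (q : E) + (1 / 2 : ℝ) • (0 : E) ∈ D.Q := by simpa using hq
  have c1 := ((contDiffAt_midpoint (y := (0, q, 0)) (contDiffAt_XH hx)).continuousAt).isBigO_one ℝ
  have h1 : (fun y : ParamSpace E => y.1 • D.XH (y.2.1 + (1 / 2 : ℝ) • y.2.2))
      =O[𝓝 (0, q, 0)] fun y => |y.1| + ‖D.deviation y‖ := by
    refine ((isBigO_refl (fun y : ParamSpace E => y.1) _).smul c1).trans
      (IsBigO.of_bound 1 (Eventually.of_forall fun y => ?_))
    simp only [smul_eq_mul, mul_one, one_mul]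
    rw [Real.norm_of_nonneg (by positivity : 0 ≤ |y.1| + ‖D.deviation y‖), Real.norm_eq_abs]
    linarith [norm_nonneg (D.deviation y)]
  have h2 : D.deviation =O[𝓝 (0, q, 0)] fun y => |y.1| + ‖D.deviation y‖ := by
    refine IsBigO.of_bound 1 (Eventually.of_forall fun y => ?_)
    rw [one_mul, Real.norm_of_nonneg (by positivity)]
    linarith [abs_nonneg y.1]
  refine (h2.add h1).congr_left fun y => ?_
  simp [deviation]

/-- With ξ = κ + ħX_H everything free of κ cancels up to O(|ħ|³): −½ω(ξ, ·) against ½ħω(X_H, ·), the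
Taylor term (1/12)Dω[ξ](ξ, ·) of the line integral against the 1/12-term of Σ, and ħ²g(X_H, ·) at
the midpoint against its value at q. What remains is linear in κ, up to products of κ with small
quantities. -/
theorem isBigO_momentumCovector (θ : ℝ) (hq : q ∈ D.Q) :
    (fun y : ParamSpace E => D.momentumCovector θ y +
      (1 / 2 : ℝ) • D.omega (y.2.1 + (1 / 2 : ℝ) • y.2.2) (D.deviation y) +
      (1 / 2 * (Real.sin θ / (1 - Real.cos θ))) •
        D.metric (y.2.1 + (1 / 2 : ℝ) • y.2.2) (D.deviation y)) =O[𝓝 (0, q, 0)] D.remainder := by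
  set a : ParamSpace E := (0, q, 0) with ha
  set s : ParamSpace E → ℝ := fun y => |y.1| + ‖D.deviation y‖ with hs
  have hx : a.2.1 + (1 / 2 : ℝ) • a.2.2 ∈ D.Q := by simpa [ha] using hq
  have hsmall : ∀ᶠ y in 𝓝 a, |y.1| ≤ 1 ∧ ‖D.deviation y‖ ≤ 1 := by
    have h1 : ∀ᶠ y in 𝓝 a, |y.1| ≤ 1 := by
      have : Continuous fun y : ParamSpace E => |y.1| := by fun_prop
      exact (this.tendsto' a 0 (by simp [ha])).eventually (ge_mem_nhds zero_lt_one)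
    have h2 := (tendsto_deviation hq).norm
    rw [norm_zero] at h2
    exact h1.and (h2.eventually (ge_mem_nhds zero_lt_one))
  have hs0 : ∀ y, 0 ≤ s y := fun y => by positivity
  have hk0 : ∀ y, 0 ≤ ‖D.deviation y‖ := fun y => norm_nonneg _
  have hh0 : ∀ y : ParamSpace E, 0 ≤ |y.1| := fun y => abs_nonneg _
  have hR : ∀ y, D.remainder y = |y.1| ^ 3 + ‖D.deviation y‖ * s y := fun y => rfl
  have hR0 : ∀ y, 0 ≤ D.remainder y := fun y => by rw [hR]; positivity
  have r1 : (fun y => s y ^ 3) =O[𝓝 a] D.remainder := by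
    refine IsBigO.of_bound 4 ?_
    filter_upwards [hsmall] with y hy
    rw [Real.norm_of_nonneg (by positivity), Real.norm_of_nonneg (hR0 y), hR]
    simp only [hs]
    have := hk0 y
    have := hh0 y
    nlinarith [mul_nonneg (hk0 y) (hh0 y), mul_nonneg (hk0 y) (hk0 y),
      mul_nonneg (mul_nonneg (hk0 y) (hh0 y)) (sub_nonneg.2 hy.1),
      mul_nonneg (mul_nonneg (hk0 y) (hh0 y)) (sub_nonneg.2 hy.2),
      mul_nonneg (mul_nonneg (hk0 y) (hk0 y)) (sub_nonneg.2 hy.2), pow_nonneg (hh0 y) 3]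
  have r2 : (fun y : ParamSpace E => |y.1| ^ 2 * s y) =O[𝓝 a] D.remainder := by
    refine IsBigO.of_bound 1 ?_
    filter_upwards [hsmall] with y hy
    rw [Real.norm_of_nonneg (by have := hs0 y; positivity), Real.norm_of_nonneg (hR0 y), hR]
    simp only [hs]
    nlinarith [mul_nonneg (mul_nonneg (hk0 y) (hh0 y)) (sub_nonneg.2 hy.1),
      mul_nonneg (hk0 y) (hk0 y)]
  have r3 : (fun y => ‖D.deviation y‖ * s y) =O[𝓝 a] D.remainder := by
    refine IsBigO.of_bound 1 (Eventually.of_forall fun y => ?_)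
    rw [Real.norm_of_nonneg (mul_nonneg (hk0 y) (hs0 y)), Real.norm_of_nonneg (hR0 y), hR]
    have := pow_nonneg (hh0 y) 3
    linarith
  have hξ : (fun y : ParamSpace E => y.2.2) =O[𝓝 a] s := isBigO_displacement hq
  have hκ : D.deviation =O[𝓝 a] fun y => ‖D.deviation y‖ := (isBigO_refl _ _).norm_right
  have hκs : D.deviation =O[𝓝 a] s := by
    refine IsBigO.of_bound 1 (Eventually.of_forall fun y => ?_)
    rw [one_mul, Real.norm_of_nonneg (hs0 y)]
    simp only [hs]
    linarith [hh0 y]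
  have hh : (fun y : ParamSpace E => y.1) =O[𝓝 a] fun y => |y.1| := (isBigO_refl _ _).norm_right
  have hhs : (fun y : ParamSpace E => y.1) =O[𝓝 a] s := by
    refine IsBigO.of_bound 1 (Eventually.of_forall fun y => ?_)
    rw [one_mul, Real.norm_of_nonneg (hs0 y), Real.norm_eq_abs]
    simp only [hs]
    linarith [hk0 y]
  have o1 := ((contDiffAt_midpoint (contDiffAt_XH hx)).continuousAt).isBigO_one ℝ
  have o2 := ((contDiffAt_midpoint ((contDiffAt_omega hx).fderiv_right
    (m := ∞) (by simp))).continuousAt).isBigO_one ℝ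
  have o3 := ((contDiffAt_midpoint ((contDiffAt_sigCovector hx).fderiv_right
    (m := ∞) (by simp))).continuousAt).isBigO_one ℝ
  have o4 := ((contDiffAt_midpoint ((contDiffAt_metric hx).fderiv_right
    (m := ∞) (by simp))).continuousAt).isBigO_one ℝ
  have o5 := ((contDiffAt_midpoint (contDiffAt_metric hx)).continuousAt).isBigO_one ℝ
  have o6 := ((contDiffAt_midpoint ((contDiffAt_XH hx).fderiv_right
    (m := ∞) (by simp))).continuousAt).isBigO_one ℝ
  have tA : (fun y : ParamSpace E => ((∫ t in (0 : ℝ)..1, (1 - t) • D.omega (y.2.1 + t • y.2.2)) -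
      ((1 / 2 : ℝ) • D.omega (y.2.1 + (1 / 2 : ℝ) • y.2.2) -
        (1 / 12 : ℝ) • fderiv ℝ D.omega (y.2.1 + (1 / 2 : ℝ) • y.2.2) y.2.2)) y.2.2)
      =O[𝓝 a] D.remainder := by
    refine ((isBigO_clm_apply (isBigO_integral_omega hq) hξ).trans
      ((hξ.norm_left.pow 2).mul (isBigO_refl s _))).trans (r1.congr_left fun y => ?_)
    ring
  -- Dω[ξ](ξ) − ħ²Dω[X_H](X_H) is the sum of Dω[κ](ξ) and ħDω[X_H](κ).
  have tB1 : (fun y : ParamSpace E => fderiv ℝ D.omega (y.2.1 + (1 / 2 : ℝ) • y.2.2)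
      (D.deviation y) y.2.2) =O[𝓝 a] D.remainder :=
    (isBigO_clm_apply (isBigO_clm_apply o2 hκ) hξ).trans (r3.congr_left fun y => by ring)
  have tB2 : (fun y : ParamSpace E => y.1 • fderiv ℝ D.omega (y.2.1 + (1 / 2 : ℝ) • y.2.2)
      (D.XH (y.2.1 + (1 / 2 : ℝ) • y.2.2)) (D.deviation y)) =O[𝓝 a] D.remainder :=
    (hhs.smul (isBigO_clm_apply (isBigO_clm_apply o2 o1) hκ)).trans
      (r3.congr_left fun y => by simp only [smul_eq_mul]; ring)
  have tC : (fun y : ParamSpace E => (y.1 ^ 2 / 2) •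
      (fderiv ℝ D.sigCovector (y.2.1 + (1 / 2 : ℝ) • y.2.2)).flip y.2.2) =O[𝓝 a]
      D.remainder := by
    have o3' : (fun y : ParamSpace E => (fderiv ℝ D.sigCovector
        (y.2.1 + (1 / 2 : ℝ) • y.2.2)).flip) =O[𝓝 a] fun _ => (1 : ℝ) :=
      (IsBigO.of_bound 1 (Eventually.of_forall fun y => by
        rw [ContinuousLinearMap.opNorm_flip, one_mul])).trans o3
    refine ((((hh.pow 2).const_mul_left (1 / 2)).smul (isBigO_clm_apply o3' hξ)).trans
      (r2.congr_left fun y => by simp only [smul_eq_mul]; ring)).congr_left fun y => ?_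
    congr 1
    ring
  have tD : (fun y : ParamSpace E => y.1 ^ 2 • (D.metric (y.2.1 + (1 / 2 : ℝ) • y.2.2)
      (D.XH (y.2.1 + (1 / 2 : ℝ) • y.2.2)) - D.metric y.2.1 (D.XH y.2.1))) =O[𝓝 a]
      D.remainder := by
    have c : ContDiffAt ℝ ∞ (fun x => D.metric x (D.XH x)) q :=
      (contDiffAt_metric hq).clm_apply (contDiffAt_XH hq)
    have t1 : Tendsto (fun y : ParamSpace E => (y.2.1 + (1 / 2 : ℝ) • y.2.2, y.2.1)) (𝓝 a)
        (𝓝 (q, q)) := by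
      have : Continuous fun y : ParamSpace E => (y.2.1 + (1 / 2 : ℝ) • y.2.2, y.2.1) := by fun_prop
      exact this.tendsto' _ _ (by simp [ha])
    have k1 := (c.isBigO_sub_nhds (by simp)).comp_tendsto t1
    have k2 : (fun y : ParamSpace E => (1 / 2 : ℝ) • y.2.2) =O[𝓝 a] s := hξ.const_smul_left _
    simp only [Function.comp_def, add_sub_cancel_left] at k1
    exact ((hh.pow 2).smul (k1.trans k2)).trans (r2.congr_left fun y => by simp)
  have tE1 : (fun y : ParamSpace E => ((fderiv ℝ D.metric (y.2.1 + (1 / 2 : ℝ) • y.2.2)).flip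
        (D.deviation y)).flip (D.deviation y)) =O[𝓝 a] D.remainder := by
    have o4' : (fun y : ParamSpace E => (fderiv ℝ D.metric
        (y.2.1 + (1 / 2 : ℝ) • y.2.2)).flip) =O[𝓝 a] fun _ => (1 : ℝ) :=
      (IsBigO.of_bound 1 (Eventually.of_forall fun y => by
        rw [ContinuousLinearMap.opNorm_flip, one_mul])).trans o4
    have o4'' := isBigO_clm_apply o4' hκ
    have o7 : (fun y : ParamSpace E => ((fderiv ℝ D.metric (y.2.1 + (1 / 2 : ℝ) • y.2.2)).flip
        (D.deviation y)).flip) =O[𝓝 a] fun y => 1 * ‖D.deviation y‖ :=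
      (IsBigO.of_bound 1 (Eventually.of_forall fun y => by
        rw [ContinuousLinearMap.opNorm_flip, one_mul])).trans o4''
    exact (isBigO_clm_apply o7 hκs).trans (r3.congr_left fun y => by ring)
  have tE2 : (fun y : ParamSpace E => (y.1 / 4) • (D.metric (y.2.1 + (1 / 2 : ℝ) • y.2.2)
      (D.deviation y)).comp (fderiv ℝ D.XH (y.2.1 + (1 / 2 : ℝ) • y.2.2))) =O[𝓝 a]
      D.remainder := by
    have k1 : (fun y : ParamSpace E => (D.metric (y.2.1 + (1 / 2 : ℝ) • y.2.2)
      (D.deviation y)).comp (fderiv ℝ D.XH (y.2.1 + (1 / 2 : ℝ) • y.2.2))) =O[𝓝 a]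
      fun y => (1 * ‖D.deviation y‖) * 1 := by
      refine IsBigO.trans (IsBigO.of_bound 1 (Eventually.of_forall fun y => ?_))
        ((isBigO_clm_apply o5 hκ).norm_left.mul o6.norm_left)
      rw [one_mul, norm_mul, norm_norm, norm_norm]
      exact ContinuousLinearMap.opNorm_comp_le _ _
    refine (((hhs.const_mul_left (1 / 4)).smul k1).trans
      (r3.congr_left fun y => by simp only [smul_eq_mul]; ring)).congr_left fun y => ?_
    congr 1
    ring
  have total := ((((tA.neg_left.add ((tB1.add tB2).const_smul_left (1 / 12 : ℝ))).sub tC).add tD).add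
    (((tE1.const_smul_left (1 / 8 : ℝ)).sub tE2).const_smul_left
      (Real.sin θ / (1 - Real.cos θ))))
  refine total.congr_left fun y => ?_
  have e1 : y.2.2 = D.deviation y + y.1 • D.XH (y.2.1 + (1 / 2 : ℝ) • y.2.2) := by
    simp [deviation]
  simp only [momentumCovector, sigCovector, Pi.smul_apply]
  generalize D.deviation y = κ at e1 ⊢
  generalize (∫ t in (0 : ℝ)..1, (1 - t) • D.omega (y.2.1 + t • y.2.2)) = I
  generalize y.2.1 + (1 / 2 : ℝ) • y.2.2 = x at e1 ⊢
  rw [e1]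
  ext w
  simp
  ring

end MomentumExpansion

end HamSystem

/-! ### Deviation, displacement and linearization of the momentum -/

namespace HamSystem

section MomentumEstimates

set_option maxSynthPendingDepth 3

variable {E : Type*} [NormedAddCommGroup E] [NormedSpace ℝ E] {D : HamSystem E} {q q' : E}

theorem isBigO_one_of_base {V : Type*} [NormedAddCommGroup V] {f : E → V}
    (hf : ContinuousAt f q) :
    (fun y : ParamSpace E => f y.2.1) =O[𝓝 (0, q, 0)] fun _ => (1 : ℝ) :=
  (ContinuousAt.comp (g := f) (f := fun y : ParamSpace E => y.2.1) (x := (0, q, 0)) hf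
    (by fun_prop)).isBigO_one ℝ

theorem momentum_base (θ : ℝ) (q : E) : D.momentum θ (0, q, 0) = 0 := by
  simp [momentum, momentumCovector, deviation]

variable [FiniteDimensional ℝ E]

theorem isBigO_midpoint_sub {V : Type*} [NormedAddCommGroup V] [NormedSpace ℝ V] {f : E → V}
    (hf : ContDiffAt ℝ ∞ f q) (hq : q ∈ D.Q) :
    (fun y : ParamSpace E => f (y.2.1 + (1 / 2 : ℝ) • y.2.2) - f y.2.1) =O[𝓝 (0, q, 0)]
      fun y => |y.1| + ‖D.deviation y‖ := by
  have t1 : Tendsto (fun y : ParamSpace E => (y.2.1 + (1 / 2 : ℝ) • y.2.2, y.2.1))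
      (𝓝 (0, q, 0)) (𝓝 (q, q)) := by
    have : Continuous fun y : ParamSpace E => (y.2.1 + (1 / 2 : ℝ) • y.2.2, y.2.1) := by fun_prop
    exact this.tendsto' _ _ (by simp)
  have k1 := (hf.isBigO_sub_nhds (by simp)).comp_tendsto t1
  have k2 : (fun y : ParamSpace E => (1 / 2 : ℝ) • y.2.2) =O[𝓝 (0, q, 0)]
      fun y => |y.1| + ‖D.deviation y‖ := (isBigO_displacement hq).const_smul_left _
  simp only [Function.comp_def, add_sub_cancel_left] at k1
  exact k1.trans k2

/-- Move the coefficients from the midpoint to q at the cost of the remainder, and apply the inverse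
of g, which turns ω(κ, ·) into J κ. -/
theorem isBigO_momentum (θ : ℝ) (hq : q ∈ D.Q) :
    (fun y : ParamSpace E => D.momentum θ y + (1 / 2 : ℝ) • (D.J y.2.1 (D.deviation y) +
      (Real.sin θ / (1 - Real.cos θ)) • D.deviation y)) =O[𝓝 (0, q, 0)] D.remainder := by
  have hκ : D.deviation =O[𝓝 (0, q, 0)] fun y => ‖D.deviation y‖ := (isBigO_refl _ _).norm_right
  have r3 : (fun y => (|y.1| + ‖D.deviation y‖) * ‖D.deviation y‖) =O[𝓝 (0, q, 0)]
      D.remainder := by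
    refine IsBigO.of_bound 1 (Eventually.of_forall fun y => ?_)
    rw [one_mul, Real.norm_of_nonneg (by positivity),
      Real.norm_of_nonneg (by unfold remainder; positivity), remainder]
    have := pow_nonneg (abs_nonneg y.1) 3
    linarith
  have k1 := (isBigO_clm_apply (isBigO_midpoint_sub (contDiffAt_omega hq) hq) hκ).trans r3
  have k2 := (isBigO_clm_apply (isBigO_midpoint_sub (contDiffAt_metric hq) hq) hκ).trans r3
  have k3 := ((isBigO_momentumCovector θ hq).sub (k1.const_smul_left (1 / 2 : ℝ))).sub
    (k2.const_smul_left (1 / 2 * (Real.sin θ / (1 - Real.cos θ))))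
  have k4 := isBigO_clm_apply (isBigO_one_of_base (contDiffAt_metric_inverse hq).continuousAt) k3
  simp only [one_mul] at k4
  refine k4.congr' ?_ EventuallyEq.rfl
  filter_upwards [eventually_fst_snd_mem D.isOpen_Q hq] with y hy
  rw [← metric_inverse_apply hy ((1 / 2 : ℝ) • (D.J y.2.1 (D.deviation y) +
      (Real.sin θ / (1 - Real.cos θ)) • D.deviation y)), momentum, ← map_add]
  congr 1
  ext w
  have := metric_J hy (D.deviation y) w
  simp [this]
  ring

/-- Since (J − c)(J + c) = −(1 + c²), the leading part of the momentum can be solved for κ; the part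
of the remainder involving κ is absorbed near the base point. -/
theorem isBigO_deviation (θ : ℝ) (hq : q ∈ D.Q) :
    D.deviation =O[𝓝 (0, q, 0)] fun y => |y.1| ^ 3 + ‖D.momentum θ y‖ := by
  set c := Real.sin θ / (1 - Real.cos θ) with hc
  obtain ⟨C₁, hC₁, b₁⟩ := (isBigO_momentum θ hq).exists_pos
  have k1 : (fun y : ParamSpace E => D.J y.2.1 - c • ContinuousLinearMap.id ℝ E)
      =O[𝓝 (0, q, 0)] fun _ => (1 : ℝ) :=
    isBigO_one_of_base (f := fun q => D.J q - c • ContinuousLinearMap.id ℝ E)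
      ((contDiffAt_J hq).continuousAt.sub continuousAt_const)
  obtain ⟨C₂, hC₂, b₂⟩ := k1.exists_pos
  have t1 : Tendsto (fun y : ParamSpace E => |y.1| + ‖D.deviation y‖) (𝓝 (0, q, 0)) (𝓝 0) := by
    have : Tendsto (fun y : ParamSpace E => |y.1|) (𝓝 (0, q, 0)) (𝓝 0) := by
      have : Continuous fun y : ParamSpace E => |y.1| := by fun_prop
      exact this.tendsto' _ _ (by simp)
    simpa using this.add (tendsto_deviation hq).norm
  -- This smallness makes the κ-part of the remainder, after multiplication by 4 C₂, at most ‖κ‖, so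
  -- that it can be absorbed on the left.
  have e1 : ∀ᶠ y : ParamSpace E in 𝓝 (0, q, 0),
      |y.1| + ‖D.deviation y‖ ≤ 1 / (4 * C₁ * C₂) := t1.eventually (ge_mem_nhds (by positivity))
  refine IsBigO.of_bound (4 * C₂ * C₁ + 4 * C₂) ?_
  filter_upwards [b₁.bound, b₂.bound, e1, eventually_fst_snd_mem D.isOpen_Q hq] with y f1 f2 f3 hy
  set κ := D.deviation y
  set m := D.momentum θ y
  rw [Real.norm_of_nonneg (by unfold remainder; positivity), remainder] at f1
  rw [norm_one, mul_one] at f2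
  have i1 : -((1 + c ^ 2) • κ) = (D.J y.2.1 - c • ContinuousLinearMap.id ℝ E)
      (D.J y.2.1 κ + c • κ) := by
    simp [D.J_sq _ hy]
    module
  have i2 : (1 + c ^ 2) * ‖κ‖ ≤ C₂ * ‖D.J y.2.1 κ + c • κ‖ := by
    rw [← Real.norm_of_nonneg (by positivity : 0 ≤ 1 + c ^ 2), ← norm_smul, ← norm_neg, i1]
    exact (ContinuousLinearMap.le_opNorm _ _).trans (by gcongr)
  have i3 : (1 / 2) * ‖D.J y.2.1 κ + c • κ‖ ≤
      C₁ * (|y.1| ^ 3 + ‖κ‖ * (|y.1| + ‖κ‖)) + ‖m‖ := by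
    rw [← Real.norm_of_nonneg (by norm_num : (0 : ℝ) ≤ 1 / 2), ← norm_smul]
    calc _ = ‖(m + (1 / 2 : ℝ) • (D.J y.2.1 κ + c • κ)) - m‖ := by rw [add_sub_cancel_left]
      _ ≤ _ := (norm_sub_le _ _).trans (by gcongr)
  have i4 : C₁ * (‖κ‖ * (|y.1| + ‖κ‖)) * (4 * C₂) ≤ ‖κ‖ := by
    calc C₁ * (‖κ‖ * (|y.1| + ‖κ‖)) * (4 * C₂) = (4 * C₁ * C₂) * (|y.1| + ‖κ‖) * ‖κ‖ := by ring
      _ ≤ (4 * C₁ * C₂) * (1 / (4 * C₁ * C₂)) * ‖κ‖ := by gcongr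
      _ = ‖κ‖ := by field_simp
  rw [Real.norm_of_nonneg (by positivity)]
  have i5 : ‖κ‖ ≤ (1 + c ^ 2) * ‖κ‖ := by nlinarith [norm_nonneg κ, sq_nonneg c]
  have i6 : C₂ * ‖D.J y.2.1 κ + c • κ‖ ≤
      C₂ * (2 * (C₁ * (|y.1| ^ 3 + ‖κ‖ * (|y.1| + ‖κ‖)) + ‖m‖)) := by
    gcongr
    linarith
  have i7 : 0 ≤ C₂ * C₁ * ‖m‖ := by positivity
  have i8 : 0 ≤ C₂ * |y.1| ^ 3 := by positivity
  nlinarith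

/-- The midpoint rule has second order: expand X_H at the midpoint q + ξ/2 and insert ξ = ħX_H + …
into the linear term. -/
theorem isBigO_displacement_sub (hq : q ∈ D.Q) :
    (fun y : ParamSpace E => y.2.2 - (y.1 • D.XH y.2.1 +
      (y.1 ^ 2 / 2) • fderiv ℝ D.XH y.2.1 (D.XH y.2.1))) =O[𝓝 (0, q, 0)]
      fun y => |y.1| ^ 3 + ‖D.deviation y‖ := by
  set a : ParamSpace E := (0, q, 0) with ha
  set s : ParamSpace E → ℝ := fun y => |y.1| + ‖D.deviation y‖ with hs
  set r : ParamSpace E → ℝ := fun y => |y.1| ^ 3 + ‖D.deviation y‖ with hr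
  have hsmall : ∀ᶠ y : ParamSpace E in 𝓝 a, |y.1| ≤ 1 ∧ ‖D.deviation y‖ ≤ 1 := by
    have h1 : ∀ᶠ y : ParamSpace E in 𝓝 a, |y.1| ≤ 1 := by
      have : Continuous fun y : ParamSpace E => |y.1| := by fun_prop
      exact (this.tendsto' a 0 (by simp [ha])).eventually (ge_mem_nhds zero_lt_one)
    have h2 := (tendsto_deviation hq).norm
    rw [norm_zero] at h2
    exact h1.and (h2.eventually (ge_mem_nhds zero_lt_one))
  have r0 : ∀ y, 0 ≤ r y := fun y => by positivity
  have hκ : D.deviation =O[𝓝 a] r := by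
    refine IsBigO.of_bound 1 (Eventually.of_forall fun y => ?_)
    rw [one_mul, Real.norm_of_nonneg (r0 y)]
    simp only [hr]
    have := pow_nonneg (abs_nonneg y.1) 3
    linarith
  have hh : (fun y : ParamSpace E => y.1) =O[𝓝 a] fun y => |y.1| := (isBigO_refl _ _).norm_right
  have r1 : (fun y : ParamSpace E => |y.1| * (s y * s y)) =O[𝓝 a] r := by
    refine IsBigO.of_bound 3 ?_
    filter_upwards [hsmall] with y hy
    rw [Real.norm_of_nonneg (by positivity), Real.norm_of_nonneg (r0 y)]
    simp only [hr, hs]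
    have hk0 := norm_nonneg (D.deviation y)
    have hh0 := abs_nonneg y.1
    have j1 : |y.1| * |y.1| ≤ 1 := mul_le_one₀ hy.1 hh0 hy.1
    have j2 : |y.1| * ‖D.deviation y‖ ≤ 1 := mul_le_one₀ hy.1 hk0 hy.2
    have j3 := mul_le_mul_of_nonneg_right j1 hk0
    have j4 := mul_le_mul_of_nonneg_right j2 hk0
    nlinarith [pow_nonneg hh0 3]
  have r2 : (fun y : ParamSpace E => |y.1| * r y) =O[𝓝 a] r := by
    refine IsBigO.of_bound 1 ?_
    filter_upwards [hsmall] with y hy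
    have := r0 y
    rw [Real.norm_of_nonneg (by positivity), Real.norm_of_nonneg (r0 y)]
    exact mul_le_mul_of_nonneg_right hy.1 this
  have hξ : (fun y : ParamSpace E => y.2.2) =O[𝓝 a] s := isBigO_displacement hq
  -- second order expansion of the vector field at the midpoint
  have t1 : Tendsto (fun y : ParamSpace E => (y.2.1 + (1 / 2 : ℝ) • y.2.2, y.2.1, y.2.1))
      (𝓝 a) (𝓝 (q, q, q)) := by
    have : Continuous fun y : ParamSpace E =>
      (y.2.1 + (1 / 2 : ℝ) • y.2.2, y.2.1, y.2.1) := by fun_prop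
    exact this.tendsto' _ _ (by simp [ha])
  have k1 := ((contDiffAt_XH hq).isBigO_sub_sub_fderiv two_le_infty).comp_tendsto t1
  simp only [Function.comp_def, add_sub_cancel_left, sub_self, norm_zero, add_zero] at k1
  have k2 : (fun y : ParamSpace E => (1 / 2 : ℝ) • y.2.2) =O[𝓝 a] s := hξ.const_smul_left _
  have k3 := (hh.smul (k1.trans (k2.norm_left.mul k2.norm_left))).trans r1
  -- first order expansion
  have k4 := hh.smul (hh.smul (isBigO_midpoint_sub (contDiffAt_XH hq) hq))
  have k5 : (fun y : ParamSpace E => y.1 • (y.1 • (D.XH (y.2.1 + (1 / 2 : ℝ) • y.2.2) -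
      D.XH y.2.1))) =O[𝓝 a] r := by
    refine k4.trans (IsBigO.trans (IsBigO.of_bound 1 (Eventually.of_forall fun y => ?_)) r1)
    have hk0 := norm_nonneg (D.deviation y)
    have hh0 := abs_nonneg y.1
    simp only [smul_eq_mul]
    rw [one_mul, Real.norm_of_nonneg (by positivity), Real.norm_of_nonneg (by positivity)]
    simp only [hs]
    gcongr
    linarith
  have k6 : (fun y : ParamSpace E => y.1 • (1 / 2 : ℝ) • fderiv ℝ D.XH y.2.1
      (y.2.2 - y.1 • D.XH y.2.1)) =O[𝓝 a] r := by
    have j1 := isBigO_one_of_base (f := fderiv ℝ D.XH)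
      (((contDiffAt_XH hq).fderiv_right (m := 0) (by simp)).continuousAt)
    have j2 := isBigO_clm_apply j1 (((hh.smul hκ).trans r2).add k5)
    refine (j2.const_smul_left (1 / 2 : ℝ)).congr (fun y => ?_) fun y => one_mul _
    simp only [Pi.smul_apply]
    rw [← smul_add, map_smul, smul_comm]
    congr 3
    simp [deviation, smul_sub]
  refine ((hκ.add k3).add k6).congr_left fun y => ?_
  simp only [deviation, map_sub, map_smul]
  module

/-- The remainder is of smaller order than the distance to (0, q, 0), so the derivative is that of
−½(J + c)κ. -/
theorem hasFDerivAt_momentum (θ : ℝ) (hq : q ∈ D.Q) :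
    ∃ A : ParamSpace E →L[ℝ] E, HasFDerivAt (D.momentum θ) A (0, q, 0) ∧
      ∀ h u ξ, A (h, u, ξ) = -(1 / 2 : ℝ) • (D.J q (ξ - h • D.XH q) +
        (Real.sin θ / (1 - Real.cos θ)) • (ξ - h • D.XH q)) := by
  have hx : (q : E) + (1 / 2 : ℝ) • (0 : E) ∈ D.Q := by simpa using hq
  set c := Real.sin θ / (1 - Real.cos θ) with hc
  -- the linear part
  have hX := ((contDiffAt_midpoint (y := (0, q, 0)) (contDiffAt_XH hx)).differentiableAt
    (by simp)).hasFDerivAt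
  have hfst : HasFDerivAt (fun y : ParamSpace E => y.1) (ContinuousLinearMap.fst ℝ ℝ (E × E))
    (0, q, 0) := hasFDerivAt_fst
  have hsnd : HasFDerivAt (fun y : ParamSpace E => y.2.2) ((ContinuousLinearMap.snd ℝ E E).comp
      (ContinuousLinearMap.snd ℝ ℝ (E × E))) (0, q, 0) :=
    ((ContinuousLinearMap.snd ℝ E E).comp (ContinuousLinearMap.snd ℝ ℝ (E × E))).hasFDerivAt
  have hκ : HasFDerivAt D.deviation _ (0, q, 0) := hsnd.sub (hfst.smul hX)
  have hJ : HasFDerivAt (fun y : ParamSpace E => D.J y.2.1) _ (0, q, 0) :=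
    ((ContDiffAt.comp (g := D.J) ((0, q, 0) : ParamSpace E) (contDiffAt_J hq)
      contDiffAt_snd.fst).differentiableAt (by simp)).hasFDerivAt
  have hlin := (((hJ.clm_apply hκ).add (hκ.const_smul c)).const_smul (1 / 2 : ℝ))
  -- the remainder
  have hrem : D.remainder =o[𝓝 (0, q, 0)] fun y => y - (0, q, 0) := by
    have o2 : (fun y : ParamSpace E => |y.1|) =O[𝓝 (0, q, 0)] fun y => y - (0, q, 0) := by
      refine IsBigO.of_bound 1 (Eventually.of_forall fun y => ?_)
      have := norm_fst_le (y - (0, q, 0))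
      rwa [Prod.fst_sub, sub_zero, ← norm_abs_eq_norm, ← one_mul ‖y - _‖] at this
    have o3 : D.deviation =O[𝓝 (0, q, 0)] fun y => y - (0, q, 0) :=
      hκ.isBigO_sub.congr_left fun y => by simp [deviation]
    have t1 : Tendsto (fun y : ParamSpace E => |y.1|) (𝓝 (0, q, 0)) (𝓝 0) := by
      have : Continuous fun y : ParamSpace E => |y.1| := by fun_prop
      exact this.tendsto' _ _ (by simp)
    have t2 := (tendsto_deviation hq).norm
    have o4 : (fun y : ParamSpace E => |y.1| ^ 2) =o[𝓝 (0, q, 0)] fun _ => (1 : ℝ) := by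
      rw [isLittleO_one_iff]
      simpa using t1.pow 2
    have o5 : (fun y : ParamSpace E => |y.1| + ‖D.deviation y‖) =o[𝓝 (0, q, 0)]
        fun _ => (1 : ℝ) := by
      rw [isLittleO_one_iff]
      simpa using t1.add t2
    have o6 := (o2.norm_right.mul_isLittleO o4).add (o3.norm_norm.mul_isLittleO o5)
    simp only [mul_one] at o6
    refine (o6.congr_left (f₂ := D.remainder) fun y => ?_).of_norm_right
    unfold remainder
    ring
  have hm : HasFDerivAt (D.momentum θ + fun y => (1 / 2 : ℝ) • (D.J y.2.1 (D.deviation y) +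
      c • D.deviation y)) (0 : ParamSpace E →L[ℝ] E) (0, q, 0) := by
    refine HasFDerivAt.of_isLittleO ?_
    refine ((isBigO_momentum θ hq).trans_isLittleO hrem).congr_left fun y => ?_
    simp [momentum_base, deviation, hc]
  have h2 := hm.sub hlin
  refine ⟨_, h2.congr_of_eventuallyEq (Eventually.of_forall fun y => ?_), fun h u ξ => ?_⟩
  · simp
  · simp [deviation]
    abel

end MomentumEstimates

end HamSystem

/-! ### The Lorentz map as a nearly periodic map -/

namespace HamSystem

section MomentumMap

set_option maxSynthPendingDepth 3

variable {E : Type*} [NormedAddCommGroup E] [NormedSpace ℝ E] {D : HamSystem E} {q q' : E} {θ : ℝ}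

variable (D) in
/-- The map from `(ħ, q, q' - q)` to `(ħ, q, p)`, where `p` is the rescaled momentum. -/
noncomputable def legendre (θ : ℝ) (y : ParamSpace E) : ParamSpace E :=
  (y.1, y.2.1, D.momentum θ y)

/-- Exchange of the two endpoints, and of the sign of `ħ`. -/
def swapEnds (y : ParamSpace E) : ParamSpace E := (-y.1, y.2.1 + y.2.2, -y.2.2)

theorem deviation_swapEnds (y : ParamSpace E) : D.deviation (swapEnds y) = -D.deviation y := by
  have : y.2.1 + y.2.2 + (1 / 2 : ℝ) • -y.2.2 = y.2.1 + (1 / 2 : ℝ) • y.2.2 := by module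
  simp only [deviation, swapEnds, this]
  module

theorem remainder_swapEnds (y : ParamSpace E) : D.remainder (swapEnds y) = D.remainder y := by
  simp only [remainder, deviation_swapEnds, norm_neg]
  simp only [swapEnds, abs_neg]

variable (D) in
/-- The image point and its rescaled momentum, in terms of `(ħ, q, q' - q)`. -/
noncomputable def imageMomentum (θ : ℝ) (y : ParamSpace E) : E × E :=
  (y.2.1 + y.2.2, D.momentum (-θ) (swapEnds y))

variable (D) in
/-- The Lorentz map in the variables `(ħ, q, p)`. -/
noncomputable def momentumMap (θ : ℝ) (V : Set (ParamSpace E)) (z : ParamSpace E) : E × E :=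
  D.imageMomentum θ (Function.invFunOn (D.legendre θ) V z)

theorem tendsto_swapEnds {E : Type*} [NormedAddCommGroup E] (q : E) :
    Tendsto swapEnds (𝓝 ((0, q, 0) : ParamSpace E)) (𝓝 (0, q, 0)) := by
  have : Continuous (swapEnds (E := E)) := by unfold swapEnds; fun_prop
  exact this.tendsto' _ _ (by simp [swapEnds])

theorem momentumMap_legendre {V : Set (ParamSpace E)} (hinj : InjOn (D.legendre θ) V) {y : ParamSpace E} (hy : y ∈ V) :
    D.momentumMap θ V (D.legendre θ y) = D.imageMomentum θ y := by
  rw [momentumMap, hinj.leftInvOn_invFunOn hy]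

theorem segment_base (hq : q ∈ D.Q) :
    segment ℝ ((0, q, 0) : ParamSpace E).2.1 (((0, q, 0) : ParamSpace E).2.1 +
      ((0, q, 0) : ParamSpace E).2.2) ⊆ D.Q := by
  simpa using hq

theorem legendre_base (q : E) : D.legendre θ (0, q, 0) = (0, q, 0) := by
  simp [legendre, momentum_base]

variable [FiniteDimensional ℝ E]

theorem contDiffAt_legendre {y : ParamSpace E} (h : segment ℝ y.2.1 (y.2.1 + y.2.2) ⊆ D.Q) :
    ContDiffAt ℝ ∞ (D.legendre θ) y :=
  contDiffAt_fst.prodMk (contDiffAt_snd.fst.prodMk (contDiffAt_momentum θ h))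

theorem contDiffAt_imageMomentum {y : ParamSpace E}
    (h : segment ℝ y.2.1 (y.2.1 + y.2.2) ⊆ D.Q) : ContDiffAt ℝ ∞ (D.imageMomentum θ) y := by
  refine ContDiffAt.prodMk (by fun_prop) (ContDiffAt.comp (g := D.momentum (-θ)) y
    (contDiffAt_momentum (-θ) ?_) (by unfold swapEnds; fun_prop))
  simpa [swapEnds, segment_symm] using h

/-- On the deviation, the inverse of −½(J + c) is (1 − cos θ)J − sin θ; this uses sin²θ = (1 − cos
θ)(1 + cos θ). -/
theorem exists_equiv_legendre (hθ : Real.cos θ ≠ 1) (hq : q ∈ D.Q) :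
    ∃ e : ParamSpace E ≃L[ℝ] ParamSpace E, HasFDerivAt (D.legendre θ)
      (e : ParamSpace E →L[ℝ] ParamSpace E) (0, q, 0) ∧ ∀ h u p, e.symm (h, u, p) =
        (h, u, h • D.XH q + (1 - Real.cos θ) • D.J q p - Real.sin θ • p) := by
  obtain ⟨A, hA, hA'⟩ := hasFDerivAt_momentum θ hq
  have hs : 1 - Real.cos θ ≠ 0 := sub_ne_zero.2 (Ne.symm hθ)
  have hJ := D.J_sq q hq
  set A' : ParamSpace E →L[ℝ] ParamSpace E := (ContinuousLinearMap.fst ℝ ℝ (E × E)).prod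
    (((ContinuousLinearMap.fst ℝ E E).comp (ContinuousLinearMap.snd ℝ ℝ (E × E))).prod A) with hA2
  set B : ParamSpace E →L[ℝ] ParamSpace E := (ContinuousLinearMap.fst ℝ ℝ (E × E)).prod
    (((ContinuousLinearMap.fst ℝ E E).comp (ContinuousLinearMap.snd ℝ ℝ (E × E))).prod
      ((ContinuousLinearMap.fst ℝ ℝ (E × E)).smulRight (D.XH q) +
        ((1 - Real.cos θ) • D.J q - Real.sin θ • ContinuousLinearMap.id ℝ E).comp
          ((ContinuousLinearMap.snd ℝ E E).comp (ContinuousLinearMap.snd ℝ ℝ (E × E))))) with hB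
  have hA1 : ∀ h u ξ, A' (h, u, ξ) = (h, u, -(1 / 2 : ℝ) • (D.J q (ξ - h • D.XH q) +
        (Real.sin θ / (1 - Real.cos θ)) • (ξ - h • D.XH q))) := fun h u ξ => by
    rw [← hA']; rfl
  have hB1 : ∀ h u p, B (h, u, p) =
      (h, u, h • D.XH q + (1 - Real.cos θ) • D.J q p - Real.sin θ • p) := fun h u p => by
    simp [hB]; abel
  have hsc := Real.sin_sq_add_cos_sq θ
  have hAB : ∀ y, A' (B y) = y := by
    rintro ⟨h, u, p⟩
    rw [hB1, hA1]
    simp only [Prod.mk.injEq, true_and]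
    have e1 : h • D.XH q + (1 - Real.cos θ) • D.J q p - Real.sin θ • p - h • D.XH q =
      (1 - Real.cos θ) • D.J q p - Real.sin θ • p := by abel
    rw [e1]
    simp only [map_sub, map_smul, hJ]
    match_scalars <;> field_simp <;> linarith
  have hBA : ∀ y, B (A' y) = y := by
    rintro ⟨h, u, ξ⟩
    rw [hA1, hB1]
    simp only [Prod.mk.injEq, true_and]
    obtain ⟨κ, hκ⟩ : ∃ κ, ξ = κ + h • D.XH q := ⟨ξ - h • D.XH q, by abel⟩
    rw [hκ, add_sub_cancel_right]
    simp only [map_smul, map_add, hJ]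
    match_scalars <;> field_simp <;> linarith
  refine ⟨ContinuousLinearEquiv.equivOfInverse A' B hBA hAB, ?_, hB1⟩
  have hd : HasFDerivAt (D.legendre θ) A' (0, q, 0) := hasFDerivAt_fst.prodMk
    (((ContinuousLinearMap.fst ℝ E E).comp
      (ContinuousLinearMap.snd ℝ ℝ (E × E))).hasFDerivAt.prodMk hA)
  exact hd

/-- The points (0, q, 0) are fixed with invertible derivative, so the map is injective on a
neighbourhood of all of them. Intersecting it with the open set where the derivative is invertible
makes the inverse smooth throughout. -/
theorem exists_legendre_domain (D : HamSystem E) (hθ : Real.cos θ ≠ 1) :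
    ∃ V : Set (ParamSpace E), IsOpen V ∧ (∀ q ∈ D.Q, ((0, q, 0) : ParamSpace E) ∈ V) ∧
      (∀ y ∈ V, segment ℝ y.2.1 (y.2.1 + y.2.2) ⊆ D.Q) ∧ InjOn (D.legendre θ) V ∧
      ∀ y ∈ V, ∃ e : ParamSpace E ≃L[ℝ] ParamSpace E,
        HasFDerivAt (D.legendre θ) (e : ParamSpace E →L[ℝ] ParamSpace E) y := by
  have := FiniteDimensional.complete ℝ E
  have hO : {y | ∃ q ∈ D.Q, y = ((0, q, 0) : ParamSpace E)} ⊆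
      interior {y | segment ℝ y.2.1 (y.2.1 + y.2.2) ⊆ D.Q} := by
    rintro _ ⟨q, hq, rfl⟩
    rw [mem_interior_iff_mem_nhds]
    filter_upwards [eventually_segment_mem hq] with y hy
    exact segment_subset_of_forall hy
  obtain ⟨V, h1, h2, h3, h4⟩ := exists_isOpen_injOn_of_forall_fixed (G := D.legendre θ)
    isOpen_interior hO (by rintro _ ⟨q, hq, rfl⟩; exact legendre_base q) (by
      rintro _ ⟨q, hq, rfl⟩
      obtain ⟨e, he, -⟩ := exists_equiv_legendre hθ hq
      exact ⟨e, (contDiffAt_legendre (segment_base hq)).hasStrictFDerivAt' he (by simp)⟩)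
  have h3' : ∀ y ∈ V, segment ℝ y.2.1 (y.2.1 + y.2.2) ⊆ D.Q := fun y hy =>
    (interior_subset (s := {y : ParamSpace E | segment ℝ y.2.1 (y.2.1 + y.2.2) ⊆ D.Q})) (h3 hy)
  have hc : ContinuousOn (fderiv ℝ (D.legendre θ)) V := fun y hy =>
    ((contDiffAt_legendre (h3' y hy)).fderiv_right (m := 0)
      (by simp)).continuousAt.continuousWithinAt
  refine ⟨_, hc.isOpen_inter_preimage h1 (ContinuousLinearEquiv.isOpen (𝕜 := ℝ)
    (E := ParamSpace E) (F := ParamSpace E)), fun q hq => ⟨h2 ⟨q, hq, rfl⟩, ?_⟩,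
    fun y hy => h3' y hy.1, h4.mono inter_subset_left, fun y hy => ?_⟩
  · obtain ⟨e, he, -⟩ := exists_equiv_legendre hθ hq
    exact ⟨e, he.fderiv.symm⟩
  · obtain ⟨e, he⟩ := hy.2
    refine ⟨e, ?_⟩
    rw [he]
    exact ((contDiffAt_legendre (h3' y hy.1)).differentiableAt (by simp)).hasFDerivAt

variable {V : Set (ParamSpace E)}

theorem contDiffAt_legendre_inverse (hθ : Real.cos θ ≠ 1) (hV : IsOpen V)
    (hQV : ∀ q ∈ D.Q, ((0, q, 0) : ParamSpace E) ∈ V) (hinj : InjOn (D.legendre θ) V)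
    (hq : q ∈ D.Q) :
    ContDiffAt ℝ ∞ (Function.invFunOn (D.legendre θ) V) (0, q, 0) ∧
      Function.invFunOn (D.legendre θ) V (0, q, 0) = (0, q, 0) ∧
      ∀ᶠ z in 𝓝 (0, q, 0), Function.invFunOn (D.legendre θ) V z ∈ V ∧
        D.legendre θ (Function.invFunOn (D.legendre θ) V z) = z := by
  obtain ⟨e, he, -⟩ := exists_equiv_legendre hθ hq
  have h1 := contDiffAt_invFunOn hV hinj (hQV q hq) (n := ∞) (by simp)
    (contDiffAt_legendre (segment_base hq)) he
  rw [legendre_base] at h1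
  refine ⟨h1.1, ?_, h1.2⟩
  have := hinj.leftInvOn_invFunOn (hQV q hq)
  rwa [legendre_base] at this

/-- To first order κ = ((1 − cos θ)J − sin θ)p. The deviation of the reversed step is −κ, so p̄ =
½(J − c)κ, which is exactly (cos θ − sin θ J)p; and κ = −J(p̄ − p) gives the base point. -/
theorem isNearlyPeriodicMap_momentumMap (hθ : Real.cos θ ≠ 1) (hV : IsOpen V)
    (hQV : ∀ q ∈ D.Q, ((0, q, 0) : ParamSpace E) ∈ V) (hinj : InjOn (D.legendre θ) V) :
    IsNearlyPeriodicMap D.Q D.J θ D.XH (D.momentumMap θ V) := by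
  have hs : 1 - Real.cos θ ≠ 0 := sub_ne_zero.2 (Ne.symm hθ)
  refine ⟨D.isOpen_Q, fun q hq => contDiffAt_J hq, D.J_sq, fun q hq => contDiffAt_XH hq,
    fun q hq => ?_, fun q hq => ?_, fun q hq h u w => ?_⟩
  · obtain ⟨h1, h2, -⟩ := contDiffAt_legendre_inverse hθ hV hQV hinj hq
    refine ContDiffAt.comp (g := D.imageMomentum θ) _ ?_ h1
    rw [h2]
    exact contDiffAt_imageMomentum (segment_base hq)
  · obtain ⟨h1, h2, -⟩ := contDiffAt_legendre_inverse hθ hV hQV hinj hq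
    simp [momentumMap, h2, imageMomentum, swapEnds, momentum_base]
  · obtain ⟨h1, h2, h3⟩ := contDiffAt_legendre_inverse hθ hV hQV hinj hq
    obtain ⟨e, he, hes⟩ := exists_equiv_legendre hθ hq
    have d1 : HasFDerivAt (Function.invFunOn (D.legendre θ) V)
        (e.symm : ParamSpace E →L[ℝ] ParamSpace E) (0, q, 0) :=
      HasFDerivAt.of_local_left_inverse h1.continuousAt (by rwa [h2]) (h3.mono fun z hz => hz.2)
    obtain ⟨A, hA, hA'⟩ := hasFDerivAt_momentum (-θ) hq
    have hL : HasFDerivAt (swapEnds (E := E)) ((-ContinuousLinearMap.fst ℝ ℝ (E × E)).prod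
        ((((ContinuousLinearMap.fst ℝ E E).comp (ContinuousLinearMap.snd ℝ ℝ (E × E))) +
          ((ContinuousLinearMap.snd ℝ E E).comp (ContinuousLinearMap.snd ℝ ℝ (E × E)))).prod
          (-((ContinuousLinearMap.snd ℝ E E).comp (ContinuousLinearMap.snd ℝ ℝ (E × E))))))
        (0, q, 0) := hasFDerivAt_fst.neg.prodMk ((((ContinuousLinearMap.fst ℝ E E).comp
        (ContinuousLinearMap.snd ℝ ℝ (E × E))).hasFDerivAt.add (((ContinuousLinearMap.snd ℝ E E).comp
        (ContinuousLinearMap.snd ℝ ℝ (E × E))).hasFDerivAt)).prodMk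
        ((ContinuousLinearMap.snd ℝ E E).comp (ContinuousLinearMap.snd ℝ ℝ (E × E))).hasFDerivAt.neg)
    have hA2 : HasFDerivAt (D.momentum (-θ)) A (swapEnds ((0, q, 0) : ParamSpace E)) := by
      simpa [swapEnds] using hA
    have d2 : HasFDerivAt (D.imageMomentum θ) _ (0, q, 0) :=
      (ContinuousLinearMap.hasFDerivAt (((ContinuousLinearMap.fst ℝ E E).comp
        (ContinuousLinearMap.snd ℝ ℝ (E × E))) + ((ContinuousLinearMap.snd ℝ E E).comp
        (ContinuousLinearMap.snd ℝ ℝ (E × E))))).prodMk (hA2.comp _ hL)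
    rw [← h2] at d2
    have d3 : HasFDerivAt (D.momentumMap θ V) _ (0, q, 0) := d2.comp _ d1
    have hJ := D.J_sq q hq
    rw [d3.fderiv]
    simp only [ContinuousLinearMap.comp_apply, ContinuousLinearEquiv.coe_coe, hes,
      ContinuousLinearMap.prod_apply, add_apply, neg_apply, ContinuousLinearMap.coe_fst',
      ContinuousLinearMap.coe_snd', hA', Real.sin_neg, Real.cos_neg, rot_apply, map_sub, map_add,
      map_smul, hJ, map_neg]
    have hsc := Real.sin_sq_add_cos_sq θ
    ext1
    · dsimp only
      module
    · dsimp only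
      match_scalars <;> field_simp <;> linarith

end MomentumMap

end HamSystem

/-- A function that vanishes to second order on `{ħ = 0}` is `ħ²` times a smooth function. -/
theorem exists_contDiffAt_sq_smul {X V : Type u} [NormedAddCommGroup X] [NormedSpace ℝ X]
    [NormedAddCommGroup V] [NormedSpace ℝ V] [CompleteSpace V] (k : ℝ × X → V) :
    ∃ W : ℝ × X → V, ∀ p : ℝ × X,
      (∀ t ∈ Icc (0 : ℝ) 1, ContDiffAt ℝ ∞ k (t * p.1, p.2)) →
      ContDiffAt ℝ ∞ W p ∧ (k (0, p.2) = 0 → fderiv ℝ k (0, p.2) (1, 0) = 0 →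
        k p = p.1 ^ 2 • W p) := by
  set k' : ℝ × X → V := fun y => fderiv ℝ k y (1, 0) with hk'
  set k'' : ℝ × X → V := fun y => fderiv ℝ k' y (1, 0) with hk''
  -- Taylor's formula in ħ with integral remainder; W is chosen before p, so one function serves all
  -- points.
  refine ⟨fun p => ∫ t in (0 : ℝ)..1, (1 - t) • k'' (t * p.1, p.2), fun p hp => ?_⟩
  have s1 : ∀ t ∈ Icc (0 : ℝ) 1, ContDiffAt ℝ ∞ k' (t * p.1, p.2) := fun t ht =>
    ((hp t ht).fderiv_right (m := ∞) (by simp)).clm_apply contDiffAt_const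
  have s2 : ∀ t ∈ Icc (0 : ℝ) 1, ContDiffAt ℝ ∞ k'' (t * p.1, p.2) := fun t ht =>
    ((s1 t ht).fderiv_right (m := ∞) (by simp)).clm_apply contDiffAt_const
  constructor
  · refine contDiffAt_integral_param
      (f := fun y : (ℝ × X) × ℝ => (1 - y.2) • k'' (y.2 * y.1.1, y.1.2)) fun t ht => ?_
    exact ContDiffAt.smul (contDiffAt_const.sub contDiffAt_snd) (ContDiffAt.comp (g := k'')
      (f := fun y : (ℝ × X) × ℝ => (y.2 * y.1.1, y.1.2)) (p, t) (s2 t ht) (by fun_prop))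
  · intro h0 h1
    have hl : ∀ t : ℝ, HasDerivAt (fun t : ℝ => (t * p.1, p.2)) (p.1 • ((1 : ℝ), (0 : X))) t := by
      intro t
      have := ((hasDerivAt_id t).mul_const p.1).prodMk (hasDerivAt_const t p.2)
      simpa using this
    have d1 : ∀ t ∈ Icc (0 : ℝ) 1, HasDerivAt (fun t : ℝ => k (t * p.1, p.2))
        (p.1 • k' (t * p.1, p.2)) t := fun t ht => by
      have := (((hp t ht).differentiableAt (by simp)).hasFDerivAt).comp_hasDerivAt t (hl t)
      rwa [map_smul] at this
    have d2 : ∀ t ∈ Icc (0 : ℝ) 1, HasDerivAt (fun t : ℝ => k' (t * p.1, p.2))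
        (p.1 • k'' (t * p.1, p.2)) t := fun t ht => by
      have := (((s1 t ht).differentiableAt (by simp)).hasFDerivAt).comp_hasDerivAt t (hl t)
      rwa [map_smul] at this
    have c2 : ContinuousOn (fun t : ℝ => (1 - t) • k'' (t * p.1, p.2)) (Icc 0 1) := fun t ht =>
      (ContinuousAt.smul (continuousAt_const.sub continuousAt_id)
        (ContinuousAt.comp (g := k'') (f := fun t : ℝ => (t * p.1, p.2)) (s2 t ht).continuousAt
          (by fun_prop))).continuousWithinAt
    rw [← intervalIntegral.integral_smul, intervalIntegral.integral_eq_sub_of_hasDerivAt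
      (f := fun t : ℝ => p.1 • (1 - t) • k' (t * p.1, p.2) + k (t * p.1, p.2))]
    · simp [h0, hk', h1]
    · intro t ht
      rw [uIcc_of_le zero_le_one] at ht
      refine (((((hasDerivAt_id t).const_sub 1).smul (d2 t ht)).const_smul p.1).add
        (d1 t ht)).congr_deriv ?_
      simp only [id]
      module
    · exact (c2.const_smul _).intervalIntegrable_of_Icc zero_le_one

/-! ### Existence of the symplectic Lorentz map -/

namespace HamSystem

section LorentzMap

set_option maxSynthPendingDepth 3

variable {E : Type*} [NormedAddCommGroup E] [NormedSpace ℝ E] [FiniteDimensional ℝ E]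
  {D : HamSystem E} {q q' : E} {θ : ℝ} {V : Set (ParamSpace E)}

/-- Reversing the step leaves the remainder unchanged and only flips the sign of κ, so the expansion
of the momentum applies to p̄ too. -/
theorem isBigO_imageMomentum (hq : q ∈ D.Q) :
    (fun y => (D.imageMomentum θ y).2) =O[𝓝 (0, q, 0)] fun y => |y.1| ^ 3 + ‖D.deviation y‖ := by
  have k1 := (isBigO_momentum (-θ) hq).comp_tendsto (tendsto_swapEnds q)
  have t1 : Tendsto (fun y : ParamSpace E => |y.1| + ‖D.deviation y‖) (𝓝 (0, q, 0)) (𝓝 0) := by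
    have : Tendsto (fun y : ParamSpace E => |y.1|) (𝓝 (0, q, 0)) (𝓝 0) := by
      have : Continuous fun y : ParamSpace E => |y.1| := by fun_prop
      exact this.tendsto' _ _ (by simp)
    simpa using this.add (tendsto_deviation hq).norm
  have k2 : D.remainder =O[𝓝 (0, q, 0)] fun y => |y.1| ^ 3 + ‖D.deviation y‖ := by
    refine IsBigO.of_bound 1 ?_
    filter_upwards [t1.eventually (ge_mem_nhds zero_lt_one)] with y hy
    rw [one_mul, Real.norm_of_nonneg (by unfold remainder; positivity),
      Real.norm_of_nonneg (by positivity), remainder]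
    gcongr
    exact mul_le_of_le_one_right (norm_nonneg _) hy
  have k3 : D.deviation =O[𝓝 (0, q, 0)] fun y => |y.1| ^ 3 + ‖D.deviation y‖ := by
    refine IsBigO.of_bound 1 (Eventually.of_forall fun y => ?_)
    rw [one_mul, Real.norm_of_nonneg (by positivity)]
    exact le_add_of_nonneg_left (by positivity)
  have t2 : Tendsto (fun y : ParamSpace E => y.2.1 + y.2.2) (𝓝 (0, q, 0)) (𝓝 q) := by
    have : Continuous fun y : ParamSpace E => y.2.1 + y.2.2 := by fun_prop
    exact this.tendsto' _ _ (by simp)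
  have k4 : (fun y : ParamSpace E => D.J (y.2.1 + y.2.2)) =O[𝓝 (0, q, 0)] fun _ => (1 : ℝ) :=
    (((contDiffAt_J hq).continuousAt.tendsto.comp t2)).isBigO_one ℝ
  have k5 := isBigO_clm_apply k4 k3
  simp only [Function.comp_def, remainder_swapEnds, one_mul] at k1 k5
  refine ((k1.trans k2).add ((k5.add (k3.const_smul_left
    (Real.sin (-θ) / (1 - Real.cos (-θ))))).const_smul_left (1 / 2 : ℝ))).congr_left fun y => ?_
  simp only [deviation_swapEnds, imageMomentum, Pi.smul_apply]
  simp only [swapEnds, map_neg]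
  module

theorem tendsto_legendre_inverse (hθ : Real.cos θ ≠ 1) (hV : IsOpen V)
    (hQV : ∀ q ∈ D.Q, ((0, q, 0) : ParamSpace E) ∈ V) (hinj : InjOn (D.legendre θ) V)
    (hq : q ∈ D.Q) :
    Tendsto (Function.invFunOn (D.legendre θ) V) (𝓝 (0, q, 0)) (𝓝 (0, q, 0)) := by
  obtain ⟨h1, h2, -⟩ := contDiffAt_legendre_inverse hθ hV hQV hinj hq
  simpa only [ContinuousAt, h2] using h1.continuousAt

theorem isBigO_momentumMap_snd (hθ : Real.cos θ ≠ 1) (hV : IsOpen V)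
    (hQV : ∀ q ∈ D.Q, ((0, q, 0) : ParamSpace E) ∈ V) (hinj : InjOn (D.legendre θ) V)
    (hq : q ∈ D.Q) :
    (fun z => (D.momentumMap θ V z).2) =O[𝓝 (0, q, 0)] fun z => |z.1| ^ 3 + ‖z.2.2‖ := by
  obtain ⟨h1, h2, h3⟩ := contDiffAt_legendre_inverse hθ hV hQV hinj hq
  have k1 : (fun y => |y.1| ^ 3 + ‖D.deviation y‖) =O[𝓝 (0, q, 0)]
      fun y => |y.1| ^ 3 + ‖D.momentum θ y‖ := by
    refine IsBigO.add (IsBigO.of_bound 1 (Eventually.of_forall fun y => ?_))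
      (isBigO_deviation θ hq).norm_left
    rw [one_mul, Real.norm_of_nonneg (by positivity), Real.norm_of_nonneg (by positivity)]
    exact le_add_of_nonneg_right (by positivity)
  have k2 := ((isBigO_imageMomentum (θ := θ) hq).trans k1).comp_tendsto
    (tendsto_legendre_inverse hθ hV hQV hinj hq)
  refine k2.congr' EventuallyEq.rfl ?_
  filter_upwards [h3] with z hz
  conv_rhs => rw [← hz.2]
  rfl

theorem isBigO_momentumMap_fst (hθ : Real.cos θ ≠ 1) (hV : IsOpen V)
    (hQV : ∀ q ∈ D.Q, ((0, q, 0) : ParamSpace E) ∈ V) (hinj : InjOn (D.legendre θ) V)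
    (hq : q ∈ D.Q) :
    (fun z => (D.momentumMap θ V z).1 - (z.2.1 + z.1 • D.XH z.2.1 +
      (z.1 ^ 2 / 2) • fderiv ℝ D.XH z.2.1 (D.XH z.2.1))) =O[𝓝 (0, q, 0)]
      fun z => |z.1| ^ 3 + ‖z.2.2‖ := by
  obtain ⟨h1, h2, h3⟩ := contDiffAt_legendre_inverse hθ hV hQV hinj hq
  have k1 : (fun y => |y.1| ^ 3 + ‖D.deviation y‖) =O[𝓝 (0, q, 0)]
      fun y => |y.1| ^ 3 + ‖D.momentum θ y‖ := by
    refine IsBigO.add (IsBigO.of_bound 1 (Eventually.of_forall fun y => ?_))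
      (isBigO_deviation θ hq).norm_left
    rw [one_mul, Real.norm_of_nonneg (by positivity), Real.norm_of_nonneg (by positivity)]
    exact le_add_of_nonneg_right (by positivity)
  have k2 := ((isBigO_displacement_sub hq).trans k1).comp_tendsto
    (tendsto_legendre_inverse hθ hV hQV hinj hq)
  refine k2.congr' ?_ ?_
  · filter_upwards [h3] with z hz
    conv_rhs => enter [2]; rw [← hz.2]
    simp only [Function.comp_apply, momentumMap, imageMomentum, legendre]
    abel
  · filter_upwards [h3] with z hz
    conv_rhs => rw [← hz.2]
    rfl

theorem isOpen_image_legendre (hV : IsOpen V)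
    (hseg : ∀ y ∈ V, segment ℝ y.2.1 (y.2.1 + y.2.2) ⊆ D.Q) (hinj : InjOn (D.legendre θ) V)
    (he : ∀ y ∈ V, ∃ e : ParamSpace E ≃L[ℝ] ParamSpace E,
        HasFDerivAt (D.legendre θ) (e : ParamSpace E →L[ℝ] ParamSpace E) y) :
    IsOpen (D.legendre θ '' V) := by
  rw [isOpen_iff_mem_nhds]
  rintro _ ⟨y, hy, rfl⟩
  obtain ⟨e, he⟩ := he y hy
  filter_upwards [(contDiffAt_invFunOn hV hinj hy (n := ∞) (by simp)
    (contDiffAt_legendre (hseg y hy)) he).2] with z hz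
  exact ⟨_, hz.1, hz.2⟩

theorem contDiffAt_momentumMap (hV : IsOpen V)
    (hseg : ∀ y ∈ V, segment ℝ y.2.1 (y.2.1 + y.2.2) ⊆ D.Q) (hinj : InjOn (D.legendre θ) V)
    (he : ∀ y ∈ V, ∃ e : ParamSpace E ≃L[ℝ] ParamSpace E,
        HasFDerivAt (D.legendre θ) (e : ParamSpace E →L[ℝ] ParamSpace E) y) {z : ParamSpace E}
    (hz : z ∈ D.legendre θ '' V) : ContDiffAt ℝ ∞ (D.momentumMap θ V) z := by
  obtain ⟨y, hy, rfl⟩ := hz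
  obtain ⟨e, he⟩ := he y hy
  refine ContDiffAt.comp (g := D.imageMomentum θ) _ ?_ (contDiffAt_invFunOn hV hinj hy (n := ∞)
    (by simp) (contDiffAt_legendre (hseg y hy)) he).1
  rw [hinj.leftInvOn_invFunOn hy]
  exact contDiffAt_imageMomentum (hseg y hy)

/-- Substitute p = ħ²(v − X_H(q)) into `momentumMap`. The resulting p̄ vanishes to second order in
ħ, so v̄ = X_H(q̄) + p̄/ħ² extends smoothly across ħ = 0. -/
theorem exists_isSymplecticLorentzMap (D : HamSystem E) (hθ : Real.cos θ ≠ 1) :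
    ∃ Ψ : ℝ → E × E → E × E, D.IsSymplecticLorentzMap θ Ψ := by
  have := FiniteDimensional.complete ℝ E
  obtain ⟨V, hV, hQV, hseg, hinj, he⟩ := exists_legendre_domain D hθ
  set Z := D.legendre θ '' V with hZ
  have hZo : IsOpen Z := isOpen_image_legendre hV hseg hinj he
  have hFs : ∀ z ∈ Z, ContDiffAt ℝ ∞ (D.momentumMap θ V) z := fun z hz =>
    contDiffAt_momentumMap hV hseg hinj he hz
  have hF := isNearlyPeriodicMap_momentumMap hθ hV hQV hinj
  set m : ParamSpace E → ParamSpace E := fun p =>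
    (p.1, p.2.1, p.1 ^ 2 • (p.2.2 - D.XH p.2.1)) with hm
  have hms : ∀ p : ParamSpace E, p.2.1 ∈ D.Q → ContDiffAt ℝ ∞ m p := fun p hp => by
    have h1 : ContDiffAt ℝ ∞ (fun p : ParamSpace E => D.XH p.2.1) p :=
      ContDiffAt.comp (g := D.XH) p (contDiffAt_XH hp) contDiffAt_snd.fst
    exact contDiffAt_fst.prodMk (contDiffAt_snd.fst.prodMk
      ((contDiffAt_fst.pow 2).smul (contDiffAt_snd.snd.sub h1)))
  set k : ParamSpace E → E := fun p => (D.momentumMap θ V (m p)).2 with hk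
  obtain ⟨W, hW⟩ := exists_contDiffAt_sq_smul k
  -- The whole segment from ħ = 0 is required in the domain because Taylor's formula in ħ integrates
  -- over it.
  set U' : Set (ParamSpace E) := {p | p.2.1 ∈ D.Q ∧ ∀ t ∈ Icc (0 : ℝ) 1, m (t * p.1, p.2) ∈ Z}
    with hU'
  have hQZ : ∀ q ∈ D.Q, ((0, q, 0) : ParamSpace E) ∈ Z := fun q hq =>
    ⟨_, hQV q hq, legendre_base q⟩
  have hbase : ∀ q ∈ D.Q, ∀ v, ((0 : ℝ), q, v) ∈ interior U' := by
    intro q hq v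
    rw [mem_interior_iff_mem_nhds]
    have h1 : ∀ᶠ p : ParamSpace E in 𝓝 (0, q, v), p.2.1 ∈ D.Q :=
      (continuous_fst.comp continuous_snd).continuousAt.eventually_mem (D.isOpen_Q.mem_nhds hq)
    have h2 : ∀ᶠ p : ParamSpace E in 𝓝 (0, q, v), ∀ t ∈ Icc (0 : ℝ) 1,
        m (t * p.1, p.2) ∈ Z := by
      refine eventually_forall_Icc_of_forall_Icc
        (p := fun x : ParamSpace E × ℝ => m (x.2 * x.1.1, x.1.2) ∈ Z) fun t _ => ?_
      have h3 : ContinuousAt (fun x : ParamSpace E × ℝ => m (x.2 * x.1.1, x.1.2))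
          ((0, q, v), t) :=
        ContinuousAt.comp (g := m) (hms _ hq).continuousAt (by fun_prop)
      refine h3.eventually_mem (hZo.mem_nhds ?_)
      simpa [hm] using hQZ q hq
    filter_upwards [h1, h2] with p hp1 hp2
    exact ⟨hp1, hp2⟩
  have hks : ∀ p ∈ U', ∀ t ∈ Icc (0 : ℝ) 1, ContDiffAt ℝ ∞ k (t * p.1, p.2) := fun p hp t ht =>
    (ContDiffAt.comp (g := D.momentumMap θ V) (t * p.1, p.2) (hFs _ (hp.2 t ht))
      (hms _ hp.1)).snd
  have hmem1 : ∀ p ∈ U', m p ∈ Z := fun p hp => by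
    simpa using hp.2 1 (by norm_num)
  have hk0 : ∀ q ∈ D.Q, ∀ v, k (0, q, v) = 0 := fun q hq v => by
    simp [hk, hm, hF.base q hq]
  -- At ħ = 0 the curve ħ ↦ (ħ, q, ħ²(v − X_H)) has velocity (1, 0, 0), which the fast component of
  -- the linearization kills.
  have hk1 : ∀ q ∈ D.Q, ∀ v, fderiv ℝ k (0, q, v) (1, 0) = 0 := by
    intro q hq v
    have hkd : ContDiffAt ℝ ∞ k (0, q, v) := by
      simpa using hks _ (interior_subset (hbase q hq v)) 0 (by norm_num)
    have l1 : HasDerivAt (fun s : ℝ => ((s, q, v) : ParamSpace E)) (1, 0) 0 :=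
      (hasDerivAt_id (0 : ℝ)).prodMk (hasDerivAt_const _ _)
    have d1 := ((hkd.differentiableAt (by simp)).hasFDerivAt).comp_hasDerivAt (0 : ℝ) l1
    have l2 : HasDerivAt (fun s : ℝ => ((s, q, s ^ 2 • (v - D.XH q)) : ParamSpace E))
        (1, 0, 0) 0 := by
      refine (hasDerivAt_id (0 : ℝ)).prodMk ((hasDerivAt_const _ _).prodMk ?_)
      simpa using (hasDerivAt_pow 2 (0 : ℝ)).smul_const (v - D.XH q)
    have hF0 : HasFDerivAt (D.momentumMap θ V) (fderiv ℝ (D.momentumMap θ V) (0, q, 0))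
        ((0 : ℝ), q, (0 : ℝ) ^ 2 • (v - D.XH q)) := by
      simpa using ((hF.smooth q hq).differentiableAt (by simp)).hasFDerivAt
    have d2 := hF0.snd.comp_hasDerivAt (0 : ℝ) l2
    rw [ContinuousLinearMap.comp_apply, hF.deriv q hq, map_zero] at d2
    exact d1.unique d2
  have hkW : ∀ p ∈ U', k p = p.1 ^ 2 • W p := fun p hp =>
    (hW p (hks p hp)).2 (hk0 _ hp.1 _) (hk1 _ hp.1 _)
  refine ⟨fun ħ z => ((D.momentumMap θ V (m (ħ, z))).1,
    D.XH (D.momentumMap θ V (m (ħ, z))).1 + W (ħ, z)), interior U', isOpen_interior,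
    fun p hp => (interior_subset hp).1, hbase, fun p hp => ?_, fun q hq v => ?_, fun p hp => ?_⟩
  · have hp' := interior_subset hp
    have h1 : ContDiffAt ℝ ∞ (fun p => (D.momentumMap θ V (m p)).1) p :=
      (ContDiffAt.comp (g := D.momentumMap θ V) p (hFs _ (hmem1 p hp')) (hms _ hp'.1)).fst
    have h2 : (D.momentumMap θ V (m p)).1 ∈ D.Q := by
      obtain ⟨y, hy, hym⟩ := hmem1 p hp'
      rw [← hym, momentumMap_legendre hinj hy]
      exact hseg y hy (right_mem_segment ℝ _ _)
    exact (h1.prodMk ((ContDiffAt.comp (g := D.XH) p (contDiffAt_XH h2) h1).add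
      (hW p (hks p hp')).1)).contDiffWithinAt
  · simp [hm, hF.base q hq]
  · have hp' := interior_subset hp
    obtain ⟨y, hy, hym⟩ := hmem1 p hp'
    have hkp := hkW p hp'
    simp only [hk, ← hym, momentumMap_legendre hinj hy] at hkp
    obtain ⟨e1, e2, e3⟩ : y.1 = p.1 ∧ y.2.1 = p.2.1 ∧
        D.momentum θ y = p.1 ^ 2 • (p.2.2 - D.XH p.2.1) := by
      simpa only [legendre, hm, Prod.mk.injEq] using hym
    have e4 : D.momentumMap θ V (m (p.1, p.2)) = D.imageMomentum θ y := by
      rw [← momentumMap_legendre hinj hy, hym]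
    rw [lorentzRel_iff]
    simp only [e4]
    refine ⟨?_, ?_, ?_⟩
    · rw [← e2]
      exact hseg y hy
    · rw [← e3, ← e1, ← e2]
      simp [imageMomentum]
    · rw [add_sub_cancel_left, ← hkp, ← e1, ← e2]
      simp [imageMomentum, swapEnds]

end LorentzMap

end HamSystem

/-! ### Loops and their action -/

section Loop

variable {E : Type*} [NormedAddCommGroup E] [NormedSpace ℝ E]

/-- The orbit of `(ħ, q, w)` under the rotations. -/
noncomputable def loop (J : E → E →L[ℝ] E) (y : ParamSpace E) (t : ℝ) : ParamSpace E :=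
  (y.1, y.2.1, rot J (2 * Real.pi * t) y.2.1 y.2.2)

/-- The velocity of `loop`. -/
noncomputable def loopVelocity (J : E → E →L[ℝ] E) (y : ParamSpace E) (t : ℝ) : ParamSpace E :=
  (0, 0, -(2 * Real.pi) • J y.2.1 (loop J y t).2.2)

variable {J : E → E →L[ℝ] E} {q : E}

theorem loop_apply_zero (y : ParamSpace E) : loop J y 0 = y := by simp [loop]

theorem loop_apply_one (y : ParamSpace E) : loop J y 1 = y := by simp [loop, rot_apply]

theorem loop_eq_add {y : ParamSpace E} (t : ℝ) : loop J y t = (y.1, y.2.1, 0) +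
    (Real.cos (2 * Real.pi * t) • ((0, 0, y.2.2) : ParamSpace E) -
      Real.sin (2 * Real.pi * t) • (0, 0, J y.2.1 y.2.2)) := by
  simp [loop, rot_apply]

theorem hasDerivAt_loop {y : ParamSpace E} (hJ : ∀ v, J y.2.1 (J y.2.1 v) = -v) (t : ℝ) :
    HasDerivAt (loop J y) (loopVelocity J y t) t := by
  have h0 : HasDerivAt (fun t : ℝ => 2 * Real.pi * t) (2 * Real.pi) t := by
    simpa using (hasDerivAt_id t).const_mul (2 * Real.pi)
  have h1 := ((h0.cos.smul_const ((0, 0, y.2.2) : ParamSpace E)).sub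
    (h0.sin.smul_const ((0, 0, J y.2.1 y.2.2) : ParamSpace E))).const_add (y.1, y.2.1, 0)
  refine (h1.congr_deriv ?_).congr_of_eventuallyEq
    (Eventually.of_forall fun t => loop_eq_add t)
  ext
  · simp [loopVelocity]
  · simp [loopVelocity]
  · simp only [loopVelocity, loop, rot_apply, map_sub, map_smul, hJ, Prod.snd_sub, Prod.smul_snd]
    module

theorem continuous_loop (y : ParamSpace E) : Continuous (loop J y) := by
  have : Continuous fun t => (y.1, y.2.1, 0) +
    (Real.cos (2 * Real.pi * t) • ((0, 0, y.2.2) : ParamSpace E) -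
      Real.sin (2 * Real.pi * t) • (0, 0, J y.2.1 y.2.2)) := by fun_prop
  exact this.congr fun t => (loop_eq_add t).symm

theorem continuous_loopVelocity (y : ParamSpace E) : Continuous (loopVelocity J y) := by
  have h : Continuous fun t => (loop J y t).2.2 := (continuous_loop (J := J) y).snd.snd
  exact continuous_const.prodMk (continuous_const.prodMk
    (((J y.2.1).continuous.comp h).const_smul (-(2 * Real.pi))))

theorem norm_rot_le (J : E → E →L[ℝ] E) (φ : ℝ) (q w : E) :
    ‖rot J φ q w‖ ≤ (1 + ‖J q‖) * ‖w‖ := by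
  rw [rot_apply]
  refine (norm_sub_le _ _).trans ?_
  rw [norm_smul, norm_smul, add_mul, one_mul]
  refine add_le_add (mul_le_of_le_one_left (norm_nonneg _) (Real.abs_cos_le_one _)) ?_
  exact (mul_le_of_le_one_left (norm_nonneg _) (Real.abs_sin_le_one _)).trans
    ((J q).le_opNorm w)

theorem eventually_norm_le_of_continuousAt {V : Type*} [NormedAddCommGroup V] {Y : Type*}
    [TopologicalSpace Y] {f : Y → V} {a : Y} (hf : ContinuousAt f a) :
    ∃ C > 0, ∀ᶠ y in 𝓝 a, ‖f y‖ ≤ C := by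
  refine ⟨‖f a‖ + 1, by positivity, ?_⟩
  exact (hf.norm.eventually (gt_mem_nhds (lt_add_one _))).mono fun y hy => le_of_lt hy

theorem exists_norm_loop_le (hJ : ContinuousAt J q) :
    ∃ C > 0, ∀ᶠ y : ParamSpace E in 𝓝 (0, q, 0), ∀ t,
      ‖(loop J y t).2.2‖ ≤ C * ‖y.2.2‖ ∧ ‖fastProj E (loop J y t)‖ ≤ C * ‖fastProj E y‖ ∧
      ‖loopVelocity J y t‖ ≤ C * ‖y.2.2‖ := by
  have hJ' : ContinuousAt (fun y : ParamSpace E => J y.2.1) (0, q, 0) :=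
    ContinuousAt.comp (g := J) (f := fun y : ParamSpace E => y.2.1) (x := (0, q, 0)) hJ
      (by fun_prop)
  obtain ⟨B, hB, h⟩ := eventually_norm_le_of_continuousAt hJ'
  -- One factor 1 + B bounds the rotation; the rest bounds the velocity 2π J w.
  refine ⟨2 * Real.pi * (1 + B) * (1 + B), by positivity, ?_⟩
  filter_upwards [h] with y hy t
  have h1 : ‖(loop J y t).2.2‖ ≤ (1 + B) * ‖y.2.2‖ :=
    (norm_rot_le J _ _ _).trans (by gcongr)
  have h2 : (1 + B) ≤ 2 * Real.pi * (1 + B) * (1 + B) := by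
    have : 1 ≤ 2 * Real.pi * (1 + B) := by nlinarith [Real.pi_gt_three]
    nlinarith
  have h3 : 1 ≤ 2 * Real.pi * (1 + B) * (1 + B) := by linarith
  have h4 : (1 + B) * ‖y.2.2‖ ≤ 2 * Real.pi * (1 + B) * (1 + B) * ‖y.2.2‖ := by gcongr
  refine ⟨h1.trans h4, ?_, ?_⟩
  · have e : ‖fastProj E (loop J y t)‖ = max |y.1| ‖(loop J y t).2.2‖ := by
      simp [Prod.norm_def, loop]
    rw [e]
    refine max_le ?_ ?_
    · refine (abs_fst_le_norm_fastProj y).trans ?_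
      exact le_mul_of_one_le_left (norm_nonneg _) h3
    · exact (h1.trans h4).trans (by gcongr; exact norm_snd_snd_le_norm_fastProj y)
  · have e : ‖loopVelocity J y t‖ = 2 * Real.pi * ‖J y.2.1 (loop J y t).2.2‖ := by
      simp [loopVelocity, Prod.norm_def, norm_smul, abs_of_pos Real.pi_pos]
      positivity
    rw [e]
    calc 2 * Real.pi * ‖J y.2.1 (loop J y t).2.2‖
        ≤ 2 * Real.pi * (B * ((1 + B) * ‖y.2.2‖)) := by
          gcongr
          exact ((J y.2.1).le_opNorm _).trans (by gcongr)
      _ ≤ 2 * Real.pi * ((1 + B) * ((1 + B) * ‖y.2.2‖)) := by gcongr; linarith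
      _ = _ := by ring

theorem exists_norm_loop_sub_le (hJ : ContDiffAt ℝ ∞ J q) :
    ∃ C > 0, ∀ᶠ p : ParamSpace E × ParamSpace E in 𝓝 ((0, q, 0), (0, q, 0)), ∀ t,
      ‖loop J p.1 t - loop J p.2 t‖ ≤ C * ‖p.1 - p.2‖ := by
  have h1 : ContDiffAt ℝ ∞ (fun y : ParamSpace E => J y.2.1 y.2.2) (0, q, 0) :=
    (ContDiffAt.comp (g := J) ((0, q, 0) : ParamSpace E) hJ contDiffAt_snd.fst).clm_apply
      contDiffAt_snd.snd
  obtain ⟨C, hC, h⟩ := (h1.isBigO_sub_nhds (by simp)).exists_pos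
  refine ⟨1 + C, by positivity, ?_⟩
  filter_upwards [h.bound] with p hp t
  have e : loop J p.1 t - loop J p.2 t = (p.1.1 - p.2.1, p.1.2.1 - p.2.2.1,
      Real.cos (2 * Real.pi * t) • (p.1.2.2 - p.2.2.2) -
        Real.sin (2 * Real.pi * t) • (J p.1.2.1 p.1.2.2 - J p.2.2.1 p.2.2.2)) := by
    ext
    · simp [loop]
    · simp [loop]
    · simp only [loop, rot_apply, Prod.snd_sub]
      module
  have a1 : ‖p.1.1 - p.2.1‖ ≤ ‖p.1 - p.2‖ := norm_fst_le (p.1 - p.2)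
  have a2 : ‖p.1.2.1 - p.2.2.1‖ ≤ ‖p.1 - p.2‖ :=
    (norm_fst_le (p.1 - p.2).2).trans (norm_snd_le (p.1 - p.2))
  have a3 : ‖p.1.2.2 - p.2.2.2‖ ≤ ‖p.1 - p.2‖ :=
    (norm_snd_le (p.1 - p.2).2).trans (norm_snd_le (p.1 - p.2))
  have h0 := norm_nonneg (p.1 - p.2)
  have hle : ‖p.1 - p.2‖ ≤ (1 + C) * ‖p.1 - p.2‖ := by nlinarith
  rw [e, Prod.norm_def, Prod.norm_def]
  refine max_le (a1.trans hle) (max_le (a2.trans hle) ?_)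
  refine (norm_sub_le _ _).trans ?_
  rw [norm_smul, norm_smul, add_mul, one_mul]
  exact add_le_add ((mul_le_of_le_one_left (norm_nonneg _) (Real.abs_cos_le_one _)).trans a3)
    ((mul_le_of_le_one_left (norm_nonneg _) (Real.abs_sin_le_one _)).trans hp)

theorem eventually_loop (hJ : ContinuousAt J q) {p : ParamSpace E → Prop}
    (hp : ∀ᶠ y in 𝓝 (0, q, 0), p y) :
    ∀ᶠ y in 𝓝 (0, q, 0), ∀ t ∈ Icc (0 : ℝ) 1, p (loop J y t) := by
  refine eventually_forall_Icc_of_forall_Icc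
    (p := fun x : ParamSpace E × ℝ => p (loop J x.1 x.2)) fun t _ => ?_
  have h1 : ContinuousAt (fun x : ParamSpace E × ℝ => J x.1.2.1) ((0, q, 0), t) :=
    ContinuousAt.comp (g := J) (f := fun x : ParamSpace E × ℝ => x.1.2.1)
      (x := ((0, q, 0), t)) hJ (by fun_prop)
  have h2 : ContinuousAt (fun x : ParamSpace E × ℝ => loop J x.1 x.2) ((0, q, 0), t) := by
    simp only [loop, rot_apply]
    have : ContinuousAt (fun x : ParamSpace E × ℝ => J x.1.2.1 x.1.2.2) ((0, q, 0), t) :=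
      h1.clm_apply (by fun_prop)
    fun_prop
  have h3 : Tendsto (fun x : ParamSpace E × ℝ => loop J x.1 x.2) (𝓝 ((0, q, 0), t))
      (𝓝 (0, q, 0)) := by
    simpa [ContinuousAt, loop] using h2
  exact h3.eventually hp

/-- Derivatives of a function along the loops. -/
theorem exists_hasDerivAt_comp_loop {V : Type*} [NormedAddCommGroup V] [NormedSpace ℝ V]
    {f : ParamSpace E → V} (hf : ContDiffAt ℝ ∞ f (0, q, 0)) (hJ : ContinuousAt J q)
    (hJ2 : ∀ᶠ q' in 𝓝 q, ∀ v, J q' (J q' v) = -v) :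
    ∃ C > 0, ∀ᶠ y in 𝓝 (0, q, 0), ∀ t ∈ Icc (0 : ℝ) 1,
      HasDerivAt (fun t => f (loop J y t)) (fderiv ℝ f (loop J y t) (loopVelocity J y t)) t ∧
      ContinuousAt (fun t => fderiv ℝ f (loop J y t) (loopVelocity J y t)) t ∧
      ‖fderiv ℝ f (loop J y t) (loopVelocity J y t)‖ ≤ C * ‖y.2.2‖ := by
  obtain ⟨C₁, hC₁, h1⟩ := exists_norm_loop_le hJ
  obtain ⟨C₂, hC₂, h2⟩ := eventually_norm_le_of_continuousAt
    (hf.fderiv_right (m := 0) (by simp)).continuousAt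
  have h3 : ∀ᶠ y in 𝓝 ((0, q, 0) : ParamSpace E), ContDiffAt ℝ 1 f y :=
    (hf.of_le (by simp)).eventually (by simp)
  have hq : Tendsto (fun y : ParamSpace E => y.2.1) (𝓝 (0, q, 0)) (𝓝 q) :=
    (continuous_fst.comp continuous_snd).tendsto' _ _ rfl
  refine ⟨C₂ * C₁, by positivity, ?_⟩
  filter_upwards [h1, eventually_loop hJ (h2.and h3), hq.eventually hJ2] with y g1 g2 g3 t ht
  have hd := (g2 t ht).2
  refine ⟨((hd.differentiableAt (by simp)).hasFDerivAt).comp_hasDerivAt t (hasDerivAt_loop g3 t),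
    ?_, ?_⟩
  · exact (ContinuousAt.comp (g := fderiv ℝ f) (f := loop J y)
      (hd.fderiv_right (m := 0) (by simp)).continuousAt (continuous_loop y).continuousAt).clm_apply
      (continuous_loopVelocity y).continuousAt
  · refine (ContinuousLinearMap.le_opNorm _ _).trans ?_
    rw [mul_assoc]
    exact mul_le_mul (g2 t ht).1 (g1 t).2.2 (norm_nonneg _) hC₂.le

end Loop

/-! ### Comparison of line integrals over closed curves -/

section IntegrationByParts

variable {E : Type*} [NormedAddCommGroup E] [NormedSpace ℝ E]

/-- Two closed curves that are close to each other have close line integrals. -/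
theorem abs_integral_sub_integral_le {α β β' : ℝ → E →L[ℝ] ℝ} {x x' z z' : ℝ → E} {M ε : ℝ}
    (hα : ContinuousOn α (Icc 0 1)) (hβ : ∀ t ∈ Icc (0 : ℝ) 1, HasDerivAt β (β' t) t)
    (hβ' : ContinuousOn β' (Icc 0 1)) (hx : ∀ t ∈ Icc (0 : ℝ) 1, HasDerivAt x (x' t) t)
    (hx' : ContinuousOn x' (Icc 0 1)) (hz : ∀ t ∈ Icc (0 : ℝ) 1, HasDerivAt z (z' t) t)
    (hz' : ContinuousOn z' (Icc 0 1)) (cβ : β 0 = β 1) (cx : x 0 = x 1) (cz : z 0 = z 1)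
    (hαβ : ∀ t ∈ Icc (0 : ℝ) 1, ‖α t - β t‖ ≤ ε) (hxz : ∀ t ∈ Icc (0 : ℝ) 1, ‖x t - z t‖ ≤ ε)
    (bx : ∀ t ∈ Icc (0 : ℝ) 1, ‖x' t‖ ≤ M) (bβ : ∀ t ∈ Icc (0 : ℝ) 1, ‖β' t‖ ≤ M) (hM : 0 ≤ M) :
    |(∫ t in (0 : ℝ)..1, α t (x' t)) - ∫ t in (0 : ℝ)..1, β t (z' t)| ≤ 2 * M * ε := by
  have hβc : ContinuousOn β (Icc 0 1) := fun t ht => (hβ t ht).continuousAt.continuousWithinAt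
  have hxc : ContinuousOn x (Icc 0 1) := fun t ht => (hx t ht).continuousAt.continuousWithinAt
  have hzc : ContinuousOn z (Icc 0 1) := fun t ht => (hz t ht).continuousAt.continuousWithinAt
  have c1 : ContinuousOn (fun t => (α t - β t) (x' t) - β' t (x t - z t)) (Icc 0 1) :=
    ((hα.sub hβc).clm_apply hx').sub (hβ'.clm_apply (hxc.sub hzc))
  have c2 : ContinuousOn (fun t => β' t (x t - z t) + β t (x' t - z' t)) (Icc 0 1) :=
    (hβ'.clm_apply (hxc.sub hzc)).add (hβc.clm_apply (hx'.sub hz'))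
  -- The integrand is the derivative of β(x − z), which is periodic. Integrating by parts thus
  -- removes the difference of the velocities, and uniform closeness of the curves themselves
  -- suffices.
  have h1 : ∫ t in (0 : ℝ)..1, (β' t (x t - z t) + β t (x' t - z' t)) = 0 := by
    rw [intervalIntegral.integral_eq_sub_of_hasDerivAt (f := fun t => β t (x t - z t))]
    · rw [cβ, cx, cz, sub_self]
    · intro t ht
      rw [uIcc_of_le zero_le_one] at ht
      exact (hβ t ht).clm_apply ((hx t ht).sub (hz t ht))
    · exact c2.intervalIntegrable_of_Icc zero_le_one
  have h2 : (∫ t in (0 : ℝ)..1, α t (x' t)) - ∫ t in (0 : ℝ)..1, β t (z' t) =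
      ∫ t in (0 : ℝ)..1, ((α t - β t) (x' t) - β' t (x t - z t)) := by
    have c3 := (hα.clm_apply hx').intervalIntegrable_of_Icc (μ := MeasureTheory.volume) zero_le_one
    have c4 := (hβc.clm_apply hz').intervalIntegrable_of_Icc (μ := MeasureTheory.volume) zero_le_one
    have e : ∀ t, (α t - β t) (x' t) - β' t (x t - z t) =
        (α t (x' t) - β t (z' t)) - (β' t (x t - z t) + β t (x' t - z' t)) := fun t => by
      simp only [sub_apply, map_sub]
      ring
    simp only [e]
    rw [intervalIntegral.integral_sub (c3.sub c4) (c2.intervalIntegrable_of_Icc zero_le_one),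
      intervalIntegral.integral_sub c3 c4, h1, sub_zero]
  rw [h2, ← Real.norm_eq_abs]
  refine (intervalIntegral.norm_integral_le_of_norm_le_const (C := 2 * M * ε)
    fun t ht => ?_).trans (by simp)
  rw [uIoc_of_le zero_le_one] at ht
  have ht' : t ∈ Icc (0 : ℝ) 1 := ⟨ht.1.le, ht.2⟩
  refine (norm_sub_le _ _).trans ?_
  have e1 : ‖(α t - β t) (x' t)‖ ≤ ε * M := (ContinuousLinearMap.le_opNorm _ _).trans
    (mul_le_mul (hαβ t ht') (bx t ht') (norm_nonneg _) ((norm_nonneg _).trans (hαβ t ht')))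
  have e2 : ‖β' t (x t - z t)‖ ≤ M * ε := (ContinuousLinearMap.le_opNorm _ _).trans
    (mul_le_mul (bβ t ht') (hxz t ht') (norm_nonneg _) hM)
  linarith

end IntegrationByParts

/-! ### Exact invariance of loop integrals -/

namespace HamSystem

section Invariance

set_option maxSynthPendingDepth 3

variable {E : Type*} [NormedAddCommGroup E] [NormedSpace ℝ E] (D : HamSystem E)

/-- The one-form `ϑ_q + ħ² g_q(v, ·)`, at the point `(ħ, q, p)` with `p = ħ² (v - X_H(q))`. -/
noncomputable def liouville (z : ParamSpace E) : E →L[ℝ] ℝ :=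
  D.ϑ z.2.1 + D.metric z.2.1 (z.1 ^ 2 • D.XH z.2.1 + z.2.2)

/-- The integral of the Liouville form along the image of `loop D.J y` under `f`. -/
noncomputable def action (f : ParamSpace E → E × E) (y : ParamSpace E) : ℝ :=
  ∫ t in (0 : ℝ)..1, D.liouville (y.1, f (loop D.J y t))
    (fderiv ℝ f (loop D.J y t) (loopVelocity D.J y t)).1

variable {D} {q : E} {θ : ℝ} {V : Set (ParamSpace E)} {Γ P : ParamSpace E → E × E} {j : ℕ}

theorem exists_hasDerivAt_comp_loop (hq : q ∈ D.Q) (hJ : ContinuousAt D.J q) {W : Type*} [NormedAddCommGroup W]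
    [NormedSpace ℝ W] {f : ParamSpace E → W} (hf : ContDiffAt ℝ ∞ f (0, q, 0)) :
    ∃ C > 0, ∀ᶠ y in 𝓝 (0, q, 0), ∀ t ∈ Icc (0 : ℝ) 1,
      HasDerivAt (fun t => f (loop D.J y t)) (fderiv ℝ f (loop D.J y t) (loopVelocity D.J y t)) t ∧
      ContinuousAt (fun t => fderiv ℝ f (loop D.J y t) (loopVelocity D.J y t)) t ∧
      ‖fderiv ℝ f (loop D.J y t) (loopVelocity D.J y t)‖ ≤ C * ‖y.2.2‖ :=
  _root_.exists_hasDerivAt_comp_loop hf hJ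
    ((D.isOpen_Q.eventually_mem hq).mono fun q' hq' => D.J_sq q' hq')

theorem intervalIntegrable_clm_apply_fst {β : ℝ → E →L[ℝ] ℝ} {x : ℝ → E × E}
    (hβ : ∀ t ∈ Icc (0 : ℝ) 1, ContinuousAt β t) (hx : ∀ t ∈ Icc (0 : ℝ) 1, ContinuousAt x t) :
    IntervalIntegrable (fun t => β t (x t).1) MeasureTheory.volume 0 1 :=
  ContinuousOn.intervalIntegrable_of_Icc zero_le_one fun t ht =>
    ((hβ t ht).clm_apply (hx t ht).fst).continuousWithinAt

theorem hasDerivAt_fst_comp {x : ℝ → E × E} {x' : E × E} {t : ℝ} (h : HasDerivAt x x' t) :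
    HasDerivAt (fun t => (x t).1) x'.1 t :=
  (ContinuousLinearMap.fst ℝ E E).hasFDerivAt.comp_hasDerivAt t h

variable [FiniteDimensional ℝ E]

theorem contDiffAt_liouville {z : ParamSpace E} (hz : z.2.1 ∈ D.Q) :
    ContDiffAt ℝ ∞ D.liouville z := by
  have h : ContDiffAt ℝ ∞ (fun z : ParamSpace E => z.2.1) z := contDiffAt_snd.fst
  refine (ContDiffAt.comp (g := D.ϑ) z (contDiffAt_ϑ hz) h).add
    ((ContDiffAt.comp (g := D.metric) z (contDiffAt_metric hz) h).clm_apply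
      (((contDiffAt_fst.pow 2).smul
        (ContDiffAt.comp (g := D.XH) z (contDiffAt_XH hz) h)).add contDiffAt_snd.snd))

theorem fderiv_liouville_apply (hq : q ∈ D.Q) (h : ℝ) (u p : E) :
    fderiv ℝ D.liouville (0, q, 0) (h, u, p) = fderiv ℝ D.ϑ q u + D.metric q p := by
  have h1 : HasFDerivAt (fun z : ParamSpace E => z.2.1)
      ((ContinuousLinearMap.fst ℝ E E).comp (ContinuousLinearMap.snd ℝ ℝ (E × E)))
      ((0, q, 0) : ParamSpace E) :=
    ((ContinuousLinearMap.fst ℝ E E).comp (ContinuousLinearMap.snd ℝ ℝ (E × E))).hasFDerivAt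
  have h2 : HasFDerivAt (fun z : ParamSpace E => z.2.2)
      ((ContinuousLinearMap.snd ℝ E E).comp (ContinuousLinearMap.snd ℝ ℝ (E × E)))
      ((0, q, 0) : ParamSpace E) :=
    ((ContinuousLinearMap.snd ℝ E E).comp (ContinuousLinearMap.snd ℝ ℝ (E × E))).hasFDerivAt
  have h0 : HasFDerivAt (fun z : ParamSpace E => z.1) (ContinuousLinearMap.fst ℝ ℝ (E × E))
      ((0, q, 0) : ParamSpace E) := hasFDerivAt_fst
  have h3 := h0.pow 2
  have d1 := (contDiffAt_ϑ hq).differentiableAt (by simp)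
  have d2 := (contDiffAt_metric hq).differentiableAt (by simp)
  have d3 := (contDiffAt_XH hq).differentiableAt (by simp)
  have k1 : HasFDerivAt (fun z : ParamSpace E => D.ϑ z.2.1) _ ((0, q, 0) : ParamSpace E) :=
    HasFDerivAt.comp (g := D.ϑ) ((0, q, 0) : ParamSpace E) d1.hasFDerivAt h1
  have k2 : HasFDerivAt (fun z : ParamSpace E => D.metric z.2.1) _ ((0, q, 0) : ParamSpace E) :=
    HasFDerivAt.comp (g := D.metric) ((0, q, 0) : ParamSpace E) d2.hasFDerivAt h1
  have k3 : HasFDerivAt (fun z : ParamSpace E => D.XH z.2.1) _ ((0, q, 0) : ParamSpace E) :=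
    HasFDerivAt.comp (g := D.XH) ((0, q, 0) : ParamSpace E) d3.hasFDerivAt h1
  have k4 : HasFDerivAt D.liouville _ ((0, q, 0) : ParamSpace E) :=
    k1.add (k2.clm_apply ((h3.smul k3).add h2))
  rw [k4.fderiv]
  simp

/-- The Lorentz map preserves the integrals of the Liouville form along closed curves. -/
theorem integral_liouville_eq {ħ : ℝ} {x x' dx dx' : ℝ → E}
    (hx : ∀ t ∈ Icc (0 : ℝ) 1, HasDerivAt x (dx t) t)
    (hx' : ∀ t ∈ Icc (0 : ℝ) 1, HasDerivAt x' (dx' t) t) (cx : x 0 = x 1) (cx' : x' 0 = x' 1)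
    (hQ : ∀ t ∈ Icc (0 : ℝ) 1, segment ℝ (x t) (x' t) ⊆ D.Q)
    (hi : IntervalIntegrable (fun t => D.liouville
      (ħ, x t, D.momentum θ (ħ, x t, x' t - x t)) (dx t)) MeasureTheory.volume 0 1)
    (hi' : IntervalIntegrable (fun t => D.liouville
      (ħ, x' t, D.momentum (-θ) (-ħ, x' t, x t - x' t)) (dx' t)) MeasureTheory.volume 0 1) :
    ∫ t in (0 : ℝ)..1, D.liouville (ħ, x' t, D.momentum (-θ) (-ħ, x' t, x t - x' t)) (dx' t) =
      ∫ t in (0 : ℝ)..1, D.liouville (ħ, x t, D.momentum θ (ħ, x t, x' t - x t)) (dx t) := by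
  -- The difference of the integrands is the derivative of S(x, x') along the pair of closed curves.
  rw [← sub_eq_zero, ← intervalIntegral.integral_sub hi' hi,
    intervalIntegral.integral_eq_sub_of_hasDerivAt (f := fun t => D.S θ ħ (x t) (x' t)) _
      (hi'.sub hi), cx, cx', sub_self]
  intro t ht
  rw [uIcc_of_le zero_le_one] at ht
  refine ((hasFDerivAt_S_pair θ ħ (hQ t ht)).comp_hasDerivAt t
    ((hx t ht).prodMk (hx' t ht))).congr_deriv ?_
  simp only [liouville, ContinuousLinearMap.coprod_apply, _root_.sub_apply, _root_.neg_apply,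
    _root_.add_apply]
  ring

theorem contDiffAt_liouville_comp (hq : q ∈ D.Q) {f : ParamSpace E → E × E}
    (hf : ContDiffAt ℝ ∞ f (0, q, 0)) (hf0 : f (0, q, 0) = (q, 0)) :
    ContDiffAt ℝ ∞ (fun y => D.liouville (y.1, f y)) (0, q, 0) :=
  ContDiffAt.comp (g := D.liouville) (f := fun y : ParamSpace E => (y.1, f y))
    ((0, q, 0) : ParamSpace E) (contDiffAt_liouville (by simpa [hf0] using hq))
    (contDiffAt_fst.prodMk hf)

/-- An equality, not an estimate: near the base point the whole loop lies in the domain of the map,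
where both implicit relations hold. -/
theorem eventually_action_momentumMap (hθ : Real.cos θ ≠ 1) (hV : IsOpen V)
    (hQV : ∀ q ∈ D.Q, ((0, q, 0) : ParamSpace E) ∈ V)
    (hseg : ∀ y ∈ V, segment ℝ y.2.1 (y.2.1 + y.2.2) ⊆ D.Q) (hinj : InjOn (D.legendre θ) V)
    (he : ∀ y ∈ V, ∃ e : ParamSpace E ≃L[ℝ] ParamSpace E,
        HasFDerivAt (D.legendre θ) (e : ParamSpace E →L[ℝ] ParamSpace E) y) (hq : q ∈ D.Q)
    (hΓ : ContDiffAt ℝ ∞ Γ (0, q, 0)) (hΓ0 : Γ (0, q, 0) = (q, 0)) :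
    ∀ᶠ y in 𝓝 (0, q, 0), D.action (fun y => D.momentumMap θ V (y.1, Γ y)) y = D.action Γ y := by
  have hJ := (contDiffAt_J (D := D) hq).continuousAt
  have hF := isNearlyPeriodicMap_momentumMap hθ hV hQV hinj
  have hΓ' : ContDiffAt ℝ ∞ (fun y : ParamSpace E => (y.1, Γ y)) (0, q, 0) :=
    contDiffAt_fst.prodMk hΓ
  have hG : ContDiffAt ℝ ∞ (fun y => D.momentumMap θ V (y.1, Γ y)) (0, q, 0) :=
    ContDiffAt.comp (g := D.momentumMap θ V) ((0, q, 0) : ParamSpace E)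
      (by simpa [hΓ0] using hF.smooth q hq) hΓ'
  have hG0 : D.momentumMap θ V (0, Γ (0, q, 0)) = (q, 0) := by rw [hΓ0, hF.base q hq]
  have hmem : ∀ᶠ y : ParamSpace E in 𝓝 (0, q, 0), (y.1, Γ y) ∈ D.legendre θ '' V := by
    refine hΓ'.continuousAt.eventually_mem ((isOpen_image_legendre hV hseg hinj he).mem_nhds ?_)
    rw [hΓ0]
    exact ⟨(0, q, 0), hQV q hq, legendre_base q⟩
  obtain ⟨_, _, a1⟩ := exists_hasDerivAt_comp_loop hq hJ hΓ
  obtain ⟨_, _, a2⟩ := exists_hasDerivAt_comp_loop hq hJ hG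
  obtain ⟨_, _, a3⟩ := exists_hasDerivAt_comp_loop hq hJ (contDiffAt_liouville_comp hq hΓ hΓ0)
  obtain ⟨_, _, a4⟩ := exists_hasDerivAt_comp_loop hq hJ (contDiffAt_liouville_comp hq hG hG0)
  filter_upwards [a1, a2, a3, a4, eventually_loop hJ hmem]
    with y b1 b2 b3 b4 b5
  set G : ParamSpace E → E × E := fun y => D.momentumMap θ V (y.1, Γ y)
  have key : ∀ t ∈ Icc (0 : ℝ) 1,
      segment ℝ (Γ (loop D.J y t)).1 (G (loop D.J y t)).1 ⊆ D.Q ∧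
      (Γ (loop D.J y t)) = ((Γ (loop D.J y t)).1, D.momentum θ
        (y.1, (Γ (loop D.J y t)).1, (G (loop D.J y t)).1 - (Γ (loop D.J y t)).1)) ∧
      (G (loop D.J y t)) = ((G (loop D.J y t)).1, D.momentum (-θ)
        (-y.1, (G (loop D.J y t)).1, (Γ (loop D.J y t)).1 - (G (loop D.J y t)).1)) := by
    intro t ht
    obtain ⟨ζ, hζ, hζe⟩ := b5 t ht
    have e1 : G (loop D.J y t) = D.imageMomentum θ ζ := by
      rw [← momentumMap_legendre hinj hζ, hζe]
    have e2 : ζ.1 = y.1 := by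
      simpa [legendre, loop] using congrArg (fun z : ParamSpace E => z.1) hζe
    have e3 : Γ (loop D.J y t) = (ζ.2.1, D.momentum θ ζ) := (congrArg (fun z : ParamSpace E => z.2) hζe).symm
    rw [e1, e3]
    have e4 : ζ.2.1 + ζ.2.2 - ζ.2.1 = ζ.2.2 := by abel
    have e5 : ζ.2.1 - (ζ.2.1 + ζ.2.2) = -ζ.2.2 := by abel
    refine ⟨hseg ζ hζ, ?_, ?_⟩
    · simp only [imageMomentum, e4, ← e2]
    · simp only [imageMomentum, e5, ← e2, swapEnds]
  have i1 := intervalIntegrable_clm_apply_fst (fun t ht => (b3 t ht).1.continuousAt)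
    fun t ht => (b1 t ht).2.1
  have i2 := intervalIntegrable_clm_apply_fst (fun t ht => (b4 t ht).1.continuousAt)
    fun t ht => (b2 t ht).2.1
  have c1 : EqOn (fun t => D.liouville (y.1, (Γ (loop D.J y t)).1, D.momentum θ (y.1,
        (Γ (loop D.J y t)).1, (G (loop D.J y t)).1 - (Γ (loop D.J y t)).1))
      (fderiv ℝ Γ (loop D.J y t) (loopVelocity D.J y t)).1)
      (fun t => D.liouville (y.1, Γ (loop D.J y t))
        (fderiv ℝ Γ (loop D.J y t) (loopVelocity D.J y t)).1) (Icc 0 1) := fun t ht => by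
    simp only [← (key t ht).2.1]
  have c2 : EqOn (fun t => D.liouville (y.1, (G (loop D.J y t)).1, D.momentum (-θ) (-y.1,
        (G (loop D.J y t)).1, (Γ (loop D.J y t)).1 - (G (loop D.J y t)).1))
      (fderiv ℝ G (loop D.J y t) (loopVelocity D.J y t)).1)
      (fun t => D.liouville (y.1, G (loop D.J y t))
        (fderiv ℝ G (loop D.J y t) (loopVelocity D.J y t)).1) (Icc 0 1) := fun t ht => by
    simp only [← (key t ht).2.2]
  rw [← uIcc_of_le (zero_le_one' ℝ)] at c1 c2
  unfold action
  refine ((intervalIntegral.integral_congr c2).symm.trans ?_).trans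
    (intervalIntegral.integral_congr c1)
  refine integral_liouville_eq (fun t ht => hasDerivAt_fst_comp (b1 t ht).1) (fun t ht => hasDerivAt_fst_comp (b2 t ht).1) ?_ ?_
    (fun t ht => (key t ht).1) ?_ ?_
  · simp only [loop_apply_zero, loop_apply_one]
  · simp only [loop_apply_zero, loop_apply_one]
  · exact i1.congr_uIoo fun t ht => (c1 (Ioo_subset_Icc_self ht)).symm
  · exact i2.congr_uIoo fun t ht => (c2 (Ioo_subset_Icc_self ht)).symm

end Invariance

end HamSystem

/-! ### Loops and normal forms -/

section Loop

variable {E : Type*} [NormedAddCommGroup E] [NormedSpace ℝ E] {J : E → E →L[ℝ] E} {θ : ℝ}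
  {Q : Set E} {F Γ P : ParamSpace E → E × E} {j : ℕ} {q : E}

/-- The slow map commutes with rotations. -/
theorem loop_slowMap {y : ParamSpace E} (hP : ∀ φ, P (y.1, y.2.1, rot J φ y.2.1 y.2.2) =
      ((P y).1, rot J φ y.2.1 (P y).2))
    (hJ : ∀ v, J y.2.1 (J y.2.1 v) = -v) (hJ' : ∀ v, J (P y).1 (J (P y).1 v) = -v) (t : ℝ) :
    loop J (slowMap J θ P y) t = slowMap J θ P (loop J y t) := by
  simp only [loop, slowMap, hP, transport_rot hJ hJ']

/-- The derivative at the base points of the map `y ↦ (ħ, Γ y)`, for a normal form `Γ`. -/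
theorem IsNormalForm.exists_equiv
    (hΓ : IsNormalForm Q J θ F j Γ P) (hq : q ∈ Q) :
    ∃ e : ParamSpace E ≃L[ℝ] ParamSpace E, HasStrictFDerivAt
      (fun y : ParamSpace E => (y.1, Γ y)) (e : ParamSpace E →L[ℝ] ParamSpace E) (0, q, 0) := by
  set p₂ := (ContinuousLinearMap.fst ℝ E E).comp (ContinuousLinearMap.snd ℝ ℝ (E × E))
  set p₃ := (ContinuousLinearMap.snd ℝ E E).comp (ContinuousLinearMap.snd ℝ ℝ (E × E))
  set A : ParamSpace E →L[ℝ] ParamSpace E := (ContinuousLinearMap.fst ℝ ℝ (E × E)).prod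
    ((p₂ - (J q).comp p₃).prod p₃)
  set B : ParamSpace E →L[ℝ] ParamSpace E := (ContinuousLinearMap.fst ℝ ℝ (E × E)).prod
    ((p₂ + (J q).comp p₃).prod p₃)
  refine ⟨ContinuousLinearEquiv.equivOfInverse A B (fun y => by simp [A, B, p₂, p₃])
    (fun y => by simp [A, B, p₂, p₃]), ?_⟩
  have h1 := ((hΓ.smooth q hq).hasStrictFDerivAt (by simp))
  have h2 : HasStrictFDerivAt (fun y : ParamSpace E => (y.1, Γ y)) _ (0, q, 0) :=
    hasStrictFDerivAt_fst.prodMk h1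
  refine h2.congr_fderiv ?_
  refine ContinuousLinearMap.ext fun ⟨h, u, w⟩ => ?_
  have := hΓ.deriv q hq h u w
  simp [this, A, p₂, p₃]

end Loop

/-! ### Drift of the action in one step -/

namespace HamSystem

section Drift

set_option maxSynthPendingDepth 3

variable {E : Type*} [NormedAddCommGroup E] [NormedSpace ℝ E] {D : HamSystem E} {q : E} {θ : ℝ}
  {V : Set (ParamSpace E)} {Γ P : ParamSpace E → E × E} {j : ℕ} [FiniteDimensional ℝ E]

/-- Closed curves that are close to each other have close actions. -/
theorem exists_abs_action_sub_action_le (hq : q ∈ D.Q) {f g : ParamSpace E → E × E}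
    (hf : ContDiffAt ℝ ∞ f (0, q, 0)) (hf0 : f (0, q, 0) = (q, 0))
    (hg : ContDiffAt ℝ ∞ g (0, q, 0)) (hg0 : g (0, q, 0) = (q, 0)) :
    ∃ C > 0, ∀ᶠ p : ParamSpace E × ParamSpace E in 𝓝 ((0, q, 0), (0, q, 0)), p.2.1 = p.1.1 →
      ∀ ε, (∀ t ∈ Icc (0 : ℝ) 1, ‖f (loop D.J p.2 t) - g (loop D.J p.1 t)‖ ≤ ε) →
      |D.action f p.2 - D.action g p.1| ≤ C * ε := by
  have hJ := (contDiffAt_J (D := D) hq).continuousAt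
  obtain ⟨C₁, hC₁, a1⟩ := exists_hasDerivAt_comp_loop hq hJ hf
  obtain ⟨_, _, a2⟩ := exists_hasDerivAt_comp_loop hq hJ hg
  obtain ⟨_, _, a3⟩ := exists_hasDerivAt_comp_loop hq hJ (contDiffAt_liouville_comp hq hf hf0)
  obtain ⟨C₄, hC₄, a4⟩ :=
    exists_hasDerivAt_comp_loop hq hJ (contDiffAt_liouville_comp hq hg hg0)
  obtain ⟨K, hK, hL⟩ := ((contDiffAt_liouville (D := D) (z := (0, q, 0)) hq).isBigO_sub_nhds
    (by simp)).exists_pos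
  have hU := hL.bound
  rw [nhds_prod_eq] at hU
  obtain ⟨pa, ha, pb, hb, hab⟩ := eventually_prod_iff.1 hU
  have b1 : ∀ᶠ y in 𝓝 ((0, q, 0) : ParamSpace E), pa (y.1, f y) := by
    refine Tendsto.eventually ?_ ha
    have : ContinuousAt (fun y : ParamSpace E => (y.1, f y)) (0, q, 0) :=
      continuousAt_fst.prodMk hf.continuousAt
    simpa only [ContinuousAt, hf0] using this
  have b2 : ∀ᶠ y in 𝓝 ((0, q, 0) : ParamSpace E), pb (y.1, g y) := by
    refine Tendsto.eventually ?_ hb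
    have : ContinuousAt (fun y : ParamSpace E => (y.1, g y)) (0, q, 0) :=
      continuousAt_fst.prodMk hg.continuousAt
    simpa only [ContinuousAt, hg0] using this
  have hw : ∀ᶠ y in 𝓝 ((0, q, 0) : ParamSpace E), ‖y.2.2‖ < 1 := by
    have : ContinuousAt (fun y : ParamSpace E => ‖y.2.2‖) (0, q, 0) := by fun_prop
    exact this.eventually_lt continuousAt_const (by simp)
  refine ⟨2 * (C₁ + C₄) * (1 + K), by positivity, ?_⟩
  have hsnd := (((a1.and a3).and (eventually_loop hJ b1)).and hw)
  have hfst := (((a2.and a4).and (eventually_loop hJ b2)).and hw)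
  rw [nhds_prod_eq]
  filter_upwards [hsnd.prod_inr (𝓝 (0, q, 0)), hfst.prod_inl (𝓝 (0, q, 0))]
    with ⟨y, y'⟩ ⟨⟨⟨c1, c3⟩, d1⟩, w1⟩ ⟨⟨⟨c2, c4⟩, d2⟩, w2⟩ hy ε hε
  dsimp only at *
  have hε0 : 0 ≤ ε := (norm_nonneg _).trans (hε 0 (by simp))
  rw [mul_assoc (2 * (C₁ + C₄))]
  unfold action
  refine abs_integral_sub_integral_le
    (β' := fun t => fderiv ℝ (fun y => D.liouville (y.1, g y)) (loop D.J y t)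
      (loopVelocity D.J y t))
    (x := fun t => (f (loop D.J y' t)).1) (z := fun t => (g (loop D.J y t)).1)
    (fun t ht => (c3 t ht).1.continuousAt.continuousWithinAt)
    (fun t ht => (c4 t ht).1) (fun t ht => (c4 t ht).2.1.continuousWithinAt)
    (fun t ht => hasDerivAt_fst_comp (c1 t ht).1)
    (fun t ht => (c1 t ht).2.1.fst.continuousWithinAt)
    (fun t ht => hasDerivAt_fst_comp (c2 t ht).1)
    (fun t ht => (c2 t ht).2.1.fst.continuousWithinAt)
    ?_ ?_ ?_ ?_ ?_ ?_ ?_ (by positivity)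
  · simp only [loop_apply_zero, loop_apply_one]
  · simp only [loop_apply_zero, loop_apply_one]
  · simp only [loop_apply_zero, loop_apply_one]
  · intro t ht
    refine (hab (d1 t ht) (d2 t ht)).trans ?_
    have e : ‖((loop D.J y' t).1, f (loop D.J y' t)) - ((loop D.J y t).1, g (loop D.J y t))‖ =
        ‖f (loop D.J y' t) - g (loop D.J y t)‖ := by
      simp [Prod.norm_def, loop, hy]
    rw [e]
    refine (mul_le_mul_of_nonneg_left (hε t ht) hK.le).trans ?_
    nlinarith
  · intro t ht
    refine (norm_fst_le _).trans ((hε t ht).trans ?_)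
    nlinarith
  · intro t ht
    refine (norm_fst_le _).trans ((c1 t ht).2.2.trans ?_)
    nlinarith [norm_nonneg y'.2.2]
  · intro t ht
    refine (c4 t ht).2.2.trans ?_
    nlinarith [norm_nonneg y.2.2]

/-- A normal form yields an almost invariant action. -/
theorem exists_abs_action_sub_le (hθ : Real.cos θ ≠ 1) (hV : IsOpen V)
    (hQV : ∀ q ∈ D.Q, ((0, q, 0) : ParamSpace E) ∈ V)
    (hseg : ∀ y ∈ V, segment ℝ y.2.1 (y.2.1 + y.2.2) ⊆ D.Q) (hinj : InjOn (D.legendre θ) V)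
    (he : ∀ y ∈ V, ∃ e : ParamSpace E ≃L[ℝ] ParamSpace E,
        HasFDerivAt (D.legendre θ) (e : ParamSpace E →L[ℝ] ParamSpace E) y) (hq : q ∈ D.Q)
    (hΓ : IsNormalForm D.Q D.J θ (D.momentumMap θ V) j Γ P) :
    ∃ C > 0, ∀ᶠ p : ParamSpace E × ParamSpace E in 𝓝 ((0, q, 0), (0, q, 0)), p.2.1 = p.1.1 →
      Γ p.2 = D.momentumMap θ V (p.1.1, Γ p.1) →
      |D.action Γ p.2 - D.action Γ p.1| ≤ C * ‖fastProj E p.1‖ ^ j := by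
  have hJ := contDiffAt_J (D := D) hq
  have hΓs := hΓ.smooth q hq
  have hΓ0 := hΓ.base q hq
  have hF := isNearlyPeriodicMap_momentumMap hθ hV hQV hinj
  have hG : ContDiffAt ℝ ∞ (fun y => D.momentumMap θ V (y.1, Γ y)) (0, q, 0) :=
    ContDiffAt.comp (g := D.momentumMap θ V) ((0, q, 0) : ParamSpace E)
      (by simpa [hΓ0] using hF.smooth q hq) (contDiffAt_fst.prodMk hΓs)
  have hG0 : D.momentumMap θ V (0, Γ (0, q, 0)) = (q, 0) := by rw [hΓ0, hF.base q hq]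
  obtain ⟨C, hC, h1⟩ := exists_abs_action_sub_action_le hq hΓs hΓ0 hG hG0
  have h2 := eventually_action_momentumMap hθ hV hQV hseg hinj he hq hΓs hΓ0
  obtain ⟨e, he⟩ := hΓ.exists_equiv hq
  -- Invertibility of the derivative makes y ↦ (ħ, Γ y) bi-Lipschitz near the base point.
  obtain ⟨C₁, hC₁, h3⟩ := 
    (HasFDerivAtFilter.isTheta_sub he e.toHomeomorph.isInducing).isBigO_symm.exists_pos
  obtain ⟨C₂, hC₂, h4⟩ := (hΓ.error q hq).exists_pos
  obtain ⟨C₃, hC₃, h5⟩ := exists_norm_loop_le hJ.continuousAt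
  obtain ⟨C₄, hC₄, h6⟩ := exists_norm_loop_sub_le hJ
  obtain ⟨C₅, hC₅, h7⟩ := (hΓs.isBigO_sub_nhds (by simp)).exists_pos
  have hs : Tendsto (slowMap D.J θ P) (𝓝 (0, q, 0)) (𝓝 (0, q, 0)) := by
    have := (contDiffAt_slowMap (θ := θ) (fun q hq => contDiffAt_J hq) hq (hΓ.smooth_avg q hq)
      (hΓ.base_avg q hq)).continuousAt
    simpa only [ContinuousAt, slowMap_base (hΓ.base_avg q hq)] using this
  have hPQ : ∀ᶠ y in 𝓝 ((0, q, 0) : ParamSpace E), (P y).1 ∈ D.Q := by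
    refine (hΓ.smooth_avg q hq).continuousAt.fst.eventually_mem (D.isOpen_Q.mem_nhds ?_)
    simpa [hΓ.base_avg q hq] using hq
  have t1 : Tendsto (fun p : ParamSpace E × ParamSpace E => p.1) (𝓝 ((0, q, 0), (0, q, 0)))
    (𝓝 (0, q, 0)) := continuousAt_fst
  have t2 : Tendsto (fun p : ParamSpace E × ParamSpace E => p.2) (𝓝 ((0, q, 0), (0, q, 0)))
    (𝓝 (0, q, 0)) := continuousAt_snd
  have t3 := t2.prodMk_nhds (hs.comp t1)
  have hloop : ∀ᶠ p : ParamSpace E × ParamSpace E in 𝓝 ((0, q, 0), (0, q, 0)),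
      ∀ t ∈ Icc (0 : ℝ) 1, ‖Γ (loop D.J p.2 t) - Γ (loop D.J (slowMap D.J θ P p.1) t)‖ ≤
        C₅ * ‖loop D.J p.2 t - loop D.J (slowMap D.J θ P p.1) t‖ := by
    have := h7.bound
    rw [nhds_prod_eq] at this
    obtain ⟨pa, ha, pb, hb, hab⟩ := eventually_prod_iff.1 this
    filter_upwards [t2.eventually (eventually_loop hJ.continuousAt ha),
      (hs.comp t1).eventually (eventually_loop hJ.continuousAt hb)] with p k1 k2 t ht
    exact hab (k1 t ht) (k2 t ht)
  refine ⟨C * (C₅ * (C₄ * (C₁ * C₂)) + C₂ * C₃ ^ j), by positivity, ?_⟩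
  filter_upwards [h1, t1.eventually h2, t3.eventually h3.bound, t1.eventually h4.bound,
    t1.eventually (eventually_loop hJ.continuousAt h4.bound), t1.eventually h5, t3.eventually h6,
    hloop, t1.eventually hPQ, t1.eventually (eventually_fst_snd_mem D.isOpen_Q hq)]
    with ⟨y, y'⟩ a1 a2 a3 a4 a5 a6 a7 a8 a9 a10 hy hyy
  dsimp only [Function.comp_apply] at *
  -- The action at y is replaced by the equal action of F ∘ Γ, so only two nearby loops have to be
  -- compared.
  rw [← a2, mul_assoc]
  refine a1 hy _ fun t ht => ?_
  rw [norm_pow, norm_norm] at a4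
  set N := ‖fastProj E y‖ with hN
  have hN0 : 0 ≤ N := norm_nonneg _
  -- Γ y' is F(Γ y), which the normal form error puts within O(N^j) of Γ(slowMap y); pull this back
  -- by Γ.
  have b1 : ‖y' - slowMap D.J θ P y‖ ≤ C₁ * (C₂ * N ^ j) := by
    refine a3.trans (mul_le_mul_of_nonneg_left (le_trans (le_of_eq ?_) a4) hC₁.le)
    rw [← hyy]
    simp [Prod.norm_def, slowMap, hy]
  have b2 := (a8 t ht).trans (mul_le_mul_of_nonneg_left
    ((a7 t).trans (mul_le_mul_of_nonneg_left b1 hC₄.le)) hC₅.le)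
  have b3 := a5 t ht
  rw [norm_pow, norm_norm] at b3
  have b4 : ‖fastProj E (loop D.J y t)‖ ^ j ≤ (C₃ * N) ^ j :=
    pow_le_pow_left₀ (norm_nonneg _) (a6 t).2.1 j
  -- Equivariance of the slow map: it carries the loop of y to the loop of its image, so the error
  -- bound holds along the entire loop.
  rw [← loop_slowMap (fun φ => hΓ.avg_rot _ _ a10 _ φ) (D.J_sq _ a10) (D.J_sq _ a9)] at b3
  have b5 := norm_sub_le_norm_sub_add_norm_sub (Γ (loop D.J y' t))
    (Γ (loop D.J (slowMap D.J θ P y) t)) (D.momentumMap θ V ((loop D.J y t).1, Γ (loop D.J y t)))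
  rw [norm_sub_rev (Γ (loop D.J (slowMap D.J θ P y) t))] at b5
  refine b5.trans ((add_le_add b2 (b3.trans (mul_le_mul_of_nonneg_left b4 hC₂.le))).trans
    (le_of_eq ?_))
  rw [mul_pow]
  ring

end Drift

end HamSystem

/-! ### Leading term of the action -/

namespace HamSystem

section Quadratic

set_option maxSynthPendingDepth 3

variable {E : Type*} [NormedAddCommGroup E] [NormedSpace ℝ E] {D : HamSystem E} {q : E} {θ : ℝ}
  {F Γ P : ParamSpace E → E × E} {j : ℕ}

theorem metric_rot (hq : q ∈ D.Q) (φ : ℝ) (w : E) :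
    D.metric q (rot D.J φ q w) (rot D.J φ q w) = D.metric q w w := by
  have h1 : D.metric q (D.J q w) (D.J q w) = D.metric q w w := by
    rw [metric_J hq, metric_symm hq, metric_apply]
  have h2 : D.metric q (D.J q w) w = 0 := by
    rw [metric_J hq]
    linarith [omega_swap (D := D) q w w]
  rw [rot_apply]
  simp only [map_sub, map_smul, sub_apply, smul_apply, smul_eq_mul, h1, h2,
    metric_symm hq w (D.J q w)]
  linear_combination (D.metric q w w) * Real.sin_sq_add_cos_sq φ

/-- The leading term of the action. -/
theorem integral_metric_loop {y : ParamSpace E} (hy : y.2.1 ∈ D.Q) :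
    ∫ t in (0 : ℝ)..1, (-(2 * Real.pi)) * (D.metric y.2.1 (loop D.J y t).2.2
      - fderiv ℝ D.ϑ y.2.1 (D.J y.2.1 (loop D.J y t).2.2)) (loop D.J y t).2.2 =
      -(Real.pi * D.metric y.2.1 y.2.2 y.2.2) := by
  have hw : ∀ t, HasDerivAt (fun t => (loop D.J y t).2.2) (loopVelocity D.J y t).2.2 t :=
    fun t => ((ContinuousLinearMap.snd ℝ E E).comp
      (ContinuousLinearMap.snd ℝ ℝ (E × E))).hasFDerivAt.comp_hasDerivAt t
      (hasDerivAt_loop (D.J_sq _ hy) t)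
  have hc : Continuous fun t => (loop D.J y t).2.2 := (continuous_loop y).snd.snd
  -- The symmetric part of Dϑ contributes a total derivative, of −½Dϑ[w](w); the antisymmetric part
  -- is ω and halves the metric term, leaving the constant −π g(w, w).
  have hd : ∀ t ∈ uIcc (0 : ℝ) 1, HasDerivAt (fun t => -(1 / 2 : ℝ) *
      fderiv ℝ D.ϑ y.2.1 (loop D.J y t).2.2 (loop D.J y t).2.2 -
      t * (Real.pi * D.metric y.2.1 y.2.2 y.2.2)) ((-(2 * Real.pi)) *
      (D.metric y.2.1 (loop D.J y t).2.2 - fderiv ℝ D.ϑ y.2.1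
        (D.J y.2.1 (loop D.J y t).2.2)) (loop D.J y t).2.2) t := by
    intro t _
    have h1 := (fderiv ℝ D.ϑ y.2.1).hasFDerivAt.comp_hasDerivAt t (hw t)
    refine (((h1.clm_apply (hw t)).const_mul (-(1 / 2 : ℝ))).sub
      ((hasDerivAt_id t).mul_const _)).congr_deriv ?_
    have h2 : D.metric y.2.1 y.2.2 y.2.2 = fderiv ℝ D.ϑ y.2.1 (D.J y.2.1 (loop D.J y t).2.2)
        (loop D.J y t).2.2 - fderiv ℝ D.ϑ y.2.1 (loop D.J y t).2.2
        (D.J y.2.1 (loop D.J y t).2.2) := by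
      rw [← omega_apply, ← metric_apply]
      exact (metric_rot hy _ _).symm
    have h3 : D.metric y.2.1 (loop D.J y t).2.2 (loop D.J y t).2.2 =
        D.metric y.2.1 y.2.2 y.2.2 := metric_rot hy _ _
    simp only [sub_apply, h3, h2, loopVelocity, map_neg, map_smul, neg_apply, smul_apply,
      neg_smul, smul_eq_mul, Function.comp_apply]
    ring
  rw [intervalIntegral.integral_eq_sub_of_hasDerivAt hd]
  · simp only [loop_apply_zero, loop_apply_one]
    ring
  · refine Continuous.intervalIntegrable ?_ _ _
    exact continuous_const.mul ((((D.metric y.2.1).continuous.comp hc).sub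
      ((fderiv ℝ D.ϑ y.2.1).continuous.comp ((D.J y.2.1).continuous.comp hc))).clm_apply hc)

variable [FiniteDimensional ℝ E]

theorem fderiv_liouville_comp_apply (hΓ : IsNormalForm D.Q D.J θ F j Γ P) (hq : q ∈ D.Q) (w : E) :
    fderiv ℝ (fun y => D.liouville (y.1, Γ y)) (0, q, 0) (0, 0, w) =
      D.metric q w - fderiv ℝ D.ϑ q (D.J q w) := by
  have h1 : HasFDerivAt (fun y : ParamSpace E => (y.1, Γ y)) _ (0, q, 0) :=
    hasFDerivAt_fst.prodMk ((hΓ.smooth q hq).differentiableAt (by simp)).hasFDerivAt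
  have h2 := ((contDiffAt_liouville (D := D) (z := (0, Γ (0, q, 0)))
    (by simpa [hΓ.base q hq] using hq)).differentiableAt (by simp)).hasFDerivAt
  have h3 : HasFDerivAt (fun y => D.liouville (y.1, Γ y)) _ (0, q, 0) :=
    HasFDerivAt.comp (g := D.liouville) ((0, q, 0) : ParamSpace E) h2 h1
  rw [h3.fderiv, hΓ.base q hq]
  simp only [ContinuousLinearMap.comp_apply, ContinuousLinearMap.prod_apply, hΓ.deriv q hq,
    ContinuousLinearMap.coe_fst', fderiv_liouville_apply hq, zero_sub, map_neg]
  abel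

/-- The action is given to leading order by the metric. -/
theorem exists_abs_action_add_le (hΓ : IsNormalForm D.Q D.J θ F j Γ P) (hq : q ∈ D.Q) :
    ∃ C > 0, ∀ᶠ y in 𝓝 (0, q, 0), |D.action Γ y + Real.pi * D.metric y.2.1 y.2.2 y.2.2| ≤
      C * (‖fastProj E y‖ * ‖y.2.2‖ ^ 2) := by
  have hJ := (contDiffAt_J (D := D) hq).continuousAt
  have hΓs := hΓ.smooth q hq
  have hΛ := contDiffAt_liouville_comp hq hΓs (hΓ.base q hq)
  set Λ : ParamSpace E → E →L[ℝ] ℝ := fun y => D.liouville (y.1, Γ y)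
  obtain ⟨C₁, hC₁, a1⟩ := exists_hasDerivAt_comp_loop hq hJ hΓs
  obtain ⟨C₂, hC₂, a2⟩ := exists_hasDerivAt_comp_loop hq hJ hΛ
  obtain ⟨C₃, hC₃, a3⟩ := exists_norm_loop_le hJ
  obtain ⟨C₄, hC₄, a4⟩ := (hΛ.isBigO_sub_sub_fderiv two_le_infty).exists_pos
  obtain ⟨C₅, hC₅, a5⟩ := ((hΓs.fderiv_right (m := ∞) (by simp)).isBigO_sub_nhds
    (by simp)).exists_pos
  obtain ⟨C₆, hC₆, a6⟩ := eventually_norm_le_of_continuousAt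
    (hΛ.fderiv_right (m := 0) (by simp)).continuousAt
  have s1 : Tendsto (fun y : ParamSpace E => ((0, y.2.1, 0) : ParamSpace E)) (𝓝 (0, q, 0))
      (𝓝 (0, q, 0)) := by
    have : Continuous (fun y : ParamSpace E => ((0, y.2.1, 0) : ParamSpace E)) := by fun_prop
    exact this.tendsto' _ _ rfl
  have s2 : Tendsto (fun y : ParamSpace E => ((y.1, y.2.1, 0) : ParamSpace E)) (𝓝 (0, q, 0))
      (𝓝 (0, q, 0)) := by
    have : Continuous (fun y : ParamSpace E => ((y.1, y.2.1, 0) : ParamSpace E)) := by fun_prop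
    exact this.tendsto' _ _ rfl
  have b4 : ∀ᶠ y in 𝓝 ((0, q, 0) : ParamSpace E), ∀ t ∈ Icc (0 : ℝ) 1,
      ‖Λ (loop D.J y t) - Λ (y.1, y.2.1, 0) - fderiv ℝ Λ (0, y.2.1, 0)
        (loop D.J y t - (y.1, y.2.1, 0))‖ ≤ C₄ * ((‖loop D.J y t - (0, y.2.1, 0)‖ +
        ‖((y.1, y.2.1, 0) : ParamSpace E) - (0, y.2.1, 0)‖) *
          ‖loop D.J y t - (y.1, y.2.1, 0)‖) := by
    have h := (tendsto_id.prodMk_nhds (s2.prodMk_nhds s1)).eventually a4.bound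
    filter_upwards [eventually_loop hJ h] with y hy t ht
    refine (hy t ht).trans (le_of_eq ?_)
    rw [Real.norm_of_nonneg (by positivity)]
    rfl
  have b5 : ∀ᶠ y in 𝓝 ((0, q, 0) : ParamSpace E), ∀ t ∈ Icc (0 : ℝ) 1,
      ‖fderiv ℝ Γ (loop D.J y t) - fderiv ℝ Γ (0, y.2.1, 0)‖ ≤
        C₅ * ‖loop D.J y t - (0, y.2.1, 0)‖ :=
    eventually_loop hJ ((tendsto_id.prodMk_nhds s1).eventually a5.bound)
  refine ⟨C₄ * ((C₃ + 1) * C₃) * C₁ + C₆ * C₃ * (C₅ * C₃ * C₃), by positivity, ?_⟩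
  filter_upwards [a1, a2, a3, b4, b5, s1.eventually a6, eventually_fst_snd_mem D.isOpen_Q hq]
    with y c1 c2 c3 c4 c5 c6 hy
  set N := ‖fastProj E y‖ with hN
  set x' : ℝ → E := fun t => (fderiv ℝ Γ (loop D.J y t) (loopVelocity D.J y t)).1 with hx'
  set m : ℝ → E →L[ℝ] ℝ := fun t => D.metric y.2.1 (loop D.J y t).2.2 -
    fderiv ℝ D.ϑ y.2.1 (D.J y.2.1 (loop D.J y t).2.2) with hm
  have hwc : Continuous fun t => (loop D.J y t).2.2 := (continuous_loop y).snd.snd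
  have hmc : Continuous m := ((D.metric y.2.1).continuous.comp hwc).sub
      ((fderiv ℝ D.ϑ y.2.1).continuous.comp ((D.J y.2.1).continuous.comp hwc))
  have hx'c : ContinuousOn x' (Icc 0 1) := fun t ht => (c1 t ht).2.1.fst.continuousWithinAt
  have hΛc : ContinuousOn (fun t => Λ (loop D.J y t)) (Icc 0 1) :=
    fun t ht => (c2 t ht).1.continuousAt.continuousWithinAt
  have i1 : IntervalIntegrable (fun t => Λ (loop D.J y t) (x' t)) MeasureTheory.volume 0 1 :=
    (hΛc.clm_apply hx'c).intervalIntegrable_of_Icc zero_le_one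
  have i2 : IntervalIntegrable (fun t => Λ (y.1, y.2.1, 0) (x' t)) MeasureTheory.volume 0 1 :=
    (continuousOn_const.clm_apply hx'c).intervalIntegrable_of_Icc zero_le_one
  have i3 : IntervalIntegrable (fun t => -(2 * Real.pi) * m t (loop D.J y t).2.2)
    MeasureTheory.volume 0 1 :=
    (continuous_const.mul (hmc.clm_apply hwc)).intervalIntegrable _ _
  -- A constant covector integrates to zero over a closed curve. Subtracting its value at the centre
  -- makes both factors of the integrand O(‖w‖), so the error acquires ‖w‖².
  have e1 : ∫ t in (0 : ℝ)..1, Λ (y.1, y.2.1, 0) (x' t) = 0 := by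
    rw [intervalIntegral.integral_eq_sub_of_hasDerivAt
      (f := fun t => Λ (y.1, y.2.1, 0) (Γ (loop D.J y t)).1) _ i2]
    · simp only [loop_apply_zero, loop_apply_one, sub_self]
    · intro t ht
      rw [uIcc_of_le zero_le_one] at ht
      exact (Λ (y.1, y.2.1, 0)).hasFDerivAt.comp_hasDerivAt t (hasDerivAt_fst_comp (c1 t ht).1)
  have e2 : D.action Γ y + Real.pi * D.metric y.2.1 y.2.2 y.2.2 = ∫ t in (0 : ℝ)..1,
      (Λ (loop D.J y t) (x' t) - Λ (y.1, y.2.1, 0) (x' t) -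
        -(2 * Real.pi) * m t (loop D.J y t).2.2) := by
    rw [intervalIntegral.integral_sub (i1.sub i2) i3, intervalIntegral.integral_sub i1 i2, e1,
      integral_metric_loop hy, sub_zero, sub_neg_eq_add]
    rfl
  rw [e2, ← Real.norm_eq_abs]
  refine (intervalIntegral.norm_integral_le_of_norm_le_const fun t ht => ?_).trans_eq
    (by rw [sub_zero, abs_one, mul_one])
  rw [uIoc_of_le zero_le_one] at ht
  have ht' : t ∈ Icc (0 : ℝ) 1 := ⟨ht.1.le, ht.2⟩
  have n1 : ‖loop D.J y t - (0, y.2.1, 0)‖ ≤ C₃ * N := by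
    refine le_trans (le_of_eq ?_) (c3 t).2.1
    congr 1
    ext <;> simp [loop]
  have n2 : ‖((y.1, y.2.1, 0) : ParamSpace E) - (0, y.2.1, 0)‖ ≤ N := by
    refine le_trans (le_of_eq ?_) (abs_fst_le_norm_fastProj y)
    simp [Prod.norm_def]
  have n3 : loop D.J y t - (y.1, y.2.1, 0) = (0, 0, (loop D.J y t).2.2) := by
    ext <;> simp [loop]
  have n4 : ‖((0, 0, (loop D.J y t).2.2) : ParamSpace E)‖ = ‖(loop D.J y t).2.2‖ := by
    simp [Prod.norm_def]
  have m1 : m t = fderiv ℝ Λ (0, y.2.1, 0) (0, 0, (loop D.J y t).2.2) :=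
    (fderiv_liouville_comp_apply hΓ hy _).symm
  have m2 : ‖m t‖ ≤ C₆ * (C₃ * ‖y.2.2‖) := by
    rw [m1]
    refine (ContinuousLinearMap.le_opNorm _ _).trans ?_
    rw [n4]
    exact mul_le_mul c6 (c3 t).1 (norm_nonneg _) hC₆.le
  have d1 : ‖Λ (loop D.J y t) - Λ (y.1, y.2.1, 0) - m t‖ ≤
      C₄ * ((C₃ * N + N) * (C₃ * ‖y.2.2‖)) := by
    have := c4 t ht'
    rw [n3, ← m1, n4] at this
    refine this.trans ?_
    gcongr
    exact (c3 t).1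
  have x1 : x' t - -(2 * Real.pi) • (loop D.J y t).2.2 =
      ((fderiv ℝ Γ (loop D.J y t) - fderiv ℝ Γ (0, y.2.1, 0)) (loopVelocity D.J y t)).1 := by
    have : (fderiv ℝ Γ (0, y.2.1, 0) (loopVelocity D.J y t)).1 =
        -(2 * Real.pi) • (loop D.J y t).2.2 := by
      rw [loopVelocity, hΓ.deriv _ hy]
      simp only [map_smul, D.J_sq _ hy]
      module
    rw [← this, hx', sub_apply, Prod.fst_sub]
  have x2 : ‖x' t - -(2 * Real.pi) • (loop D.J y t).2.2‖ ≤ C₅ * (C₃ * N) * (C₃ * ‖y.2.2‖) := by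
    rw [x1]
    refine (norm_fst_le _).trans ((ContinuousLinearMap.le_opNorm _ _).trans ?_)
    refine mul_le_mul ((c5 t ht').trans ?_) (c3 t).2.2 (norm_nonneg _) (by positivity)
    exact mul_le_mul_of_nonneg_left n1 hC₅.le
  have x3 : ‖x' t‖ ≤ C₁ * ‖y.2.2‖ := (norm_fst_le _).trans (c1 t ht').2.2
  -- In each term one factor is O(N‖w‖) and the other is O(‖w‖).
  have split : Λ (loop D.J y t) (x' t) - Λ (y.1, y.2.1, 0) (x' t) -
      -(2 * Real.pi) * m t (loop D.J y t).2.2 =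
      (Λ (loop D.J y t) - Λ (y.1, y.2.1, 0) - m t) (x' t) +
      m t (x' t - -(2 * Real.pi) • (loop D.J y t).2.2) := by
    simp only [sub_apply, map_sub, map_smul, smul_eq_mul]
    ring
  rw [split]
  refine (norm_add_le _ _).trans ((add_le_add ((ContinuousLinearMap.le_opNorm _ _).trans
    (mul_le_mul d1 x3 (norm_nonneg _) (by positivity))) ((ContinuousLinearMap.le_opNorm _ _).trans
    (mul_le_mul m2 x2 (norm_nonneg _) (by positivity)))).trans (le_of_eq ?_))
  ring

end Quadratic

end HamSystem

/-! ### The fast variable and inversion of the normal form -/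

section FastVariable

variable {E : Type*} [NormedAddCommGroup E] [NormedSpace ℝ E] {J : E → E →L[ℝ] E} {θ : ℝ}
  {Q : Set E} {F Γ P : ParamSpace E → E × E} {j : ℕ} {q : E}

/-- The fast variable of a normal form is comparable to the second component. -/
theorem IsNormalForm.isBigO_fast (hΓ : IsNormalForm Q J θ F j Γ P) (hq : q ∈ Q)
    (h3 : (fun y : ParamSpace E => (Γ (y.1, y.2.1, 0)).2) =O[𝓝 (0, q, 0)] fun y => |y.1| ^ 3) :
    (fun y : ParamSpace E => (Γ y).2) =O[𝓝 (0, q, 0)] (fun y => ‖y.2.2‖ + |y.1| ^ 3) ∧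
      (fun y : ParamSpace E => y.2.2) =O[𝓝 (0, q, 0)] fun y => ‖(Γ y).2‖ + |y.1| ^ 3 := by
  have s2 : Tendsto (fun y : ParamSpace E => (y, ((y.1, y.2.1, 0) : ParamSpace E))) (𝓝 (0, q, 0))
      (𝓝 ((0, q, 0), (0, q, 0))) := by
    have : Continuous (fun y : ParamSpace E => (y, ((y.1, y.2.1, 0) : ParamSpace E))) := by fun_prop
    exact this.tendsto' _ _ rfl
  have hs := ((hΓ.smooth q hq).hasStrictFDerivAt (by simp)).isLittleO.comp_tendsto s2
  obtain ⟨C, hC, hC3⟩ := h3.exists_pos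
  -- The second component of DΓ is w. Strict differentiability between y and (ħ, q', 0) gives the
  -- factor 1/2, and the value at w = 0 is O(|ħ|³) by hypothesis.
  have key : ∀ᶠ y : ParamSpace E in 𝓝 (0, q, 0), ‖(Γ y).2 - y.2.2‖ ≤
      1 / 2 * ‖y.2.2‖ + C * |y.1| ^ 3 := by
    filter_upwards [hs.bound (c := 1 / 2) (by norm_num), hC3.bound] with y h1 h2
    simp only [Function.comp_apply] at h1
    have e : y - (y.1, y.2.1, 0) = (0, 0, y.2.2) := by ext <;> simp
    have e' : ‖((0, 0, y.2.2) : ParamSpace E)‖ = ‖y.2.2‖ := by simp [Prod.norm_def]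
    rw [e, hΓ.deriv q hq, e'] at h1
    have h4 := (norm_snd_le _).trans h1
    rw [Real.norm_of_nonneg (by positivity)] at h2
    have e2 : (Γ y).2 - y.2.2 = (Γ y - Γ (y.1, y.2.1, 0) - (0 - J q y.2.2, y.2.2)).2 +
        (Γ (y.1, y.2.1, 0)).2 := by
      simp only [Prod.snd_sub]
      abel
    rw [e2]
    exact (norm_add_le _ _).trans (add_le_add h4 h2)
  constructor
  · refine IsBigO.of_bound (3 / 2 + C) ?_
    filter_upwards [key] with y hy
    rw [Real.norm_of_nonneg (by positivity)]
    have := norm_le_norm_sub_add (Γ y).2 y.2.2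
    nlinarith [norm_nonneg y.2.2, pow_nonneg (abs_nonneg y.1) 3]
  · refine IsBigO.of_bound (2 + 2 * C) ?_
    filter_upwards [key] with y hy
    rw [Real.norm_of_nonneg (by positivity)]
    have := norm_le_norm_sub_add y.2.2 (Γ y).2
    rw [norm_sub_rev] at this
    nlinarith [norm_nonneg (Γ y).2, pow_nonneg (abs_nonneg y.1) 3]

/-- The points (0, q, 0) are fixed, so the gluing of local injectivity used for the momenta yields
one inverse valid near all of them. -/
theorem IsNormalForm.exists_inverse [CompleteSpace E] (hΓ : IsNormalForm Q J θ F j Γ P)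
    (hQ : IsOpen Q) : ∃ G : ParamSpace E → ParamSpace E, ∀ q ∈ Q,
      Tendsto G (𝓝 (0, q, 0)) (𝓝 (0, q, 0)) ∧
      (∀ᶠ x in 𝓝 (0, q, 0), (G x).1 = x.1 ∧ Γ (G x) = x.2) ∧
      (fun x => ‖fastProj E (G x)‖) =O[𝓝 (0, q, 0)] fun x => ‖fastProj E x‖ := by
  set A : Set (ParamSpace E) := {y | ∃ q ∈ Q, y = (0, q, 0)} with hA
  set T : ParamSpace E → ParamSpace E := fun y => (y.1, Γ y) with hT
  have hfix : ∀ a ∈ A, T a = a := by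
    rintro _ ⟨q, hq, rfl⟩
    simp [hT, hΓ.base q hq]
  obtain ⟨W, hW, hAW, -, hinj⟩ := exists_isOpen_injOn_of_forall_fixed (G := T) (A := A) isOpen_univ
    (subset_univ _) hfix (by rintro _ ⟨q, hq, rfl⟩; exact hΓ.exists_equiv hq)
  refine ⟨Function.invFunOn T W, fun q hq => ?_⟩
  have hmem : ((0, q, 0) : ParamSpace E) ∈ A := ⟨q, hq, rfl⟩
  obtain ⟨e, he⟩ := hΓ.exists_equiv hq
  obtain ⟨h1, h2⟩ := contDiffAt_invFunOn hW hinj (hAW hmem) (n := ∞) (by simp)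
    (contDiffAt_fst.prodMk (hΓ.smooth q hq)) he.hasFDerivAt
  rw [hfix _ hmem] at h1 h2
  have h0 : ∀ q ∈ Q, Function.invFunOn T W (0, q, 0) = (0, q, 0) := fun q hq => by
    have := hinj.leftInvOn_invFunOn (hAW ⟨q, hq, rfl⟩ : ((0, q, 0) : ParamSpace E) ∈ W)
    rwa [hfix _ ⟨q, hq, rfl⟩] at this
  refine ⟨?_, ?_, ?_⟩
  · simpa only [ContinuousAt, h0 q hq] using h1.continuousAt
  · exact h2.mono fun x hx => Prod.ext_iff.1 hx.2
  · refine IsBigO.trans (IsBigO.of_bound 1 ?_) (isBigO_sub_base h1)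
    filter_upwards [eventually_fst_snd_mem hQ hq] with x hx
    rw [h0 _ hx, one_mul, norm_norm]
    generalize Function.invFunOn T W x = z
    have e : ‖fastProj E z‖ = max |z.1| ‖z.2.2‖ := by simp [Prod.norm_def]
    rw [e]
    refine max_le ?_ ?_
    · have h := norm_fst_le (z - (0, x.2.1, 0))
      rwa [Prod.fst_sub, sub_zero] at h
    · have h := (norm_snd_le (z - (0, x.2.1, 0)).2).trans (norm_snd_le (z - (0, x.2.1, 0)))
      rwa [Prod.snd_sub, Prod.snd_sub, sub_zero] at h

end FastVariable

/-! ### The adiabatic invariant -/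

namespace HamSystem

section AdiabaticInvariant

set_option maxSynthPendingDepth 3

variable {E : Type*} [NormedAddCommGroup E] [NormedSpace ℝ E] {D : HamSystem E} {q : E} {θ : ℝ}
  {V : Set (ParamSpace E)} {F Γ P : ParamSpace E → E × E} {j : ℕ} [FiniteDimensional ℝ E]

/-- Positivity on the compact unit sphere is uniform and persists for nearby q; scaling gives all w.
-/
theorem exists_le_metric (hq : q ∈ D.Q) :
    ∃ c > 0, ∀ᶠ q' in 𝓝 q, ∀ w, c * ‖w‖ ^ 2 ≤ D.metric q' w w := by
  have hcpt := isCompact_sphere (0 : E) 1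
  have hc : ContinuousOn (fun w => D.metric q w w) (Metric.sphere (0 : E) 1) :=
    (((D.metric q).continuous).clm_apply continuous_id).continuousOn
  obtain ⟨c, hc0, hcle⟩ := hcpt.exists_forall_le' hc (a := 0) fun w hw =>
    metric_pos hq (by rintro rfl; simp at hw)
  refine ⟨c / 2, by positivity, ?_⟩
  have h := hcpt.eventually_forall_of_forall_eventually (x₀ := q)
    (P := fun q' w => c / 2 < D.metric q' w w) fun w hw => by
      have h1 : ContinuousAt (fun z : E × E => D.metric z.1) (q, w) :=
        ContinuousAt.comp (g := D.metric) (f := Prod.fst) (x := (q, w))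
          (contDiffAt_metric hq).continuousAt continuousAt_fst
      have h2 : ContinuousAt (fun z : E × E => D.metric z.1 z.2 z.2) (q, w) :=
        (h1.clm_apply continuousAt_snd).clm_apply continuousAt_snd
      exact h2.eventually (lt_mem_nhds (by dsimp only; linarith [hcle w hw]))
  filter_upwards [h] with q' hq' w
  rcases eq_or_ne w 0 with rfl | hw
  · simp
  have hw' := norm_pos_iff.2 hw
  have := hq' (‖w‖⁻¹ • w) (by simp [norm_smul, hw'.ne'])
  simp only [map_smul, smul_apply, smul_eq_mul] at this
  have h3 : ‖w‖⁻¹ * (‖w‖⁻¹ * D.metric q' w w) = D.metric q' w w / ‖w‖ ^ 2 := by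
    field_simp
  rw [h3, lt_div_iff₀ (by positivity)] at this
  exact this.le

theorem isTheta_action (hΓ : IsNormalForm D.Q D.J θ F j Γ P) (hq : q ∈ D.Q) :
    D.action Γ =Θ[𝓝 (0, q, 0)] fun y => ‖y.2.2‖ ^ 2 := by
  obtain ⟨C, hC, h1⟩ := exists_abs_action_add_le hΓ hq
  obtain ⟨c, hc, h2⟩ := exists_le_metric hq
  obtain ⟨B, hB, h3⟩ := eventually_norm_le_of_continuousAt
    (contDiffAt_metric (D := D) hq).continuousAt
  have hfst : Tendsto (fun y : ParamSpace E => y.2.1) (𝓝 (0, q, 0)) (𝓝 q) :=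
    (continuous_fst.comp continuous_snd).tendsto' _ _ rfl
  -- The bound 1 serves the upper estimate. For the lower one, π g(w, w) ≥ 2c‖w‖², so an error below
  -- c‖w‖² leaves c‖w‖².
  have hN : ∀ᶠ y : ParamSpace E in 𝓝 (0, q, 0), C * ‖fastProj E y‖ < min c 1 := by
    have : ContinuousAt (fun y : ParamSpace E => C * ‖fastProj E y‖) (0, q, 0) := by fun_prop
    refine this.eventually (gt_mem_nhds ?_)
    simp [hc]
  constructor
  · refine IsBigO.of_bound (1 + Real.pi * B) ?_
    filter_upwards [h1, hfst.eventually h3, hN] with y a1 a3 a4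
    rw [Real.norm_of_nonneg (by positivity : 0 ≤ ‖y.2.2‖ ^ 2), Real.norm_eq_abs]
    have b1 : |D.metric y.2.1 y.2.2 y.2.2| ≤ B * ‖y.2.2‖ ^ 2 := by
      rw [← Real.norm_eq_abs, sq, ← mul_assoc]
      exact ((D.metric y.2.1).le_opNorm₂ _ _).trans (by gcongr)
    have b2 : |Real.pi * D.metric y.2.1 y.2.2 y.2.2| ≤ Real.pi * (B * ‖y.2.2‖ ^ 2) := by
      rw [abs_mul, abs_of_pos Real.pi_pos]
      exact mul_le_mul_of_nonneg_left b1 Real.pi_pos.le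
    have b3 : C * ‖fastProj E y‖ * ‖y.2.2‖ ^ 2 ≤ 1 * ‖y.2.2‖ ^ 2 :=
      mul_le_mul_of_nonneg_right (a4.le.trans (min_le_right _ _)) (by positivity)
    rw [abs_le] at a1 b2 ⊢
    constructor <;> nlinarith
  · refine IsBigO.of_bound (1 / c) ?_
    filter_upwards [h1, hfst.eventually h2, hN] with y a1 a3 a4
    rw [Real.norm_of_nonneg (by positivity : 0 ≤ ‖y.2.2‖ ^ 2), Real.norm_eq_abs,
      one_div_mul_eq_div, le_div_iff₀ hc]
    have b3 : C * ‖fastProj E y‖ * ‖y.2.2‖ ^ 2 ≤ c * ‖y.2.2‖ ^ 2 :=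
      mul_le_mul_of_nonneg_right (a4.le.trans (min_le_left _ _)) (by positivity)
    have b4 := a3 y.2.2
    have b5 := neg_le_abs (D.action Γ y)
    have b6 := (abs_le.1 a1).2
    have b7 : 2 * (c * ‖y.2.2‖ ^ 2) ≤ Real.pi * D.metric y.2.1 y.2.2 y.2.2 :=
      mul_le_mul Real.two_le_pi b4 (by positivity) Real.pi_pos.le
    nlinarith

/-- The Lorentz map in the variables `(ħ, q, p)` has an adiabatic invariant of any order. -/
theorem exists_adiabatic_invariant (hθ : Irrational (θ / (2 * Real.pi))) (hθ' : Real.cos θ ≠ 1)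
    (hV : IsOpen V) (hQV : ∀ q ∈ D.Q, ((0, q, 0) : ParamSpace E) ∈ V)
    (hseg : ∀ y ∈ V, segment ℝ y.2.1 (y.2.1 + y.2.2) ⊆ D.Q) (hinj : InjOn (D.legendre θ) V)
    (he : ∀ y ∈ V, ∃ e : ParamSpace E ≃L[ℝ] ParamSpace E,
        HasFDerivAt (D.legendre θ) (e : ParamSpace E →L[ℝ] ParamSpace E) y) (L : ℕ) :
    ∃ a : ParamSpace E → ℝ, ∀ q ∈ D.Q,
      a =O[𝓝 (0, q, 0)] (fun x => (‖x.2.2‖ + |x.1| ^ 3) ^ 2) ∧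
      (fun x : ParamSpace E => ‖x.2.2‖ ^ 2) =O[𝓝 (0, q, 0)] (fun x => |a x| + |x.1| ^ 6) ∧
      (fun x => a (x.1, D.momentumMap θ V x) - a x) =O[𝓝 (0, q, 0)]
        fun x => ‖fastProj E x‖ ^ L := by
  have := FiniteDimensional.complete ℝ E
  have hF := isNearlyPeriodicMap_momentumMap hθ' hV hQV hinj
  have h3 : ∀ q ∈ D.Q, (fun y : ParamSpace E => (D.momentumMap θ V (y.1, y.2.1, 0)).2)
      =O[𝓝 (0, q, 0)] fun y => |y.1| ^ 3 := fun q hq => by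
    have s : Tendsto (fun y : ParamSpace E => ((y.1, y.2.1, 0) : ParamSpace E)) (𝓝 (0, q, 0))
        (𝓝 (0, q, 0)) := by
      have : Continuous (fun y : ParamSpace E => ((y.1, y.2.1, 0) : ParamSpace E)) := by fun_prop
      exact this.tendsto' _ _ rfl
    simpa [Function.comp_def] using (isBigO_momentumMap_snd hθ' hV hQV hinj hq).comp_tendsto s
  obtain ⟨Γ, P, hΓ, hΓ3⟩ := hF.exists_isNormalForm hθ h3 L
  obtain ⟨G, hG⟩ := hΓ.exists_inverse D.isOpen_Q
  -- The invariant is the action read in the original variables (ħ, q, p).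
  refine ⟨fun x => D.action Γ (G x), fun q hq => ?_⟩
  obtain ⟨g1, g2, g3⟩ := hG q hq
  obtain ⟨f1, f2⟩ := hΓ.isBigO_fast hq (hΓ3 q hq)
  obtain ⟨C₁, hC₁, f1⟩ := f1.exists_pos
  obtain ⟨C₂, hC₂, f2⟩ := f2.exists_pos
  have hA := isTheta_action hΓ hq
  obtain ⟨C₃, hC₃, f3⟩ := hA.2.exists_pos
  obtain ⟨C₄, hC₄, f4⟩ := exists_abs_action_sub_le hθ' hV hQV hseg hinj he hq hΓ
  refine ⟨(hA.1.comp_tendsto g1).trans ?_, ?_, ?_⟩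
  · refine IsBigO.of_bound (C₂ ^ 2) ?_
    filter_upwards [g1.eventually f2.bound, g2] with x a1 a2
    rw [Real.norm_of_nonneg (by positivity)] at a1
    rw [Function.comp_apply, norm_pow, norm_pow, norm_norm, ← mul_pow,
      Real.norm_of_nonneg (by positivity : 0 ≤ ‖x.2.2‖ + |x.1| ^ 3)]
    rw [a2.1, a2.2] at a1
    exact pow_le_pow_left₀ (norm_nonneg _) a1 2
  · refine IsBigO.of_bound (C₁ ^ 2 * 2 * (C₃ + 1)) ?_
    filter_upwards [g1.eventually f1.bound, g1.eventually f3.bound, g2] with x a1 a3 a2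
    rw [Real.norm_of_nonneg (by positivity)] at a1 a3 ⊢
    rw [Real.norm_of_nonneg (by positivity)]
    rw [a2.1, a2.2] at a1
    rw [Real.norm_eq_abs] at a3
    set w := ‖(G x).2.2‖
    set h := |x.1| ^ 3 with hh
    have h6 : |x.1| ^ 6 = h ^ 2 := by rw [hh, ← pow_mul]
    rw [h6]
    calc ‖x.2.2‖ ^ 2 ≤ (C₁ * (w + h)) ^ 2 := pow_le_pow_left₀ (norm_nonneg _) a1 2
      _ = C₁ ^ 2 * (w + h) ^ 2 := mul_pow _ _ _
      _ ≤ C₁ ^ 2 * (2 * (w ^ 2 + h ^ 2)) := by gcongr; nlinarith [sq_nonneg (w - h)]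
      _ ≤ C₁ ^ 2 * (2 * ((C₃ + 1) * (|D.action Γ (G x)| + h ^ 2))) := by
        gcongr
        nlinarith [abs_nonneg (D.action Γ (G x)), sq_nonneg h]
      _ = _ := by ring
  · have s : Tendsto (fun x : ParamSpace E => (x.1, D.momentumMap θ V x)) (𝓝 (0, q, 0))
        (𝓝 (0, q, 0)) := by
      have h : ContinuousAt (fun x : ParamSpace E => (x.1, D.momentumMap θ V x)) (0, q, 0) :=
        continuousAt_fst.prodMk (hF.smooth q hq).continuousAt
      simpa only [ContinuousAt, hF.base q hq] using h
    have k : (fun x => D.action Γ (G (x.1, D.momentumMap θ V x)) - D.action Γ (G x))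
        =O[𝓝 (0, q, 0)] fun x => ‖fastProj E (G x)‖ ^ (L + 3) := by
      refine IsBigO.of_bound C₄ ?_
      filter_upwards [(g1.prodMk_nhds (g1.comp s)).eventually f4, g2, s.eventually g2]
        with x a1 a2 a3
      rw [norm_pow, norm_norm, Real.norm_eq_abs]
      refine a1 ?_ ?_
      · simp only [Function.comp_apply]
        rw [a3.1, a2.1]
      · simp only [Function.comp_apply]
        rw [a3.2, a2.1, a2.2]
    refine (k.trans (g3.pow (L + 3))).trans ?_
    exact isBigO_fastProj_pow q (by omega)

end AdiabaticInvariant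

end HamSystem

/-- Estimates that hold near the points of a compact set hold uniformly on it. -/
theorem IsCompact.exists_forall_norm_le_of_isBigO {X Y : Type*} [TopologicalSpace X]
    [TopologicalSpace Y] {V W : Type*} [NormedAddCommGroup V] [NormedAddCommGroup W]
    {f : X × Y → V} {g : X × Y → W} {C : Set Y} (hC : IsCompact C) {a : X}
    (h : ∀ z ∈ C, f =O[𝓝 (a, z)] g) :
    ∃ M > 0, ∀ᶠ x in 𝓝 a, ∀ z ∈ C, ‖f (x, z)‖ ≤ M * ‖g (x, z)‖ := by
  refine hC.induction_on (p := fun s => ∃ M > 0, ∀ᶠ x in 𝓝 a, ∀ z ∈ s,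
    ‖f (x, z)‖ ≤ M * ‖g (x, z)‖) ⟨1, one_pos, by simp⟩ ?_ ?_ ?_
  · rintro s t hst ⟨M, hM, ht⟩
    exact ⟨M, hM, ht.mono fun x hx z hz => hx z (hst hz)⟩
  · rintro s t ⟨M, hM, hs⟩ ⟨M', hM', ht⟩
    refine ⟨M + M', by positivity, ?_⟩
    filter_upwards [hs, ht] with x hx hx' z hz
    rw [add_mul]
    rcases hz with hz | hz
    · exact (hx z hz).trans (le_add_of_nonneg_right (by positivity))
    · exact (hx' z hz).trans (le_add_of_nonneg_left (by positivity))
  · intro z hz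
    obtain ⟨M, hM, hb⟩ := (h z hz).exists_pos
    have hb := hb.bound
    rw [nhds_prod_eq] at hb
    obtain ⟨pa, ha, pb, hb, hab⟩ := eventually_prod_iff.1 hb
    exact ⟨{z | pb z}, mem_nhdsWithin_of_mem_nhds hb, M, hM, ha.mono fun x hx z hz => hab hx hz⟩

/-! ### Uniform one-step estimates on a compact set -/

namespace HamSystem

section LongTime

set_option maxSynthPendingDepth 3

variable {E : Type*} [NormedAddCommGroup E] [NormedSpace ℝ E] {D : HamSystem E} {θ : ℝ}
  [FiniteDimensional ℝ E]

variable (D) in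
/-- The point `(ħ, q, p)` with `p = ħ² (v - X_H(q))`. -/
noncomputable def momentumPoint (x : ℝ × E × E) : ParamSpace E :=
  (x.1, x.2.1, x.1 ^ 2 • (x.2.2 - D.XH x.2.1))

theorem isBigO_momentumPoint {z : E × E} (hz : z.1 ∈ D.Q) :
    Tendsto D.momentumPoint (𝓝 (0, z)) (𝓝 (0, z.1, 0)) ∧
      (fun x => ‖fastProj E (D.momentumPoint x)‖) =O[𝓝 (0, z)] fun x => x.1 := by
  have h1 : ContinuousAt (fun x : ℝ × E × E => x.2.2 - D.XH x.2.1) (0, z) :=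
    (by fun_prop : ContinuousAt (fun x : ℝ × E × E => x.2.2) (0, z)).sub
      (ContinuousAt.comp (g := D.XH) (f := fun x : ℝ × E × E => x.2.1) (x := (0, z))
        (contDiffAt_XH hz).continuousAt (by fun_prop))
  have h2 : ContinuousAt (fun x : ℝ × E × E => x.1 • (x.2.2 - D.XH x.2.1)) (0, z) :=
    continuousAt_fst.smul h1
  constructor
  · have h3 : ContinuousAt D.momentumPoint (0, z) :=
      continuousAt_fst.prodMk ((by fun_prop : ContinuousAt (fun x : ℝ × E × E => x.2.1) (0, z)
        ).prodMk ((continuousAt_fst.pow 2).smul h1))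
    simpa [ContinuousAt, momentumPoint] using h3
  · obtain ⟨B, hB, h⟩ := eventually_norm_le_of_continuousAt h2
    refine IsBigO.of_bound (1 + B) ?_
    filter_upwards [h] with x hx
    have e : ‖fastProj E (D.momentumPoint x)‖ =
        max |x.1| ‖x.1 ^ 2 • (x.2.2 - D.XH x.2.1)‖ := by
      simp [Prod.norm_def, momentumPoint]
    rw [norm_norm, e, Real.norm_eq_abs, sq, mul_smul, norm_smul x.1, Real.norm_eq_abs]
    have := abs_nonneg x.1
    refine max_le (by nlinarith) ?_
    rw [mul_comm]
    exact mul_le_mul_of_nonneg_right (by linarith) this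

/-- Along a compact set, the symplectic Lorentz map is the map `momentumMap`. -/
theorem IsSymplecticLorentzMap.eventually_momentumMap {Ψ : ℝ → E × E → E × E}
    (hΨ : D.IsSymplecticLorentzMap θ Ψ) {V : Set (ParamSpace E)} (hV : IsOpen V)
    (hQV : ∀ q ∈ D.Q, ((0, q, 0) : ParamSpace E) ∈ V) (hinj : InjOn (D.legendre θ) V)
    {C : Set (E × E)} (hC : IsCompact C) (hCQ : C ⊆ D.Q ×ˢ univ) :
    ∀ᶠ ħ in 𝓝 (0 : ℝ), ∀ z ∈ C, D.momentumPoint (ħ, Ψ ħ z) =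
      (ħ, D.momentumMap θ V (D.momentumPoint (ħ, z))) := by
  obtain ⟨U, hU, -, hU0, hs, hΨ0, hrel⟩ := hΨ
  have h := hC.eventually_forall_of_forall_eventually (x₀ := (0 : ℝ))
    -- By the branch condition the displacement is zero at ħ = 0, so by continuity and compactness
    -- it stays in V for small ħ. There injectivity determines it from the momentum.
    (P := fun ħ z => (ħ, z) ∈ U ∧ ((ħ, z.1, (Ψ ħ z).1 - z.1) : ParamSpace E) ∈ V) fun z hz => by
      have hz0 : ((0 : ℝ), z) ∈ U := hU0 z.1 (hCQ hz).1 z.2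
      have hc : ContinuousAt (fun p : ℝ × E × E => Ψ p.1 p.2) (0, z) :=
        (hs.contDiffAt (hU.mem_nhds hz0)).continuousAt
      have hc2 : ContinuousAt (fun p : ℝ × E × E =>
          ((p.1, p.2.1, (Ψ p.1 p.2).1 - p.2.1) : ParamSpace E)) (0, z) :=
        continuousAt_fst.prodMk ((by fun_prop : ContinuousAt (fun x : ℝ × E × E => x.2.1) (0, z)
          ).prodMk (hc.fst.sub (by fun_prop)))
      refine (hU.eventually_mem hz0).and
        (hc2.eventually_mem (hV.mem_nhds ?_))
      have e : (Ψ 0 z).1 - z.1 = 0 := sub_eq_zero.2 (hΨ0 z.1 (hCQ hz).1 z.2)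
      simpa [e] using hQV z.1 (hCQ hz).1
  filter_upwards [h] with ħ hħ z hz
  obtain ⟨k1, k2⟩ := hħ z hz
  obtain ⟨-, h1, h2⟩ := lorentzRel_iff.1 (hrel _ k1)
  have e1 : D.momentumPoint (ħ, z) = D.legendre θ (ħ, z.1, (Ψ ħ z).1 - z.1) := by
    simp only [momentumPoint, legendre, ← h1]
  have e2 : z.1 + ((Ψ ħ z).1 - z.1) = (Ψ ħ z).1 := by abel
  rw [e1, momentumMap_legendre hinj k2]
  simp only [momentumPoint, imageMomentum, swapEnds, neg_sub, e2, ← h2]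

/-- Uniform estimates on a compact set for the symplectic Lorentz map. -/
theorem IsSymplecticLorentzMap.exists_estimates {Ψ : ℝ → E × E → E × E}
    (hΨ : D.IsSymplecticLorentzMap θ Ψ) (hθ : Irrational (θ / (2 * Real.pi)))
    (hθ' : Real.cos θ ≠ 1) {C : Set (E × E)} (hC : IsCompact C) (hCQ : C ⊆ D.Q ×ˢ univ) (L : ℕ) :
    ∃ a : ℝ → E × E → ℝ, ∃ M > 0, ∀ᶠ ħ in 𝓝 (0 : ℝ), ∀ z ∈ C,
      |a ħ z| ≤ M * (‖ħ ^ 2 • (z.2 - D.XH z.1)‖ + |ħ| ^ 3) ^ 2 ∧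
      ‖ħ ^ 2 • (z.2 - D.XH z.1)‖ ^ 2 ≤ M * (|a ħ z| + |ħ| ^ 6) ∧
      |a ħ (Ψ ħ z) - a ħ z| ≤ M * |ħ| ^ L ∧
      ‖(Ψ ħ z).1 - (z.1 + ħ • D.XH z.1 + (ħ ^ 2 / 2) • fderiv ℝ D.XH z.1 (D.XH z.1))‖ ≤
        M * (|ħ| ^ 3 + ‖ħ ^ 2 • (z.2 - D.XH z.1)‖) := by
  obtain ⟨V, hV, hQV, hseg, hinj, he⟩ := exists_legendre_domain D hθ'
  obtain ⟨a, ha⟩ := exists_adiabatic_invariant hθ hθ' hV hQV hseg hinj he L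
  have ht := fun z (hz : z ∈ C) => isBigO_momentumPoint (hCQ hz).1
  obtain ⟨M₁, hM₁, h1⟩ := hC.exists_forall_norm_le_of_isBigO (a := (0 : ℝ)) fun z hz =>
    (ha z.1 (hCQ hz).1).1.comp_tendsto (ht z hz).1
  obtain ⟨M₂, hM₂, h2⟩ := hC.exists_forall_norm_le_of_isBigO (a := (0 : ℝ)) fun z hz =>
    (ha z.1 (hCQ hz).1).2.1.comp_tendsto (ht z hz).1
  obtain ⟨M₃, hM₃, h3⟩ := hC.exists_forall_norm_le_of_isBigO (a := (0 : ℝ)) fun z hz =>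
    ((ha z.1 (hCQ hz).1).2.2.comp_tendsto (ht z hz).1).trans ((ht z hz).2.pow L)
  obtain ⟨M₄, hM₄, h4⟩ := hC.exists_forall_norm_le_of_isBigO (a := (0 : ℝ)) fun z hz =>
    (isBigO_momentumMap_fst hθ' hV hQV hinj (hCQ hz).1).comp_tendsto (ht z hz).1
  refine ⟨fun ħ z => a (D.momentumPoint (ħ, z)), M₁ + M₂ + M₃ + M₄, by positivity, ?_⟩
  filter_upwards [h1, h2, h3, h4, hΨ.eventually_momentumMap hV hQV hinj hC hCQ]
    with ħ a1 a2 a3 a4 a5 z hz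
  have b1 := a1 z hz
  have b2 := a2 z hz
  have b3 := a3 z hz
  have b4 := a4 z hz
  have b5 : D.momentumMap θ V (D.momentumPoint (ħ, z)) = (D.momentumPoint (ħ, Ψ ħ z)).2 := by
    rw [a5 z hz]
  have b6 : ((D.momentumPoint (ħ, z)).1, (D.momentumPoint (ħ, Ψ ħ z)).2) =
    D.momentumPoint (ħ, Ψ ħ z) := rfl
  simp only [Function.comp_apply, b5, b6, norm_pow, Real.norm_eq_abs, abs_norm]
    at b1 b2 b3 b4
  rw [abs_of_nonneg (a := ‖_‖ + _) (by positivity)] at b1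
  rw [abs_of_nonneg (a := |_| + _) (by positivity)] at b2
  rw [abs_of_nonneg (a := |_| ^ 3 + _) (by positivity)] at b4
  refine ⟨b1.trans ?_, b2.trans ?_, b3.trans ?_, b4.trans ?_⟩
  all_goals
    refine mul_le_mul_of_nonneg_right ?_ (by positivity)
    linarith

end LongTime

end HamSystem

/-! ### The number of steps and the accumulated drift -/

theorem Real.cos_ne_one_of_irrational {θ : ℝ} (hθ : Irrational (θ / (2 * Real.pi))) :
    Real.cos θ ≠ 1 := by
  intro h
  obtain ⟨n, rfl⟩ := (Real.cos_eq_one_iff θ).1 h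
  have h2 : (2 * Real.pi) ≠ 0 := by positivity
  rw [mul_div_cancel_right₀ _ h2] at hθ
  exact hθ ⟨n, by simp⟩

/-- The number of steps over which the adiabatic invariant controls the dynamics. -/
theorem isTheta_ceil_rpow_neg {N : ℝ} (hN : 0 < N) :
    (fun ħ : ℝ => ((⌈ħ ^ (-N)⌉₊ : ℕ) : ℝ)) =Θ[𝓝[>] (0 : ℝ)] fun ħ : ℝ => ħ ^ (-N) := by
  have h : ∀ᶠ ħ : ℝ in 𝓝[>] 0, 0 < ħ ∧ ħ < 1 :=
    (eventually_mem_nhdsWithin (a := (0 : ℝ)) (s := Ioi 0)).and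
      (mem_nhdsWithin_of_mem_nhds (gt_mem_nhds one_pos))
  constructor
  · refine IsBigO.of_bound 2 ?_
    filter_upwards [h] with ħ ⟨h0, h1⟩
    have h2 := Real.one_le_rpow_of_pos_of_le_one_of_nonpos h0 h1.le (neg_nonpos.2 hN.le)
    rw [Real.norm_of_nonneg (by positivity), Real.norm_of_nonneg (by positivity)]
    linarith [(Nat.ceil_lt_add_one (by positivity : 0 ≤ ħ ^ (-N))).le]
  · refine IsBigO.of_bound 1 ?_
    filter_upwards [h] with ħ ⟨h0, h1⟩
    rw [Real.norm_of_nonneg (by positivity), Real.norm_of_nonneg (by positivity), one_mul]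
    exact Nat.le_ceil _

/-- For ħ ≤ 1 one has 1 ≤ ħ^{-N}, so the ceiling plus one is at most 3ħ^{-N}, while ħ^{⌈N⌉} ≤ ħ^N.
-/
theorem ceil_rpow_neg_add_one_mul_pow_le {N ħ : ℝ} (hN : 0 < N) (h0 : 0 < ħ) (h1 : ħ ≤ 1) :
    ((⌈ħ ^ (-N)⌉₊ : ℝ) + 1) * ħ ^ (⌈N⌉₊ + 5) ≤ 3 * ħ ^ 5 := by
  have h2 := Real.one_le_rpow_of_pos_of_le_one_of_nonpos h0 h1 (neg_nonpos.2 hN.le)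
  have h3 : (⌈ħ ^ (-N)⌉₊ : ℝ) + 1 ≤ 3 * ħ ^ (-N) := by
    linarith [(Nat.ceil_lt_add_one (by positivity : 0 ≤ ħ ^ (-N))).le]
  have h4 : ħ ^ ⌈N⌉₊ ≤ ħ ^ N := by
    rw [← Real.rpow_natCast]
    exact Real.rpow_le_rpow_of_exponent_ge h0 h1 (Nat.le_ceil N)
  have h5 : ħ ^ (-N) * ħ ^ N = 1 := by rw [← Real.rpow_add h0]; simp
  calc ((⌈ħ ^ (-N)⌉₊ : ℝ) + 1) * ħ ^ (⌈N⌉₊ + 5) ≤ (3 * ħ ^ (-N)) * (ħ ^ N * ħ ^ 5) := by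
        rw [pow_add]; gcongr
    _ = 3 * ħ ^ 5 * (ħ ^ (-N) * ħ ^ N) := by ring
    _ = 3 * ħ ^ 5 := by rw [h5, mul_one]

theorem abs_iterate_le {α : Type*} {f : α → α} {a : α → ℝ} {x : α} {C : Set α} {ε : ℝ}
    (hC : PositivelyContained f C x) (ha : ∀ z ∈ C, |a (f z) - a z| ≤ ε) (k : ℕ) :
    |a (f^[k] x)| ≤ |a x| + k * ε := by
  induction k with
  | zero => simp
  | succ k ih =>
    have h := ha _ (hC k)
    rw [← Function.iterate_succ_apply' f] at h
    have h2 := abs_sub_abs_le_abs_sub (a (f^[k + 1] x)) (a (f^[k] x))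
    push_cast
    linarith

/-! ### Long-time control of the velocity -/

namespace HamSystem

section LongTime

variable {E : Type*} [NormedAddCommGroup E] [NormedSpace ℝ E] {D : HamSystem E} {θ : ℝ}
  [FiniteDimensional ℝ E]

/-- The velocity stays close to the Hamiltonian vector field along orbits in a compact set. -/
theorem IsSymplecticLorentzMap.exists_norm_iterate_le {Ψ : ℝ → E × E → E × E}
    (hΨ : D.IsSymplecticLorentzMap θ Ψ) (hθ : Irrational (θ / (2 * Real.pi)))
    {C : Set (E × E)} (hC : IsCompact C) (hCQ : C ⊆ D.Q ×ˢ univ) {N : ℝ} (hN : 0 < N)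
    {q v : ℝ → E} (hqv : ∀ᶠ ħ in 𝓝[>] (0 : ℝ), PositivelyContained (Ψ ħ) C (q ħ, v ħ))
    (hv : (fun ħ : ℝ => v ħ - D.XH (q ħ)) =O[𝓝[>] (0 : ℝ)] (fun ħ : ℝ => ħ ^ (1 / 2 : ℝ))) :
    ∃ M > 0, ∀ᶠ ħ in 𝓝[>] (0 : ℝ), 0 < ħ ∧ ħ < 1 ∧
      (∀ z ∈ C, ‖(Ψ ħ z).1 - (z.1 + ħ • D.XH z.1 +
        (ħ ^ 2 / 2) • fderiv ℝ D.XH z.1 (D.XH z.1))‖ ≤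
          M * (ħ ^ 3 + ‖ħ ^ 2 • (z.2 - D.XH z.1)‖)) ∧
      ∀ k : ℕ, k ≤ ⌈ħ ^ (-N)⌉₊ + 1 → (Ψ ħ)^[k] (q ħ, v ħ) ∈ C ∧
        ‖((Ψ ħ)^[k] (q ħ, v ħ)).2 - D.XH ((Ψ ħ)^[k] (q ħ, v ħ)).1‖ ≤ M * ħ ^ (1 / 2 : ℝ) := by
  -- With drift of order ⌈N⌉ + 5 per step, the total over about ħ^{-N} steps is O(ħ⁵), the square of
  -- the initial size ħ^{5/2} of p.
  obtain ⟨a, M, hM, h⟩ := hΨ.exists_estimates hθ (Real.cos_ne_one_of_irrational hθ) hC hCQ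
    (⌈N⌉₊ + 5)
  obtain ⟨c, hc, hv⟩ := hv.exists_pos
  set B : ℝ := M * (M * (c + 1) ^ 2 + 3 * M + 1) with hB
  refine ⟨M + B + 1, by positivity, ?_⟩
  filter_upwards [mem_nhdsWithin_of_mem_nhds h, hqv, hv.bound,
    eventually_mem_nhdsWithin (a := (0 : ℝ)) (s := Ioi 0),
    mem_nhdsWithin_of_mem_nhds (gt_mem_nhds (one_pos : (0 : ℝ) < 1))] with ħ h hk hv0 h0 h1
  have h0 : 0 < ħ := h0
  simp only [abs_of_pos h0] at h
  refine ⟨h0, h1, fun z hz => ((h z hz).2.2.2).trans ?_, fun k hkN => ⟨hk k, ?_⟩⟩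
  · have hB0 : 0 < B := by positivity
    exact mul_le_mul_of_nonneg_right (by linarith) (by positivity)
  have hn : ∀ x : E, ‖ħ ^ 2 • x‖ = ħ ^ 2 * ‖x‖ := fun x => by
    rw [norm_smul, Real.norm_of_nonneg (by positivity)]
  simp only [hn] at h
  -- In terms of s = ħ^{1/2} all the exponents are integers: p is O(s⁵) and the invariant O(s¹⁰).
  set s := ħ ^ (1 / 2 : ℝ) with hs
  have hs0 : 0 < s := by positivity
  have hs2 : ħ = s ^ 2 := by rw [hs, ← Real.rpow_natCast, ← Real.rpow_mul h0.le]; norm_num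
  have hs1 : s < 1 := by
    by_contra! hcon
    nlinarith
  rw [Real.norm_of_nonneg hs0.le] at hv0
  have a0 : |a ħ (q ħ, v ħ)| ≤ M * (c + 1) ^ 2 * s ^ 10 := by
    refine ((h _ (hk 0)).1).trans ?_
    simp only [Function.iterate_zero, id]
    have e : ħ ^ 2 * ‖v ħ - D.XH (q ħ)‖ + ħ ^ 3 ≤ (c + 1) * s ^ 5 := by
      have e1 : ħ ^ 2 * ‖v ħ - D.XH (q ħ)‖ ≤ ħ ^ 2 * (c * s) := by gcongr
      have e2 : ħ ^ 2 * (c * s) = c * s ^ 5 := by rw [hs2]; ring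
      have e3 : ħ ^ 3 = s ^ 6 := by rw [hs2]; ring
      have e4 : s ^ 6 ≤ s ^ 5 := pow_le_pow_of_le_one hs0.le hs1.le (by norm_num)
      linarith
    calc M * (ħ ^ 2 * ‖v ħ - D.XH (q ħ)‖ + ħ ^ 3) ^ 2 ≤ M * ((c + 1) * s ^ 5) ^ 2 := by gcongr
      _ = _ := by ring
  have ak := abs_iterate_le hk (fun z hz => (h z hz).2.2.1) k
  have hkε : (k : ℝ) * (M * ħ ^ (⌈N⌉₊ + 5)) ≤ 3 * M * s ^ 10 := by
    have e1 : (k : ℝ) ≤ (⌈ħ ^ (-N)⌉₊ : ℝ) + 1 := by exact_mod_cast hkN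
    have e2 := ceil_rpow_neg_add_one_mul_pow_le hN h0 h1.le
    calc (k : ℝ) * (M * ħ ^ (⌈N⌉₊ + 5))
        ≤ ((⌈ħ ^ (-N)⌉₊ : ℝ) + 1) * (M * ħ ^ (⌈N⌉₊ + 5)) := by gcongr
      _ = M * (((⌈ħ ^ (-N)⌉₊ : ℝ) + 1) * ħ ^ (⌈N⌉₊ + 5)) := by ring
      _ ≤ M * (3 * ħ ^ 5) := by gcongr
      _ = _ := by rw [hs2]; ring
  set z := (Ψ ħ)^[k] (q ħ, v ħ)
  have hp := (h z (hk k)).2.1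
  have h6 : ħ ^ 6 ≤ s ^ 10 := by
    rw [hs2, ← pow_mul]
    exact pow_le_pow_of_le_one hs0.le hs1.le (by norm_num)
  have hp2 : (ħ ^ 2 * ‖z.2 - D.XH z.1‖) ^ 2 ≤ B * s ^ 10 :=
    hp.trans (by
      rw [hB, mul_assoc]
      refine mul_le_mul_of_nonneg_left ?_ hM.le
      linarith)
  have hB0 : 0 < B := by positivity
  have e5 : (ħ ^ 2 * ‖z.2 - D.XH z.1‖) ^ 2 = s ^ 8 * ‖z.2 - D.XH z.1‖ ^ 2 := by
    rw [hs2]; ring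
  have hp3 : ‖z.2 - D.XH z.1‖ ^ 2 ≤ B * s ^ 2 := by
    rw [e5] at hp2
    refine le_of_mul_le_mul_left (hp2.trans (le_of_eq ?_)) (pow_pos hs0 8)
    ring
  refine abs_le_of_sq_le_sq' ?_ (by positivity) |>.2
  refine hp3.trans ?_
  rw [mul_pow]
  gcongr
  nlinarith

end LongTime

end HamSystem

/-! ### The main theorem -/

theorem mainTheorem11 {E : Type*} [NormedAddCommGroup E] [NormedSpace ℝ E] [FiniteDimensional ℝ E]
    (D : HamSystem E) (θ₀ : ℝ) (hθ₀ : Irrational (θ₀ / (2 * Real.pi))) :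
    (∃ Ψ : ℝ → E × E → E × E, D.IsSymplecticLorentzMap θ₀ Ψ) ∧
    ∀ N : ℝ, 0 < N → ∃ kstar : ℝ → ℕ,
      (fun ħ : ℝ => (kstar ħ : ℝ)) =Θ[𝓝[>] (0 : ℝ)] (fun ħ : ℝ => ħ ^ (-N)) ∧
      ∀ Ψ : ℝ → E × E → E × E, D.IsSymplecticLorentzMap θ₀ Ψ →
      ∀ C : Set (E × E), IsCompact C → C ⊆ D.Q ×ˢ (univ : Set E) →
      ∀ q v : ℝ → E,
        (∀ᶠ ħ in 𝓝[>] (0 : ℝ), PositivelyContained (Ψ ħ) C (q ħ, v ħ)) →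
        (fun ħ : ℝ => v ħ - D.XH (q ħ)) =O[𝓝[>] (0 : ℝ)] (fun ħ : ℝ => ħ ^ (1 / 2 : ℝ)) →
        ∃ M : ℝ, ∃ ħ₀ : ℝ, 0 < ħ₀ ∧ ∀ ħ : ℝ, 0 < ħ → ħ < ħ₀ → ∀ k : ℕ, k ≤ kstar ħ →
          ∀ z z' : E × E, z = (Ψ ħ)^[k] (q ħ, v ħ) → z' = (Ψ ħ)^[k + 1] (q ħ, v ħ) →
            ‖z'.1 - (z.1 + ħ • D.XH z.1
                + (ħ ^ 2 / 2) • fderiv ℝ D.XH z.1 (D.XH z.1))‖ ≤ M * ħ ^ (5 / 2 : ℝ) ∧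
            ‖z'.2 - D.XH z'.1‖ ≤ M * ħ ^ (1 / 2 : ℝ) := by
  refine ⟨D.exists_isSymplecticLorentzMap (Real.cos_ne_one_of_irrational hθ₀), fun N hN =>
    ⟨fun ħ => ⌈ħ ^ (-N)⌉₊, isTheta_ceil_rpow_neg hN, fun Ψ hΨ C hC hCQ q v hqv hv => ?_⟩⟩
  obtain ⟨M, hM, h⟩ := hΨ.exists_norm_iterate_le hθ₀ hC hCQ hN hqv hv
  obtain ⟨ħ₀, hħ₀, h⟩ := mem_nhdsGT_iff_exists_Ioo_subset.1 h
  refine ⟨M * (1 + M) + M, ħ₀, hħ₀, fun ħ h0 hlt k hk z z' hz hz' => ?_⟩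
  obtain ⟨-, h1, hstep, hvel⟩ := h ⟨h0, hlt⟩
  have e5 : ħ ^ (5 / 2 : ℝ) = ħ ^ 2 * ħ ^ (1 / 2 : ℝ) := by
    rw [← Real.rpow_natCast, ← Real.rpow_add h0]; norm_num
  have e3 : ħ ^ 3 ≤ ħ ^ (5 / 2 : ℝ) := by
    rw [← Real.rpow_natCast]
    exact Real.rpow_le_rpow_of_exponent_ge h0 h1.le (by norm_num)
  have hk : k ≤ ⌈ħ ^ (-N)⌉₊ := hk
  obtain ⟨hzC, hzv⟩ := hvel k (by omega)
  -- The velocity is needed one step beyond the last k, which is why the control extends to ⌈ħ^{-N}⌉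
  -- + 1 steps.
  obtain ⟨-, hzv'⟩ := hvel (k + 1) (by omega)
  rw [← hz] at hzC hzv
  rw [← hz'] at hzv'
  have hzz : z' = Ψ ħ z := by rw [hz, hz', Function.iterate_succ_apply']
  constructor
  · rw [hzz]
    refine (hstep z hzC).trans ?_
    have e : ‖ħ ^ 2 • (z.2 - D.XH z.1)‖ ≤ M * ħ ^ (5 / 2 : ℝ) := by
      rw [norm_smul, Real.norm_of_nonneg (by positivity), e5]
      calc ħ ^ 2 * ‖z.2 - D.XH z.1‖ ≤ ħ ^ 2 * (M * ħ ^ (1 / 2 : ℝ)) := by gcongr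
        _ = _ := by ring
    calc M * (ħ ^ 3 + ‖ħ ^ 2 • (z.2 - D.XH z.1)‖)
        ≤ M * (ħ ^ (5 / 2 : ℝ) + M * ħ ^ (5 / 2 : ℝ)) := by gcongr
      _ = M * (1 + M) * ħ ^ (5 / 2 : ℝ) := by ring
      _ ≤ _ := by gcongr; linarith
  · refine hzv'.trans ?_
    gcongr
    have : 0 ≤ M * (1 + M) := by positivity
    linarith
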